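/- **Conventions.** Let $V$ be a category. A *$V$-graph* $X$ is a set $X_0$ of objects with an object $X(a,b)$ of $V$ for all $a,b\in X_0$; a morphism $f:X\to Y$ is a function $f:X_0\to Y_0$ with maps $X(a,b)\to Y(fa,fb)$; $\mathcal GV$ is the category of $V$-graphs. A functor $H$ induces $\mathcal G(H)$ by $(\mathcal G(H)X)_0=X_0$, $\mathcal G(H)X(a,b)=H(X(a,b))$, and a monad $(T,\eta,\mu)$ on $V$ induces a monad $\mathcal G(T)$ on $\mathcal GV$. Let $MV=\coprod_{n\ge 0}V^n$. A *multitensor* $(E,u,\sigma)$ on $V$ is a functor $E:MV\to V$, with values written $\mathop{E}_{i}X_i=E(X_1,\dots,X_n)$ and restriction $E_n$ to $V^n$, together with natural maps $u_X:X\to E_1X$ and $\sigma:\mathop{E}_i\mathop{E}_jX_{ij}\to \mathop{E}_{ij}X_{ij}$ (for all sequences of sequences, with $\mathop{E}_{ij}X_{ij}$ the value of $E$ at the concatenated sequence) such that $\sigma\circ u_{E_iX_i}=\mathrm{id}$, $\sigma\circ \mathop{E}_iu_{X_i}=\mathrm{id}$ and $\sigma\circ\mathop{E}_i\sigma=\sigma\circ\sigma$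 as maps $\mathop{E}_i\mathop{E}_j\mathop{E}_kX_{ijk}\to\mathop{E}_{ijk}X_{ijk}$. A *multitensor map* $E\to F$ is a natural family $E(X_i)\to F(X_i)$ compatible with units and substitutions. The functor $E_1$ is a monad on $V$, with unit $u$ and multiplication given by $\sigma$. $E$ is *distributive* if each $E_n$ preserves coproducts in each variable. An *$E$-category* is a $V$-graph $X$ with maps $\kappa_x:\mathop{E}_iX(x_{i-1},x_i)\to X(x_0,x_n)$ for all $n\geq 0$ and all sequences $x=(x_0,\dots,x_n)$ of objects, such that $\kappa_{(a,b)}u_{X(a,b)}=\mathrm{id}$ and, for every $(x_0,\dots,x_m)$ and all sequences from $x_{i-1}$ to $x_i$ $(1\le i\le m)$, the maps $\kappa\circ\mathop{E}_i\kappa$ and $\kappa\circ\sigma$ agree, where the last $\kappa$ is that of the concatenated sequence. $E$-functors are the morphisms of graphs commuting with the $\kappa$'s; $E\text{-Cat}$ is the resulting category and $U^E:E\text{-Cat}\to\mathcal GV$ is the forgetful functor. If $V$ has coproducts and $E$ is distributive, $\Gamma(E)$ denotes the monad on $\mathcal GV$ with $\Gamma(E)(X)_0=X_0$ and $\Gamma(E)(X)(a,b)=\coprod_{a=x_0,\dots,x_n=b}\mathop{E}_iX(x_{i-1},x_i)$,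 with coproduct inclusions $k_x$. Its unit is the identity on objects and is $k_{(a,b)}u$ on homs. Its multiplication is the identity on objects and, on homs, is the unique map whose composite with $k\circ\mathop{E}_i k$ on each summand $\mathop{E}_i\mathop{E}_jX(x_{ij-1},x_{ij})$ is $k\sigma$. **Theorem.** Let $(E,u,\sigma)$ be a multitensor and $(T,\eta,\mu)$ a monad on a category $V$. The following data are in bijection. 1. Monoidal monad coherences for $T$: natural maps $\tau:\mathop{E}_iTX_i\to T\mathop{E}_iX_i$ (for all finite sequences) with $$\tau\circ uT=Tu,\qquad T\sigma\circ\tau E_j\circ \mathop{E}_i\tau=\tau\circ\sigma T,\qquad \tau\circ \mathop{E}_i\eta=\eta \mathop{E}_i,\qquad \tau\circ \mathop{E}_i\mu=\mu \mathop{E}_i\circ T\tau\circ\tau T .$$ 2. Natural maps $\sigma':T\mathop{E}_iT\mathop{E}_jX_{ij}\to T\mathop{E}_{ij}X_{ij}$ making $(TE,u',\sigma')$, with $u'_X=\eta_{E_1X}u_X$, a multitensor such that $\eta E:E\to TE$ is a multitensor map, $Tu:T\to TE_1$ is a morphism of monads, and the composite $T\mathop{E}_i\xrightarrow{Tu\eta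 \mathop{E}_i}TE_1T\mathop{E}_i\xrightarrow{\sigma'}T\mathop{E}_i$ is the identity. The bijection sends $\tau$ to $\sigma'=(\mu\sigma)\circ(T\tau E)$, that is, to $T\mathop{E}_iT\mathop{E}_jX_{ij}\xrightarrow{T\tau}TT\mathop{E}_i\mathop{E}_jX_{ij}\xrightarrow{\mu}T\mathop{E}_i\mathop{E}_jX_{ij}\xrightarrow{T\sigma}T\mathop{E}_{ij}X_{ij}$. If in addition $V$ has coproducts and $E$ is distributive, then these data are also in bijection with 3. natural families of morphisms $\lambda_X:\Gamma(E)\mathcal G(T)(X)\to\mathcal G(T)\Gamma(E)(X)$ of $\mathcal GV$, each the identity on objects, that form a distributive law of the monad $\mathcal G(T)$ over the monad $\Gamma(E)$ (compatibility with both units and both multiplications); 4. liftings of $\mathcal G(T)$ to $E\text{-Cat}$: monads $(T',\eta',\mu')$ on $E\text{-Cat}$ with $\mathcal G(T)U^E=U^ET'$, $\eta U^E=U^E\eta'$ and $\mu U^E=U^E\mu'$, where $\eta,\mu$ here denote the unit and multiplication of $\mathcal G(T)$. The bijection from 1 to 3 sends $\tau$ to the $\lambda$ whose restriction to the summand of $x=(x_0,\dots,x_n)$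 is $T(k_x)\circ\tau:\mathop{E}_iTX(x_{i-1},x_i)\to T\coprod_{x}\mathop{E}_iX(x_{i-1},x_i)$. The bijection from 1 to 4 sends $\tau$ to a lifting for which $T'X$, for $X$ an $E$-category with compositions $\kappa$, is the $V$-graph $\mathcal G(T)(X)$ with compositions $T(\kappa_x)\circ\tau:\mathop{E}_iTX(x_{i-1},x_i)\to TX(x_0,x_n)$. For any corresponding $\sigma'$ and $T'$, there is an isomorphism of categories $$(TE)\text{-Cat}\;\cong\;(E\text{-Cat})^{T'}$$ between categories enriched in $(TE,u',\sigma')$ and $T'$-algebras, commuting with the forgetful functors to $\mathcal GV$. -/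

import Mathlib

open CategoryTheory CategoryTheory.Limits

universe w v u

namespace EnrichedMultitensor

/-! ### Sequences of sequences and their concatenation -/

/-- Concatenation of a sequence of sequences: `(Z_{ij})_{ij}` in lexicographic order. -/
abbrev flat {α : Sort*} {m : ℕ} {n : Fin m → ℕ} (Z : ∀ i, Fin (n i) → α) :
    Fin (∑ i, n i) → α :=
  fun l => Z (finSigmaFinEquiv.symm l).1 (finSigmaFinEquiv.symm l).2

theorem flat_apply {α : Sort*} {m : ℕ} {n : Fin m → ℕ} (Z : ∀ i, Fin (n i) → α)
    (s : (i : Fin m) × Fin (n i)) : flat Z (finSigmaFinEquiv s) = Z s.1 s.2 := by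
  have h := finSigmaFinEquiv.symm_apply_apply s
  exact congrArg (fun t : (i : Fin m) × Fin (n i) => Z t.1 t.2) h

theorem sum_castLE_mono {m : ℕ} (n : Fin m → ℕ) {k k' : ℕ} (h : k ≤ k') (h' : k' ≤ m) :
    ∑ x : Fin k, n (Fin.castLE (h.trans h') x) ≤ ∑ x : Fin k', n (Fin.castLE h' x) := by
  obtain ⟨d, rfl⟩ := Nat.exists_eq_add_of_le h
  rw [Fin.sum_univ_add]
  exact Nat.le_add_right _ _

theorem finSigma_lt {m : ℕ} {n : Fin m → ℕ} {i i' : Fin m} (h : i < i')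
    (j : Fin (n i)) (j' : Fin (n i')) :
    finSigmaFinEquiv (⟨i, j⟩ : (i : Fin m) × Fin (n i)) < finSigmaFinEquiv ⟨i', j'⟩ := by
  rw [Fin.lt_def, finSigmaFinEquiv_apply, finSigmaFinEquiv_apply]
  have h1 := sum_castLE_mono n (show i.1 + 1 ≤ i'.1 from h) i'.2.le
  rw [Fin.sum_univ_castSucc] at h1
  have h2 := j.2
  have h3 : n (Fin.castLE (show i.1 + 1 ≤ m by omega) (Fin.last i.1)) = n i := rfl
  have h4 : ∑ x : Fin i.1, n (Fin.castLE (show i.1 + 1 ≤ m by omega) x.castSucc)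
    = ∑ x : Fin i.1, n (Fin.castLE i.2.le x) := rfl
  dsimp only at *
  omega

theorem finSigma_lt' {m : ℕ} {n : Fin m → ℕ} {i : Fin m}
    {j j' : Fin (n i)} (h : j < j') :
    finSigmaFinEquiv (⟨i, j⟩ : (i : Fin m) × Fin (n i)) < finSigmaFinEquiv ⟨i, j'⟩ := by
  rw [Fin.lt_def, finSigmaFinEquiv_apply, finSigmaFinEquiv_apply]
  have : j.1 < j'.1 := h
  dsimp only
  omega

theorem finSigma_symm_lt {m : ℕ} {n : Fin m → ℕ} {l l' : Fin (∑ i, n i)} (h : l < l') :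
    (finSigmaFinEquiv.symm l).1 < (finSigmaFinEquiv.symm l').1 ∨
      ∃ (i : Fin m) (j j' : Fin (n i)), j < j' ∧ finSigmaFinEquiv.symm l = ⟨i, j⟩ ∧
        finSigmaFinEquiv.symm l' = ⟨i, j'⟩ := by
  obtain ⟨⟨i, j⟩, rfl⟩ := finSigmaFinEquiv.surjective l
  obtain ⟨⟨i', j'⟩, rfl⟩ := finSigmaFinEquiv.surjective l'
  rw [Equiv.symm_apply_apply, Equiv.symm_apply_apply]
  rcases lt_trichotomy i i' with h1 | h1 | h1
  · exact Or.inl h1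
  · subst h1
    rcases lt_trichotomy j j' with h2 | h2 | h2
    · exact Or.inr ⟨i, j, j', h2, rfl, rfl⟩
    · subst h2; exact absurd h (lt_irrefl _)
    · exact absurd h (finSigma_lt' h2).asymm
  · exact absurd h (finSigma_lt h1 _ _).asymm

theorem strictMono_fin_eq {N N' : ℕ} (h : N = N') (f : Fin N → Fin N') (hf : StrictMono f) :
    f = Fin.cast h := by
  subst h
  have e : f = (StrictMono.orderIsoOfSurjective f hf
    (Finite.surjective_of_injective hf.injective) : Fin N → Fin N) := rfl
  rw [e, Subsingleton.elim (StrictMono.orderIsoOfSurjective f hf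
    (Finite.surjective_of_injective hf.injective)) (OrderIso.refl _)]
  rfl

theorem sum_flat {m : ℕ} {n : Fin m → ℕ} (p : ∀ i, Fin (n i) → ℕ) :
    ∑ l, flat p l = ∑ i, ∑ j, p i j := by
  rw [← Equiv.sum_comp finSigmaFinEquiv, Fintype.sum_sigma]
  exact Finset.sum_congr rfl fun i _ => Finset.sum_congr rfl fun j _ => flat_apply p ⟨i, j⟩

/-- Concatenation is associative. -/
theorem flat_flat {α : Sort*} {m : ℕ} {n : Fin m → ℕ} (p : ∀ i, Fin (n i) → ℕ)
    (Z : ∀ i (j : Fin (n i)), Fin (p i j) → α) (l : Fin (∑ i, ∑ j, p i j)) :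
    flat (fun i => flat (Z i)) l =
      flat (n := flat p)
        (fun r => Z (finSigmaFinEquiv.symm r).1 (finSigmaFinEquiv.symm r).2)
        (Fin.cast (sum_flat p).symm l) := by
  let g : Fin (∑ r, flat p r) → Fin (∑ i, ∑ j, p i j) := fun t =>
    finSigmaFinEquiv (⟨(finSigmaFinEquiv.symm (finSigmaFinEquiv.symm t).1).1,
      finSigmaFinEquiv (⟨(finSigmaFinEquiv.symm (finSigmaFinEquiv.symm t).1).2,
        (finSigmaFinEquiv.symm t).2⟩ : (j : Fin (n _)) × Fin (p _ j))⟩ :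
          (i : Fin m) × Fin (∑ j, p i j))
  have hg : StrictMono g := by
    intro t t' htt
    rcases finSigma_symm_lt htt with h | ⟨r, k, k', hk, h1, h2⟩
    · rcases finSigma_symm_lt h with h' | ⟨i, j, j', hj, h1, h2⟩
      · exact finSigma_lt h' _ _
      · have aux : ∀ (s s' : (i : Fin m) × Fin (n i)) (k : Fin (p s.1 s.2))
            (k' : Fin (p s'.1 s'.2)), s = ⟨i, j⟩ → s' = ⟨i, j'⟩ →
            finSigmaFinEquiv (⟨s.1, finSigmaFinEquiv
              (⟨s.2, k⟩ : (j : Fin (n _)) × Fin (p _ j))⟩ : (i : Fin m) × Fin (∑ j, p i j)) <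
            finSigmaFinEquiv ⟨s'.1, finSigmaFinEquiv ⟨s'.2, k'⟩⟩ := by
          intro s s' k k' hs hs'
          subst hs hs'
          exact finSigma_lt' (finSigma_lt hj _ _)
        exact aux _ _ _ _ h1 h2
    · simp only [g]
      rw [h1, h2]
      exact finSigma_lt' (finSigma_lt' hk)
  have key := strictMono_fin_eq (sum_flat p) g hg
  have hl : l = g (Fin.cast (sum_flat p).symm l) := by rw [key]; rfl
  conv_lhs => rw [hl]
  simp only [g]
  rw [flat_apply, flat_apply]

theorem flat_unit_left {α : Sort*} {n : ℕ} (Z : Fin n → α) (l : Fin (∑ _i : Fin 1, n)) :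
    flat (fun _ : Fin 1 => Z) l = Z (Fin.cast (by simp) l) := by
  obtain ⟨s, rfl⟩ := finSigmaFinEquiv.surjective l
  rw [flat_apply]
  congr 1
  ext
  exact (finSigmaFinEquiv_one s).symm

theorem flat_unit_right {α : Sort*} {n : ℕ} (Z : Fin n → α) (l : Fin (∑ _i : Fin n, 1)) :
    flat (fun (i : Fin n) (_ : Fin 1) => Z i) l = Z (Fin.cast (by simp) l) := by
  obtain ⟨s, rfl⟩ := finSigmaFinEquiv.surjective l
  rw [flat_apply]
  congr 1
  ext
  simp

/-! ### Finite sequences of objects with prescribed end points -/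

/-- A sequence `a = x_0, …, x_n = b` of elements of `O`, for some `n : ℕ`. -/
structure ObjSeq (O : Type w) (a b : O) : Type w where
  /-- the length `n` -/
  len : ℕ
  /-- the entries `x_0, …, x_n` -/
  vtx : Fin (len + 1) → O
  head : vtx 0 = a
  last : vtx (Fin.last len) = b

namespace ObjSeq

variable {O : Type w}

theorem ext_of {a b : O} {p q : ObjSeq O a b} (h : p.len = q.len)
    (hv : ∀ i : Fin p.len, p.vtx i.succ = q.vtx (Fin.cast h i).succ) : p = q := by
  obtain ⟨n, x, hx, hx'⟩ := p
  obtain ⟨m, y, hy, hy'⟩ := q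
  dsimp only at h
  subst h
  have : x = y := by
    funext i
    refine Fin.cases ?_ (fun i => ?_) i
    · rw [hx, hy]
    · exact hv i
  subst this
  rfl

/-- The sequence `(a, b)` of length one. -/
def single (a b : O) : ObjSeq O a b where
  len := 1
  vtx := ![a, b]
  head := rfl
  last := rfl

/-- Image of a sequence under a function. -/
def map {O' : Type w} (f : O → O') {a b : O} (p : ObjSeq O a b) : ObjSeq O' (f a) (f b) where
  len := p.len
  vtx i := f (p.vtx i)
  head := congrArg f p.head
  last := congrArg f p.last

/-- Change of the end points along equalities. -/
def copy {a b a' b' : O} (p : ObjSeq O a b) (ha : a = a') (hb : b = b') : ObjSeq O a' b' where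
  len := p.len
  vtx := p.vtx
  head := p.head.trans ha
  last := p.last.trans hb

/-- The underlying vertices of the concatenation `x_{ij}` of a doubly nested sequence. -/
def concatVtx {a b : O} (x : ObjSeq O a b)
    (y : ∀ i : Fin x.len, ObjSeq O (x.vtx i.castSucc) (x.vtx i.succ)) :
    Fin ((∑ i, (y i).len) + 1) → O :=
  Fin.cons a (flat fun i j => (y i).vtx j.succ)

theorem psum_lt {m : ℕ} (n : Fin m → ℕ) (k : Fin (m + 1)) :
    ∑ t : Fin k.1, n (Fin.castLE (Nat.le_of_lt_succ k.2) t) < (∑ i, n i) + 1 := by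
  have h := sum_castLE_mono n (Nat.le_of_lt_succ k.2) le_rfl
  exact Nat.lt_succ_of_le h

theorem concatVtx_succ {a b : O} (x : ObjSeq O a b)
    (y : ∀ i : Fin x.len, ObjSeq O (x.vtx i.castSucc) (x.vtx i.succ)) (i : Fin x.len)
    (j : Fin (y i).len) :
    x.concatVtx y (finSigmaFinEquiv
      (⟨i, j⟩ : (i : Fin x.len) × Fin (y i).len)).succ = (y i).vtx j.succ := by
  unfold concatVtx
  rw [Fin.cons_succ, flat_apply]

theorem concatVtx_psum {a b : O} (x : ObjSeq O a b)
    (y : ∀ i : Fin x.len, ObjSeq O (x.vtx i.castSucc) (x.vtx i.succ)) (k : Fin (x.len + 1)) :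
    x.concatVtx y ⟨_, psum_lt (fun i => (y i).len) k⟩ = x.vtx k := by
  induction k using Fin.induction with
  | zero => exact x.head.symm
  | succ i ih =>
    have hs : ∑ t : Fin (i.1 + 1), (y (Fin.castLE (Nat.le_of_lt_succ i.succ.2) t)).len
        = (∑ t : Fin i.1, (y (Fin.castLE i.2.le t)).len) + (y i).len := by
      rw [Fin.sum_univ_castSucc]
      rfl
    rcases Nat.eq_zero_or_pos (y i).len with h0 | h0
    · have e : (⟨_, psum_lt (fun i => (y i).len) i.succ⟩ : Fin ((∑ i, (y i).len) + 1))
          = ⟨_, psum_lt (fun i => (y i).len) i.castSucc⟩ := by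
        ext
        simp only [Fin.val_succ]
        rw [hs, h0]
        rfl
      rw [e, ih]
      refine (y i).head.symm.trans (Eq.trans (congrArg (y i).vtx ?_) (y i).last)
      ext
      simp [h0]
    · have e : (⟨_, psum_lt (fun i => (y i).len) i.succ⟩ : Fin ((∑ i, (y i).len) + 1))
          = (finSigmaFinEquiv (⟨i, ⟨(y i).len - 1, by omega⟩⟩ :
              (i : Fin x.len) × Fin (y i).len)).succ := by
        ext
        refine hs.trans ?_
        rw [Fin.val_succ, finSigmaFinEquiv_apply]
        dsimp only
        omega
      rw [e, concatVtx_succ]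
      refine Eq.trans (congrArg (y i).vtx ?_) (y i).last
      ext
      simp
      omega

theorem concatVtx_castSucc {a b : O} (x : ObjSeq O a b)
    (y : ∀ i : Fin x.len, ObjSeq O (x.vtx i.castSucc) (x.vtx i.succ)) (i : Fin x.len)
    (j : Fin (y i).len) :
    x.concatVtx y (finSigmaFinEquiv
      (⟨i, j⟩ : (i : Fin x.len) × Fin (y i).len)).castSucc = (y i).vtx j.castSucc := by
  obtain ⟨j, hj⟩ := j
  cases j with
  | zero =>
    have e : (finSigmaFinEquiv (⟨i, ⟨0, hj⟩⟩ : (i : Fin x.len) × Fin (y i).len)).castSucc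
        = ⟨_, psum_lt (fun i => (y i).len) i.castSucc⟩ := by
      ext
      rw [Fin.val_castSucc, finSigmaFinEquiv_apply]
      rfl
    rw [e, concatVtx_psum]
    exact (y i).head.symm
  | succ j =>
    have e : (finSigmaFinEquiv (⟨i, ⟨j + 1, hj⟩⟩ : (i : Fin x.len) × Fin (y i).len)).castSucc
        = (finSigmaFinEquiv (⟨i, ⟨j, by omega⟩⟩ : (i : Fin x.len) × Fin (y i).len)).succ := by
      ext
      rw [Fin.val_castSucc, Fin.val_succ, finSigmaFinEquiv_apply, finSigmaFinEquiv_apply]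
      rfl
    rw [e, concatVtx_succ]
    rfl

/-- Concatenation of a doubly nested sequence: an outer sequence `x_0, …, x_m` and, for each `i`,
an inner sequence from `x_{i-1}` to `x_i`. -/
def concat {a b : O} (x : ObjSeq O a b)
    (y : ∀ i : Fin x.len, ObjSeq O (x.vtx i.castSucc) (x.vtx i.succ)) : ObjSeq O a b where
  len := ∑ i, (y i).len
  vtx := x.concatVtx y
  head := rfl
  last := by
    have h := x.concatVtx_psum y (Fin.last x.len)
    rw [x.last] at h
    exact h

theorem concat_castSucc {a b : O} (x : ObjSeq O a b)
    (y : ∀ i : Fin x.len, ObjSeq O (x.vtx i.castSucc) (x.vtx i.succ))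
    (l : Fin (∑ i, (y i).len)) :
    (y (finSigmaFinEquiv.symm l).1).vtx (finSigmaFinEquiv.symm l).2.castSucc
      = (x.concat y).vtx (Fin.castSucc l) := by
  obtain ⟨⟨i, j⟩, rfl⟩ := finSigmaFinEquiv.surjective l
  rw [Equiv.symm_apply_apply]
  exact (x.concatVtx_castSucc y i j).symm

theorem concat_succ {a b : O} (x : ObjSeq O a b)
    (y : ∀ i : Fin x.len, ObjSeq O (x.vtx i.castSucc) (x.vtx i.succ))
    (l : Fin (∑ i, (y i).len)) :
    (y (finSigmaFinEquiv.symm l).1).vtx (finSigmaFinEquiv.symm l).2.succ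
      = (x.concat y).vtx (Fin.succ l) := rfl

theorem single_castSucc (a b : O) (i : Fin 1) : (single a b).vtx (Fin.castSucc i) = a := by
  rw [Subsingleton.elim i 0]
  rfl

theorem single_succ (a b : O) (i : Fin 1) : (single a b).vtx (Fin.succ i) = b := by
  rw [Subsingleton.elim i 0]
  rfl

theorem concat_single_left {a b : O} (p : ObjSeq O a b) :
    (single a b).concat (fun i => p.copy (single_castSucc a b i).symm (single_succ a b i).symm)
      = p :=
  ext_of (show ∑ _i : Fin 1, p.len = p.len by simp) fun i =>
    flat_unit_left (fun j : Fin p.len => p.vtx j.succ) i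

theorem concat_single_right {a b : O} (p : ObjSeq O a b) :
    p.concat (fun i => single (p.vtx i.castSucc) (p.vtx i.succ)) = p :=
  ext_of (show ∑ _i : Fin p.len, 1 = p.len by simp) fun l => by
    refine Eq.trans ?_ (flat_unit_right (fun j : Fin p.len => p.vtx j.succ) l)
    exact single_succ (p.vtx (finSigmaFinEquiv.symm l).1.castSucc) _ (finSigmaFinEquiv.symm l).2

theorem concat_concat {a b : O} (x : ObjSeq O a b)
    (y : ∀ i : Fin x.len, ObjSeq O (x.vtx i.castSucc) (x.vtx i.succ))
    (z : ∀ (i : Fin x.len) (j : Fin (y i).len),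
      ObjSeq O ((y i).vtx j.castSucc) ((y i).vtx j.succ)) :
    x.concat (fun i => (y i).concat (z i)) =
      (x.concat y).concat (fun l => (z (finSigmaFinEquiv.symm l).1 (finSigmaFinEquiv.symm l).2).copy
        (concat_castSucc x y l) (concat_succ x y l)) :=
  ext_of (sum_flat fun i j => (z i j).len).symm fun l =>
    flat_flat (fun i j => (z i j).len) (fun i j k => (z i j).vtx k.succ) l

theorem concat_map_vtx {O' : Type w} (f : O → O') {a b : O} (x : ObjSeq O a b)
    (y : ∀ i : Fin x.len, ObjSeq O (x.vtx i.castSucc) (x.vtx i.succ))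
    (l : Fin ((∑ i, (y i).len) + 1)) :
    ((x.map f).concat (fun i => (y i).map f)).vtx l = f ((x.concat y).vtx l) := by
  refine Fin.cases ?_ (fun l => ?_) l <;> rfl

theorem concat_map {O' : Type w} (f : O → O') {a b : O} (x : ObjSeq O a b)
    (y : ∀ i : Fin x.len, ObjSeq O (x.vtx i.castSucc) (x.vtx i.succ)) :
    (x.map f).concat (fun i => (y i).map f) = (x.concat y).map f :=
  ext_of rfl fun _ => rfl

end ObjSeq

/-! ### Multitensors -/

section Tensor

variable {V : Type u} [Category.{v} V]

/-- The underlying data of a functor `M V ⥤ V`, where `M V` is the category of finite sequences of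
objects of `V` and length preserving sequences of maps: for each `n` a functor `Vⁿ ⥤ V`. -/
abbrev TensorFunctor (V : Type u) [Category.{v} V] := ∀ n : ℕ, (Fin n → V) ⥤ V

/-- The action of `E` on a sequence of maps. -/
abbrev tmap (E : TensorFunctor V) {n : ℕ} {X Y : Fin n → V} (f : ∀ i, X i ⟶ Y i) :
    (E n).obj X ⟶ (E n).obj Y :=
  (E n).map f

theorem tobj_congr (E : TensorFunctor V) {n n' : ℕ} (h : n = n') {X : Fin n → V} {Y : Fin n' → V}
    (hX : ∀ i, X i = Y (Fin.cast h i)) : (E n).obj X = (E n').obj Y := by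
  subst h
  exact congrArg (E n).obj (funext hX)

/-- The identity `E X ⟶ E Y` for sequences `X` and `Y` that are equal (have equal lengths and
equal entries). -/
def tcast (E : TensorFunctor V) {n n' : ℕ} (h : n = n') {X : Fin n → V} {Y : Fin n' → V}
    (hX : ∀ i, X i = Y (Fin.cast h i)) : (E n).obj X ⟶ (E n').obj Y :=
  eqToHom (tobj_congr E h hX)

theorem tmap_comp (E : TensorFunctor V) {n : ℕ} {X Y Z : Fin n → V} (f : ∀ i, X i ⟶ Y i)
    (g : ∀ i, Y i ⟶ Z i) : tmap E f ≫ tmap E g = tmap E (fun i => f i ≫ g i) :=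
  ((E n).map_comp (X := X) (Y := Y) (Z := Z) f g).symm

theorem tmap_id (E : TensorFunctor V) {n : ℕ} (X : Fin n → V) :
    tmap E (fun i => 𝟙 (X i)) = 𝟙 ((E n).obj X) :=
  (E n).map_id X

theorem tcast_trans (E : TensorFunctor V) {n n' n'' : ℕ} (h : n = n') (h' : n' = n'')
    {X : Fin n → V} {Y : Fin n' → V} {Z : Fin n'' → V}
    (hX : ∀ i, X i = Y (Fin.cast h i)) (hY : ∀ i, Y i = Z (Fin.cast h' i)) :
    tcast E h hX ≫ tcast E h' hY = tcast E (h.trans h') (fun i => (hX i).trans (hY _)) := by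
  simp [tcast]

theorem tcast_rfl (E : TensorFunctor V) {n : ℕ} {X : Fin n → V} (h : n = n)
    (hX : ∀ i, X i = X (Fin.cast h i)) : tcast E h hX = 𝟙 _ := rfl

theorem tcast_tmap (E : TensorFunctor V) {n n' : ℕ} (h : n = n') {X X' : Fin n → V}
    {Y Y' : Fin n' → V} (hX : ∀ i, X i = Y (Fin.cast h i)) (hX' : ∀ i, X' i = Y' (Fin.cast h i))
    (f : ∀ i, X i ⟶ X' i) (g : ∀ i, Y i ⟶ Y' i)
    (hfg : ∀ i, f i ≫ eqToHom (hX' i) = eqToHom (hX i) ≫ g (Fin.cast h i)) :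
    tmap E f ≫ tcast E h hX' = tcast E h hX ≫ tmap E g := by
  subst h
  obtain rfl : X = Y := funext hX
  obtain rfl : X' = Y' := funext hX'
  rw [tcast_rfl, tcast_rfl, Category.comp_id, Category.id_comp]
  congr 1
  funext i
  have := hfg i
  rw [eqToHom_refl, eqToHom_refl, Category.comp_id, Category.id_comp] at this
  exact this

theorem tmap_eqToHom (E : TensorFunctor V) {n : ℕ} {X Y : Fin n → V} (h : ∀ i, X i = Y i) :
    tmap E (fun i => eqToHom (h i)) = tcast E rfl h := by
  obtain rfl : X = Y := funext h
  exact tmap_id E X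

/-- The type of families of unit maps `u_Z : Z ⟶ E(Z)`. -/
abbrev TensorUnit (E : TensorFunctor V) := ∀ Z : V, Z ⟶ (E 1).obj (fun _ => Z)

/-- The type of families of substitution maps `σ : E_i E_j Z_{ij} ⟶ E_{ij} Z_{ij}`. -/
abbrev TensorSubst (E : TensorFunctor V) := ∀ {m : ℕ} (n : Fin m → ℕ) (Z : ∀ i, Fin (n i) → V),
  (E m).obj (fun i => (E (n i)).obj (Z i)) ⟶ (E (∑ i, n i)).obj (flat Z)

theorem subst_tcast {E : TensorFunctor V} (σ : TensorSubst E) {m m' : ℕ} (hm : m = m')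
    {n : Fin m → ℕ} {n' : Fin m' → ℕ} (hn : ∀ i, n i = n' (Fin.cast hm i))
    {Z : ∀ i, Fin (n i) → V} {Z' : ∀ i, Fin (n' i) → V}
    (hZ : ∀ i j, Z i j = Z' (Fin.cast hm i) (Fin.cast (hn i) j))
    (hE : ∀ i, (E (n i)).obj (Z i) = (E (n' (Fin.cast hm i))).obj (Z' (Fin.cast hm i)))
    (hs : ∑ i, n i = ∑ i, n' i) (hF : ∀ l, flat Z l = flat Z' (Fin.cast hs l)) :
    tcast E hm hE ≫ σ n' Z' = σ n Z ≫ tcast E hs hF := by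
  subst hm
  obtain rfl : n = n' := funext hn
  obtain rfl : Z = Z' := funext fun i => funext fun j => hZ i j
  rw [tcast_rfl, tcast_rfl, Category.comp_id, Category.id_comp]

/-- The axioms making a functor `E : M V ⥤ V`, with a unit `u` and a substitution `σ`, into a
multitensor (a lax monoidal structure) on `V`. -/
structure IsMultitensor (E : TensorFunctor V) (u : TensorUnit E) (σ : TensorSubst E) : Prop where
  unit_natural : ∀ {X Y : V} (f : X ⟶ Y), f ≫ u Y = u X ≫ tmap E (fun _ => f)
  subst_natural : ∀ {m : ℕ} (n : Fin m → ℕ) (Z Z' : ∀ i, Fin (n i) → V)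
    (f : ∀ i j, Z i j ⟶ Z' i j),
    tmap E (fun i => tmap E (f i)) ≫ σ n Z' =
      σ n Z ≫ tmap E (fun l => f (finSigmaFinEquiv.symm l).1 (finSigmaFinEquiv.symm l).2)
  unit_left : ∀ {n : ℕ} (Z : Fin n → V),
    u ((E n).obj Z) ≫ σ (fun _ : Fin 1 => n) (fun _ => Z) ≫
      tcast E (by simp) (flat_unit_left Z) = 𝟙 _
  unit_right : ∀ {n : ℕ} (Z : Fin n → V),
    tmap E (fun i => u (Z i)) ≫ σ (fun _ : Fin n => 1) (fun i _ => Z i) ≫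
      tcast E (by simp) (flat_unit_right Z) = 𝟙 _
  assoc : ∀ {m : ℕ} (n : Fin m → ℕ) (p : ∀ i, Fin (n i) → ℕ)
    (Z : ∀ i (j : Fin (n i)), Fin (p i j) → V),
    tmap E (fun i => σ (p i) (Z i)) ≫ σ (fun i => ∑ j, p i j) (fun i => flat (Z i)) ≫
        tcast E (sum_flat p).symm (flat_flat p Z) =
      σ n (fun i j => (E (p i j)).obj (Z i j)) ≫
        σ (flat p) (fun r => Z (finSigmaFinEquiv.symm r).1 (finSigmaFinEquiv.symm r).2)

variable (V) in
/-- A multitensor `(E, u, σ)` on `V`. -/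
structure Multitensor where
  /-- the functor `M V ⥤ V` -/
  E : TensorFunctor V
  /-- the unit -/
  unit : TensorUnit E
  /-- the substitution -/
  subst : TensorSubst E
  isMultitensor : IsMultitensor E unit subst

/-- The `n`-ary functors of `E` preserve coproducts (indexed by types in universe `w`) in each
variable: for all `X` and `i` the functor sending `Z` to `E` of the sequence obtained from `X` by
putting `Z` in place `i` preserves coproducts. -/
def IsDistributive (E : TensorFunctor V) : Prop :=
  ∀ (n : ℕ) (X : Fin n → V) (i : Fin n) (J : Type w),
    PreservesColimitsOfShape (Discrete J)
      (Functor.pi' (fun k => if k = i then 𝟭 V else (Functor.const V).obj (X k)) ⋙ E n)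

/-- The monad on `V` obtained by restricting a multitensor to singleton sequences. -/
def Multitensor.unaryMonad (M : Multitensor V) : Monad V where
  obj Z := (M.E 1).obj (fun _ => Z)
  map f := tmap M.E (fun _ => f)
  map_id Z := tmap_id M.E (fun _ => Z)
  map_comp f g := (tmap_comp M.E (fun _ => f) (fun _ => g)).symm
  η := { app := M.unit, naturality := fun _ _ f => M.isMultitensor.unit_natural f }
  μ :=
    { app := fun Z => M.subst (fun _ : Fin 1 => 1) (fun _ _ => Z) ≫
        tcast M.E (by simp) (fun _ => rfl)
      naturality := fun X Y f => by
        have h := M.isMultitensor.subst_natural (fun _ : Fin 1 => 1) (fun _ _ => X) (fun _ _ => Y)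
          (fun _ _ => f)
        have h' := tcast_tmap M.E (show ∑ _i : Fin 1, 1 = 1 by simp)
          (X := fun _ => X) (X' := fun _ => Y) (Y := fun _ => X) (Y' := fun _ => Y)
          (fun _ => rfl) (fun _ => rfl) (fun _ => f) (fun _ => f) (fun _ => by simp)
        refine ((Category.assoc _ _ _).symm.trans (congrArg (· ≫ _) h)).trans ?_
        refine (Category.assoc _ _ _).trans ((congrArg (_ ≫ ·) h').trans ?_)
        exact (Category.assoc _ _ _).symm }
  left_unit Z := M.isMultitensor.unit_left (fun _ => Z)
  right_unit Z := M.isMultitensor.unit_right (fun _ => Z)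
  assoc Z := by
    have hA := M.isMultitensor.assoc (fun _ : Fin 1 => 1) (fun _ _ => 1) (fun _ _ _ => Z)
    have h1 : ∑ _i : Fin 1, 1 = 1 := by simp
    have h2 : (M.E (∑ _i : Fin 1, 1)).obj (fun _ => Z) = (M.E 1).obj (fun _ => Z) :=
      tobj_congr M.E h1 fun _ => rfl
    have hL := subst_tcast (E := M.E) M.subst (rfl : 1 = 1)
      (n := fun _ => ∑ _i : Fin 1, 1) (n' := fun _ => 1) (fun _ => h1)
      (Z := fun _ _ => Z) (Z' := fun _ _ => Z) (fun _ _ => rfl)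
      (fun _ => h2) (by simp) (fun _ => rfl)
    have hR := subst_tcast (E := M.E) M.subst h1
      (n := fun _ => 1) (n' := fun _ => 1) (fun _ => rfl)
      (Z := fun _ _ => Z) (Z' := fun _ _ => Z) (fun _ _ => rfl) (fun _ => rfl) (by simp)
      (fun _ => rfl)
    have hT : tmap M.E (fun _ : Fin 1 => M.subst (fun _ : Fin 1 => 1) (fun _ _ => Z) ≫
        tcast M.E h1 (X := fun _ => Z) (Y := fun _ => Z) (fun _ => rfl)) =
        tmap M.E (fun _ : Fin 1 => M.subst (fun _ : Fin 1 => 1) (fun _ _ => Z)) ≫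
        tcast M.E rfl (fun _ => h2) :=
      (tmap_comp M.E _ _).symm.trans (congrArg (_ ≫ ·) (tmap_eqToHom M.E (fun _ : Fin 1 => h2)))
    refine (congrArg (· ≫ _) hT).trans ?_
    refine (Category.assoc _ _ _).trans ?_
    refine (congrArg (_ ≫ ·) ((Category.assoc _ _ _).symm.trans
      ((congrArg (· ≫ _) hL).trans (Category.assoc _ _ _)))).trans ?_
    refine Eq.trans ?_ (Category.assoc _ _ _).symm
    refine Eq.trans ?_ (congrArg (_ ≫ ·) ((Category.assoc _ _ _).symm.trans
      ((congrArg (· ≫ _) hR).trans (Category.assoc _ _ _)))).symm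
    rw [tcast_trans, tcast_trans]
    have hc := congrArg (· ≫ tcast M.E (show ∑ l, flat (fun (_ : Fin 1) (_ : Fin 1) => 1) l = 1 by
      simp [flat]) (X := fun _ => Z) (Y := fun _ => Z) (fun _ => rfl)) hA
    refine Eq.trans ?_ (hc.trans (Category.assoc _ _ _))
    refine Eq.trans ?_ (Category.assoc _ _ _).symm
    refine congrArg (_ ≫ ·) ?_
    refine Eq.trans ?_ (Category.assoc _ _ _).symm
    refine congrArg (_ ≫ ·) ?_
    exact (tcast_trans M.E _ _ _ _).symm

/-- A multitensor map between multitensors on the same category: a natural family of maps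
`E X ⟶ F X` compatible with units and substitutions. -/
structure IsMultitensorMap (M N : Multitensor V) (φ : ∀ n (X : Fin n → V), (M.E n).obj X ⟶ (N.E n).obj X) :
    Prop where
  natural : ∀ {n : ℕ} {X Y : Fin n → V} (f : ∀ i, X i ⟶ Y i),
    tmap M.E f ≫ φ n Y = φ n X ≫ tmap N.E f
  unit : ∀ Z, M.unit Z ≫ φ 1 (fun _ => Z) = N.unit Z
  subst : ∀ {m : ℕ} (n : Fin m → ℕ) (Z : ∀ i, Fin (n i) → V),
    M.subst n Z ≫ φ _ (flat Z) =
      tmap M.E (fun i => φ (n i) (Z i)) ≫ φ m _ ≫ N.subst n Z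

end Tensor

/-! ### Enriched graphs -/

/-- A graph enriched in `V`: a set of objects and for each ordered pair of objects a hom in `V`. -/
structure VGraph (V : Type u) where
  /-- the set of objects -/
  obj : Type w
  /-- the homs -/
  hom : obj → obj → V

/-- The sequence of homs `X(x_{i-1}, x_i)` along a sequence of objects of `X`. -/
abbrev homs {V : Type u} (X : VGraph.{w} V) {a b : X.obj} (x : ObjSeq X.obj a b) : Fin x.len → V :=
  fun i => X.hom (x.vtx i.castSucc) (x.vtx i.succ)

theorem homs_congr {V : Type u} (X : VGraph.{w} V) {a b : X.obj} {x y : ObjSeq X.obj a b} (h : x = y)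
    (hl : x.len = y.len) (i : Fin x.len) : homs X x i = homs X y (Fin.cast hl i) := by
  subst h
  rfl

/-- A morphism of enriched graphs. -/
@[ext]
structure VGraph.Hom {V : Type u} [Category.{v} V] (X Y : VGraph.{w} V) where
  /-- the object function -/
  obj : X.obj → Y.obj
  /-- the hom maps -/
  hom : ∀ a b, X.hom a b ⟶ Y.hom (obj a) (obj b)

section Graph

variable {V : Type u} [Category.{v} V]

/-- The category `G V` of graphs enriched in `V`. -/
instance : Category (VGraph.{w} V) where
  Hom := VGraph.Hom
  id _ := ⟨id, fun _ _ => 𝟙 _⟩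
  comp f g := ⟨g.obj ∘ f.obj, fun a b => f.hom a b ≫ g.hom _ _⟩
  id_comp _ := VGraph.Hom.ext rfl (heq_of_eq (funext fun _ => funext fun _ => Category.id_comp _))
  comp_id _ := VGraph.Hom.ext rfl (heq_of_eq (funext fun _ => funext fun _ => Category.comp_id _))
  assoc _ _ _ :=
    VGraph.Hom.ext rfl (heq_of_eq (funext fun _ => funext fun _ => Category.assoc _ _ _))

theorem VGraph.hom_ext {X Y : VGraph.{w} V} {φ : X.obj → Y.obj}
    {f g : ∀ a b, X.hom a b ⟶ Y.hom (φ a) (φ b)} (h : ∀ a b, f a b = g a b) :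
    (⟨φ, f⟩ : X ⟶ Y) = ⟨φ, g⟩ :=
  VGraph.Hom.ext rfl (heq_of_eq (funext fun a => funext fun b => h a b))

theorem VGraph.hom_eqToHom {X Y : VGraph.{w} V} (f : X ⟶ Y) {a b a' b' : X.obj} (ha : a = a')
    (hb : b = b') (h : X.hom a b = X.hom a' b')
    (h' : Y.hom (f.obj a) (f.obj b) = Y.hom (f.obj a') (f.obj b')) :
    f.hom a b ≫ eqToHom h' = eqToHom h ≫ f.hom a' b' := by
  subst ha hb
  exact (Category.comp_id _).trans (Category.id_comp _).symm

/-- The functor `G H : G V ⥤ G W` applying `H` to the homs. -/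
def graphFunctor {W : Type*} [Category W] (H : V ⥤ W) : VGraph.{w} V ⥤ VGraph.{w} W where
  obj X := ⟨X.obj, fun a b => H.obj (X.hom a b)⟩
  map f := ⟨f.obj, fun a b => H.map (f.hom a b)⟩
  map_id _ := VGraph.hom_ext fun _ _ => H.map_id _
  map_comp _ _ := VGraph.hom_ext fun _ _ => H.map_comp _ _

/-- The monad `G(T)` on `G V` induced by a monad `T` on `V`; its unit and multiplication are
identities on objects and are those of `T` on homs. -/
def graphMonad (T : Monad V) : Monad (VGraph.{w} V) where
  toFunctor := graphFunctor T.toFunctor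
  η :=
    { app := fun X => ⟨id, fun a b => T.η.app (X.hom a b)⟩
      naturality := fun _ _ _ => VGraph.hom_ext fun _ _ => T.η.naturality _ }
  μ :=
    { app := fun X => ⟨id, fun a b => T.μ.app (X.hom a b)⟩
      naturality := fun _ _ _ => VGraph.hom_ext fun _ _ => T.μ.naturality _ }
  assoc _ := VGraph.hom_ext fun _ _ => T.assoc _
  left_unit _ := VGraph.hom_ext fun _ _ => T.left_unit _
  right_unit _ := VGraph.hom_ext fun _ _ => T.right_unit _

/-- `E_i X(x_{i-1}, x_i)` -/
abbrev seqTensor (E : TensorFunctor V) (X : VGraph.{w} V) {a b : X.obj} (x : ObjSeq X.obj a b) :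
    V :=
  (E x.len).obj (homs X x)

/-- The identity `E_1 X(a, b) ⟶ E_i X(x_{i-1}, x_i)` for the sequence `x = (a, b)`. -/
def singleCast (E : TensorFunctor V) (X : VGraph.{w} V) (a b : X.obj) :
    (E 1).obj (fun _ => X.hom a b) ⟶ seqTensor E X (ObjSeq.single a b) :=
  tcast E rfl fun i => (congrArg₂ X.hom (ObjSeq.single_castSucc a b i)
    (ObjSeq.single_succ a b i)).symm

/-- The identity from `E_{ij} X(x_{ij-1}, x_{ij})`, for a doubly nested sequence `x_{ij}`, to the
tensor product along the concatenated sequence. -/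
def concatCast (E : TensorFunctor V) (X : VGraph.{w} V) {a b : X.obj} (x : ObjSeq X.obj a b)
    (y : ∀ i : Fin x.len, ObjSeq X.obj (x.vtx i.castSucc) (x.vtx i.succ)) :
    (E (∑ i, (y i).len)).obj (flat fun i => homs X (y i)) ⟶ seqTensor E X (x.concat y) :=
  tcast E rfl fun l => congrArg₂ X.hom (ObjSeq.concat_castSucc x y l) (ObjSeq.concat_succ x y l)

/-- The map `E_i X(x_{i-1}, x_i) ⟶ E_i Y(f x_{i-1}, f x_i)` induced by `f : X ⟶ Y`. -/
abbrev seqTensorMap (E : TensorFunctor V) {X Y : VGraph.{w} V} (f : X ⟶ Y) {a b : X.obj}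
    (x : ObjSeq X.obj a b) : seqTensor E X x ⟶ seqTensor E Y (x.map f.obj) :=
  tmap E (X := homs X x) (Y := homs Y (x.map f.obj)) fun _ => f.hom _ _

/-! ### Categories enriched in a multitensor -/

/-- A category enriched in the multitensor `M`. -/
structure ECat (M : Multitensor V) where
  /-- the underlying graph -/
  graph : VGraph.{w} V
  /-- the composition maps -/
  comp : ∀ {a b : graph.obj} (x : ObjSeq graph.obj a b), seqTensor M.E graph x ⟶ graph.hom a b
  unit_comp : ∀ a b : graph.obj,
    M.unit (graph.hom a b) ≫ singleCast M.E graph a b ≫ comp (ObjSeq.single a b) = 𝟙 _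
  subst_comp : ∀ {a b : graph.obj} (x : ObjSeq graph.obj a b)
    (y : ∀ i : Fin x.len, ObjSeq graph.obj (x.vtx i.castSucc) (x.vtx i.succ)),
    tmap M.E (fun i => comp (y i)) ≫ comp x =
      M.subst (fun i => (y i).len) (fun i => homs graph (y i)) ≫
        concatCast M.E graph x y ≫ comp (x.concat y)

/-- An `E`-functor: a morphism of graphs compatible with the compositions. -/
@[ext]
structure ECat.Hom {M : Multitensor V} (X Y : ECat.{w} M) where
  /-- the underlying morphism of graphs -/
  toHom : X.graph ⟶ Y.graph
  comm : ∀ {a b : X.graph.obj} (x : ObjSeq X.graph.obj a b),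
    X.comp x ≫ toHom.hom a b = seqTensorMap M.E toHom x ≫ Y.comp (x.map toHom.obj)

/-- The category `E`-Cat. -/
instance (M : Multitensor V) : Category (ECat.{w} M) where
  Hom := ECat.Hom
  id X := ⟨𝟙 _, fun x => (Category.comp_id _).trans
    ((Category.id_comp _).symm.trans (congrArg (· ≫ _) (tmap_id M.E _).symm))⟩
  comp {X Y Z} f g := ⟨f.toHom ≫ g.toHom, fun {a b} x => by
    have h1 := f.comm x
    have h2 := g.comm (x.map f.toHom.obj)
    refine (Category.assoc _ _ _).symm.trans ((congrArg (· ≫ _) h1).trans ?_)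
    refine (Category.assoc _ _ _).trans ((congrArg (_ ≫ ·) h2).trans ?_)
    refine (Category.assoc _ _ _).symm.trans (congrArg (· ≫ _) ?_)
    exact tmap_comp M.E _ _⟩
  id_comp f := ECat.Hom.ext (Category.id_comp _)
  comp_id f := ECat.Hom.ext (Category.comp_id _)
  assoc f g h := ECat.Hom.ext (Category.assoc _ _ _)

/-- The forgetful functor `U^E` from `E`-Cat to `G V`. -/
def ECat.forget (M : Multitensor V) : ECat.{w} M ⥤ VGraph.{w} V where
  obj X := X.graph
  map f := f.toHom

/-! ### Monoidal monads and composite multitensors -/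

/-- Coherence data `τ : E_i T X_i ⟶ T E_i X_i` making the monad `T` into a monoidal monad on
`(V, E)`: `(T, τ)` is a lax monoidal functor and the unit and multiplication of `T` are monoidal
natural transformations. -/
@[ext]
structure MonoidalCoherence (M : Multitensor V) (T : Monad V) where
  /-- the coherence maps -/
  τ : ∀ {n : ℕ} (X : Fin n → V), (M.E n).obj (fun i => T.obj (X i)) ⟶ T.obj ((M.E n).obj X)
  natural : ∀ {n : ℕ} {X Y : Fin n → V} (f : ∀ i, X i ⟶ Y i),
    tmap M.E (fun i => T.map (f i)) ≫ τ Y = τ X ≫ T.map (tmap M.E f)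
  unit : ∀ X : V, M.unit (T.obj X) ≫ τ (fun _ : Fin 1 => X) = T.map (M.unit X)
  subst : ∀ {m : ℕ} (n : Fin m → ℕ) (Z : ∀ i, Fin (n i) → V),
    tmap M.E (fun i => τ (Z i)) ≫ τ (fun i => (M.E (n i)).obj (Z i)) ≫ T.map (M.subst n Z) =
      M.subst n (fun i j => T.obj (Z i j)) ≫ τ (flat Z)
  monad_unit : ∀ {n : ℕ} (X : Fin n → V),
    tmap M.E (fun i => T.η.app (X i)) ≫ τ X = T.η.app ((M.E n).obj X)
  monad_mul : ∀ {n : ℕ} (X : Fin n → V),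
    tmap M.E (fun i => T.μ.app (X i)) ≫ τ X =
      τ (fun i => T.obj (X i)) ≫ T.map (τ X) ≫ T.μ.app ((M.E n).obj X)

/-- The functor `T E`. -/
abbrev compTensor (M : Multitensor V) (T : Monad V) : TensorFunctor V :=
  fun n => M.E n ⋙ T.toFunctor

/-- The unit `u'_X = η_{E_1 X} u_X` of `T E`. -/
abbrev compUnit (M : Multitensor V) (T : Monad V) : TensorUnit (compTensor M T) :=
  fun X => M.unit X ≫ T.η.app ((M.E 1).obj (fun _ => X))

/-- Substitutions `σ'` for a multitensor `(T E, u', σ')` such that `η E` is a multitensor map, `T u`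
is a monad map, and the middle unit law `σ' (T u η E) = id` holds. -/
@[ext]
structure CompositeMultitensor (M : Multitensor V) (T : Monad V) where
  /-- the substitution `σ' : T E_i T E_j X_{ij} ⟶ T E_{ij} X_{ij}` -/
  subst : TensorSubst (compTensor M T)
  isMultitensor : IsMultitensor (compTensor M T) (compUnit M T) subst
  isMultitensorMap : IsMultitensorMap M ⟨compTensor M T, compUnit M T, subst, isMultitensor⟩
    (fun n X => T.η.app ((M.E n).obj X))
  isMonadMap : ∃ φ : T ⟶ Multitensor.unaryMonad ⟨compTensor M T, compUnit M T, subst, isMultitensor⟩,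
    ∀ X, φ.app X = T.map (M.unit X)
  middle_unit : ∀ {n : ℕ} (X : Fin n → V),
    T.map (M.unit ((M.E n).obj X)) ≫
        T.map (tmap M.E (fun _ : Fin 1 => T.η.app ((M.E n).obj X))) ≫
        subst (fun _ : Fin 1 => n) (fun _ => X) ≫ tcast (compTensor M T) (by simp) (flat_unit_left X) =
      𝟙 _

/-- The multitensor `(T E, u', σ')`. -/
abbrev CompositeMultitensor.toMultitensor {M : Multitensor V} {T : Monad V}
    (s : CompositeMultitensor M T) : Multitensor V :=
  ⟨compTensor M T, compUnit M T, s.subst, s.isMultitensor⟩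

/-! ### Liftings and distributive laws of monads -/

/-- A lifting of a monad `S` on `G V` to `E`-Cat: a monad `S'` on `E`-Cat such that
`S U = U S'`, `η U = U η'` and `μ U = U μ'`. -/
@[ext]
structure Lifting (M : Multitensor V) (S : Monad (VGraph.{w} V)) where
  /-- the lifted monad -/
  monad : Monad (ECat.{w} M)
  functor_eq : ECat.forget M ⋙ S.toFunctor = monad.toFunctor ⋙ ECat.forget M
  unit_eq : ∀ X, S.η.app ((ECat.forget M).obj X) ≫ eqToHom (Functor.congr_obj functor_eq X) =
    (ECat.forget M).map (monad.η.app X)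
  mul_eq : ∀ X, S.μ.app ((ECat.forget M).obj X) ≫ eqToHom (Functor.congr_obj functor_eq X) =
    S.map (eqToHom (Functor.congr_obj functor_eq X)) ≫
      eqToHom (Functor.congr_obj functor_eq (monad.obj X)) ≫
      (ECat.forget M).map (monad.μ.app X)

/-- A distributive law of the monad `S` over the monad `R`. -/
@[ext]
structure DistributiveLaw {C : Type*} [Category C] (S R : Monad C) where
  /-- the natural transformation `R S ⟶ S R` -/
  app : ∀ X : C, R.obj (S.obj X) ⟶ S.obj (R.obj X)
  natural : ∀ {X Y : C} (f : X ⟶ Y), R.map (S.map f) ≫ app Y = app X ≫ S.map (R.map f)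
  unit_left : ∀ X, R.η.app (S.obj X) ≫ app X = S.map (R.η.app X)
  unit_right : ∀ X, R.map (S.η.app X) ≫ app X = S.η.app (R.obj X)
  mul_left : ∀ X, R.μ.app (S.obj X) ≫ app X =
    R.map (app X) ≫ app (R.obj X) ≫ S.map (R.μ.app X)
  mul_right : ∀ X, R.map (S.μ.app X) ≫ app X =
    app (S.obj X) ≫ S.map (app X) ≫ S.μ.app (R.obj X)

end Graph

/-! ### Distributivity in all variables simultaneously -/

section Distributive

variable {V : Type u} [Category.{v} V]

theorem IsDistributive.existsUnique_one {E : TensorFunctor V} (hE : IsDistributive.{w} E) {n : ℕ}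
    (Q : Fin n → V) (i : Fin n) {J : Type w} (P : J → Fin n → V) (p : ∀ j k, P j k ⟶ Q k)
    (hiso : ∀ j k, k ≠ i → IsIso (p j k))
    (hc : Nonempty (IsColimit (Cofan.mk (Q i) (fun j => p j i))))
    {A : V} (g : ∀ j, (E n).obj (P j) ⟶ A) :
    ∃! h : (E n).obj Q ⟶ A, ∀ j, tmap E (p j) ≫ h = g j := by
  obtain ⟨hc⟩ := hc
  let F : Fin n → V ⥤ V := fun k => if k = i then 𝟭 V else (Functor.const V).obj (Q k)
  have hF : ∀ k, ∃ (a : ∀ j, (F k).obj (P j i) ≅ P j k) (b : (F k).obj (Q i) ≅ Q k),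
      ∀ j, (a j).hom ≫ p j k = (F k).map (p j i) ≫ b.hom := by
    intro k
    by_cases h : k = i
    · subst h
      have hk : F k = 𝟭 V := if_pos rfl
      rw [hk]
      exact ⟨fun j => Iso.refl _, Iso.refl _, fun j =>
        (Category.id_comp _).trans (Category.comp_id _).symm⟩
    · have hk : F k = (Functor.const V).obj (Q k) := if_neg h
      rw [hk]
      have := fun j => hiso j k h
      exact ⟨fun j => (asIso (p j k)).symm, Iso.refl _, fun j => by simp⟩
  choose a b hab using hF
  let Φ : V ⥤ (Fin n → V) := Functor.pi' F
  have hP : PreservesColimitsOfShape (Discrete J) (Φ ⋙ E n) := hE n Q i J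
  have hc' := isColimitCofanMkObjOfIsColimit (Φ ⋙ E n) _ _ hc
  have hab' : ∀ k j, p j k ≫ (b k).inv = (a k j).inv ≫ (F k).map (p j i) := by
    intro k j
    rw [Iso.comp_inv_eq, Category.assoc, Iso.eq_inv_comp]
    exact hab k j
  have e1 : ∀ j, tmap E (fun k => (a k j).hom) ≫ tmap E (p j) =
      (Φ ⋙ E n).map (p j i) ≫ tmap E (fun k => (b k).hom) := fun j =>
    (tmap_comp E _ _).trans ((congrArg (tmap E) (funext fun k => hab k j)).trans
      (tmap_comp E _ _).symm)
  have e2 : ∀ j, tmap E (p j) ≫ tmap E (fun k => (b k).inv) =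
      tmap E (fun k => (a k j).inv) ≫ (Φ ⋙ E n).map (p j i) := fun j =>
    (tmap_comp E _ _).trans ((congrArg (tmap E) (funext fun k => hab' k j)).trans
      (tmap_comp E _ _).symm)
  have e3 : ∀ j, tmap E (fun k => (a k j).inv) ≫ tmap E (fun k => (a k j).hom) = 𝟙 _ := fun j =>
    (tmap_comp E _ _).trans ((congrArg (tmap E) (funext fun k => (a k j).inv_hom_id)).trans
      (tmap_id E _))
  have e4 : tmap E (fun k => (b k).inv) ≫ tmap E (fun k => (b k).hom) = 𝟙 _ :=
    (tmap_comp E _ _).trans ((congrArg (tmap E) (funext fun k => (b k).inv_hom_id)).trans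
      (tmap_id E _))
  let d : (Φ ⋙ E n).obj (Q i) ⟶ A :=
    Cofan.IsColimit.desc hc' (fun j => tmap E (fun k => (a k j).hom) ≫ g j)
  have hd : ∀ j, (Φ ⋙ E n).map (p j i) ≫ d = tmap E (fun k => (a k j).hom) ≫ g j :=
    fun j => Cofan.IsColimit.fac hc' _ j
  refine ⟨tmap E (fun k => (b k).inv) ≫ d, fun j => ?_, fun h hh => ?_⟩
  · refine (Category.assoc _ _ _).symm.trans ((congrArg (· ≫ d) (e2 j)).trans ?_)
    refine (Category.assoc _ _ _).trans ((congrArg (_ ≫ ·) (hd j)).trans ?_)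
    refine (Category.assoc _ _ _).symm.trans ((congrArg (· ≫ _) (e3 j)).trans ?_)
    exact Category.id_comp _
  · have hd' : tmap E (fun k => (b k).hom) ≫ h = d := by
      refine Cofan.IsColimit.hom_ext hc' _ _ fun j => ?_
      refine Eq.trans ?_ (hd j).symm
      refine (Category.assoc _ _ _).symm.trans ((congrArg (· ≫ h) (e1 j)).symm.trans ?_)
      exact (Category.assoc _ _ _).trans (congrArg (_ ≫ ·) (hh j))
    rw [← hd', ← Category.assoc, e4]
    exact (Category.id_comp _).symm

/-- `F` extended by `C` at `none`. -/
abbrev optObj {J : Type w} (F : J → V) (C : V) : Option J → V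
  | none => C
  | some j => F j

/-- The comparison maps between the values of `optObj`. -/
def optMap {J : Type w} {F : J → V} {C : V} (c : ∀ j, F j ⟶ C) :
    ∀ (o o' : Option J), (o' = none ∨ o' = o) → (optObj F C o ⟶ optObj F C o')
  | none, none, _ => 𝟙 C
  | some j, none, _ => c j
  | o, some j, h => eqToHom (by
      rcases h with h | h
      · cases h
      · rw [h])

theorem optMap_comp {J : Type w} {F : J → V} {C : V} (c : ∀ j, F j ⟶ C) (o o' o'' : Option J)
    (h : o' = none ∨ o' = o) (h' : o'' = none ∨ o'' = o') (h'' : o'' = none ∨ o'' = o) :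
    optMap c o o' h ≫ optMap c o' o'' h' = optMap c o o'' h'' := by
  rcases h with rfl | rfl <;> rcases h' with rfl | rfl
  · cases o <;> simp [optMap]
  · cases o <;> simp [optMap]
  · cases o' <;> simp [optMap]
  · cases o'' <;> simp [optMap]

theorem optMap_isIso {J : Type w} {F : J → V} {C : V} (c : ∀ j, F j ⟶ C) (o o' : Option J)
    (h : o' = none ∨ o' = o) (h' : o = o') : IsIso (optMap c o o' h) := by
  subst h'
  cases o <;> (unfold optMap; infer_instance)

theorem optMap_isColimit {J : Type w} {F : J → V} {C : V} (c : ∀ j, F j ⟶ C)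
    (hc : Nonempty (IsColimit (Cofan.mk C c))) (o : J → Option J) (o' : Option J)
    (ho : ∀ j, o j = some j) (ho' : o' = none) (h : ∀ j, o' = none ∨ o' = o j) :
    Nonempty (IsColimit (Cofan.mk (optObj F C o') (fun j => optMap c (o j) o' (h j)))) := by
  subst ho'
  obtain rfl : o = some := funext ho
  exact hc

theorem IsDistributive.existsUnique_aux {E : TensorFunctor V} (hE : IsDistributive.{w} E) {n : ℕ}
    {J : Fin n → Type w} (F : ∀ i, J i → V) (C : Fin n → V) (c : ∀ i j, F i j ⟶ C i)
    (hc : ∀ i, Nonempty (IsColimit (Cofan.mk (C i) (c i)))) {A : V}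
    (g : ∀ s : ∀ i, J i, (E n).obj (fun i => F i (s i)) ⟶ A) (S : Finset (Fin n)) :
    ∀ t : ∀ i, Option (J i), (∀ i, t i = none ↔ i ∈ S) →
      ∃! h : (E n).obj (fun i => optObj (F i) (C i) (t i)) ⟶ A,
        ∀ (s : ∀ i, J i) (hs : ∀ i, t i = none ∨ t i = some (s i)),
          tmap E (fun i => optMap (c i) (some (s i)) (t i) (hs i)) ≫ h = g s := by
  classical
  induction S using Finset.induction with
  | empty =>
    intro t ht
    have ht' : ∀ i, ∃ j, t i = some j := fun i => by
      rcases h : t i with _ | j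
      · exact absurd ((ht i).1 h) (by simp)
      · exact ⟨j, rfl⟩
    choose s₀ hs₀ using ht'
    obtain rfl : t = fun i => some (s₀ i) := funext hs₀
    refine ⟨g s₀, fun s hs => ?_, fun h hh => ?_⟩
    · obtain rfl : s₀ = s := funext fun i => by
        rcases hs i with h | h
        · cases h
        · exact Option.some.inj h
      exact (congrArg (· ≫ g s₀) (tmap_id E _)).trans (Category.id_comp _)
    · have := hh s₀ (fun i => Or.inr rfl)
      exact ((Category.id_comp _).symm.trans (congrArg (· ≫ h) (tmap_id E _).symm)).trans this
  | insert a S ha ih =>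
    intro t ht
    have hta : t a = none := (ht a).2 (Finset.mem_insert_self a S)
    let t' : J a → ∀ i, Option (J i) := fun j => Function.update t a (some j)
    have ht'a : ∀ j, t' j a = some j := fun j => Function.update_self ..
    have ht'n : ∀ j k, k ≠ a → t' j k = t k := fun j k hk => Function.update_of_ne hk ..
    have hle : ∀ j k, t k = none ∨ t k = t' j k := fun j k => by
      by_cases hk : k = a
      · subst hk; exact Or.inl hta
      · exact Or.inr (ht'n j k hk).symm
    have ht'S : ∀ j i, t' j i = none ↔ i ∈ S := fun j i => by
      by_cases hi : i = a
      · subst hi; rw [ht'a]; simp [ha]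
      · rw [ht'n j i hi, ht i]; simp [hi]
    choose g' hg' hg'u using fun j => ih (t' j) (ht'S j)
    obtain ⟨h, hh, hu⟩ := hE.existsUnique_one (fun i => optObj (F i) (C i) (t i)) a
      (fun j i => optObj (F i) (C i) (t' j i))
      (fun j i => optMap (c i) (t' j i) (t i) (hle j i))
      (fun j k hk => optMap_isIso _ _ _ _ (ht'n j k hk))
      (optMap_isColimit (c a) (hc a) (fun j => t' j a) (t a) ht'a hta _) g'
    have hcomp : ∀ (j : J a) (s : ∀ i, J i) (hs : ∀ i, t i = none ∨ t i = some (s i))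
        (hs' : ∀ i, t' j i = none ∨ t' j i = some (s i)),
        tmap E (fun i => optMap (c i) (some (s i)) (t' j i) (hs' i)) ≫
          tmap E (fun i => optMap (c i) (t' j i) (t i) (hle j i)) =
        tmap E (fun i => optMap (c i) (some (s i)) (t i) (hs i)) := fun j s hs hs' =>
      (tmap_comp E _ _).trans (congrArg (tmap E) (funext fun i => optMap_comp _ _ _ _ _ _ _))
    refine ⟨h, fun s hs => ?_, fun h' hh' => hu h' fun j => hg'u j _ fun s hs' => ?_⟩
    · have hs' : ∀ i, t' (s a) i = none ∨ t' (s a) i = some (s i) := fun i => by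
        by_cases hi : i = a
        · subst hi; exact Or.inr (ht'a _)
        · rw [ht'n _ i hi]; exact hs i
      rw [← hcomp (s a) s hs hs', Category.assoc, hh]
      exact hg' (s a) s hs'
    · have hs : ∀ i, t i = none ∨ t i = some (s i) := fun i => by
        by_cases hi : i = a
        · subst hi; exact Or.inl hta
        · rw [← ht'n j i hi]; exact hs' i
      rw [← Category.assoc, hcomp j s hs hs']
      exact hh' s hs

/-- If the `n`-ary functors of `E` preserve coproducts in each variable, then `E` sends a sequence
of coproducts to a coproduct over all sequences of summands. -/
theorem IsDistributive.existsUnique {E : TensorFunctor V} (hE : IsDistributive.{w} E) {n : ℕ}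
    {J : Fin n → Type w} (F : ∀ i, J i → V) (C : Fin n → V) (c : ∀ i j, F i j ⟶ C i)
    (hc : ∀ i, Nonempty (IsColimit (Cofan.mk (C i) (c i)))) {A : V}
    (g : ∀ s : ∀ i, J i, (E n).obj (fun i => F i (s i)) ⟶ A) :
    ∃! h : (E n).obj C ⟶ A, ∀ s : ∀ i, J i, tmap E (fun i => c i (s i)) ≫ h = g s := by
  obtain ⟨h, hh, hu⟩ := hE.existsUnique_aux F C c hc g Finset.univ (fun _ => none) (by simp)
  exact ⟨h, fun s => hh s (fun _ => Or.inl rfl), fun h' hh' => hu h' fun s _ => hh' s⟩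

end Distributive

/-! ### The monad on enriched graphs induced by a distributive multitensor -/

theorem comp_whisker {C : Type*} [Category C] {A B B' D D' : C} {f : A ⟶ B} {g : B ⟶ D}
    {f' : A ⟶ B'} {g' : B' ⟶ D} (h : f ≫ g = f' ≫ g') (k : D ⟶ D') :
    f ≫ g ≫ k = f' ≫ g' ≫ k := by
  rw [← Category.assoc, h, Category.assoc]

section Gamma

variable {V : Type u} [Category.{v} V] [HasCoproducts.{w} V]

/-- The graph `Γ E (X)`: the same objects as `X`, and
`Γ E (X)(a, b) = ∐_{a = x_0, …, x_n = b} E_i X(x_{i-1}, x_i)`. -/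
noncomputable abbrev gammaObj (E : TensorFunctor V) (X : VGraph.{w} V) : VGraph.{w} V where
  obj := X.obj
  hom a b := ∐ fun x : ObjSeq X.obj a b => seqTensor E X x

/-- The coproduct inclusions `k`. -/
noncomputable abbrev gammaIncl (E : TensorFunctor V) (X : VGraph.{w} V) {a b : X.obj}
    (x : ObjSeq X.obj a b) : seqTensor E X x ⟶ (gammaObj E X).hom a b :=
  Sigma.ι (fun x : ObjSeq X.obj a b => seqTensor E X x) x

/-- The hom maps of `Γ E (f)`. -/
noncomputable def gammaMapHom (E : TensorFunctor V) {X Y : VGraph.{w} V} (f : X ⟶ Y)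
    (a b : X.obj) : (gammaObj E X).hom a b ⟶ (gammaObj E Y).hom (f.obj a) (f.obj b) :=
  Sigma.desc fun x : ObjSeq X.obj a b => seqTensorMap E f x ≫ gammaIncl E Y (x.map f.obj)

theorem gammaIncl_map (E : TensorFunctor V) {X Y : VGraph.{w} V} (f : X ⟶ Y) {a b : X.obj}
    (x : ObjSeq X.obj a b) :
    gammaIncl E X x ≫ gammaMapHom E f a b = seqTensorMap E f x ≫ gammaIncl E Y (x.map f.obj) :=
  Sigma.ι_desc _ _

theorem gamma_hom_ext_one {E : TensorFunctor V} {X : VGraph.{w} V} {a b : X.obj} {A : V}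
    {f g : (gammaObj E X).hom a b ⟶ A}
    (h : ∀ x : ObjSeq X.obj a b, gammaIncl E X x ≫ f = gammaIncl E X x ≫ g) : f = g :=
  Sigma.hom_ext _ _ h

/-- The action of `Γ E` on morphisms. -/
noncomputable abbrev gammaMap (E : TensorFunctor V) {X Y : VGraph.{w} V} (f : X ⟶ Y) :
    gammaObj E X ⟶ gammaObj E Y :=
  ⟨f.obj, gammaMapHom E f⟩

/-- The functor `Γ E`. -/
noncomputable def gammaFunctor (E : TensorFunctor V) : VGraph.{w} V ⥤ VGraph.{w} V where
  obj X := gammaObj E X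
  map f := gammaMap E f
  map_id X := VGraph.hom_ext fun a b => gamma_hom_ext_one fun x =>
    (gammaIncl_map E (𝟙 X) x).trans ((eq_whisker (tmap_id E (homs X x)) _).trans
      ((Category.id_comp _).trans (Category.comp_id _).symm))
  map_comp {X Y Z} f g := VGraph.hom_ext fun a b => gamma_hom_ext_one fun x => by
    refine (gammaIncl_map E (f ≫ g) x).trans ?_
    refine Eq.trans ?_ (comp_whisker (gammaIncl_map E f x) (gammaMapHom E g _ _)).symm
    refine Eq.trans ?_ (whisker_eq _ (gammaIncl_map E g (x.map f.obj)).symm)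
    refine Eq.trans ?_ (Category.assoc _ _ _)
    exact eq_whisker (tmap_comp E _ _).symm _

theorem gammaIncl_congr (E : TensorFunctor V) (X : VGraph.{w} V) {a b : X.obj}
    {x y : ObjSeq X.obj a b} (h : x = y) (hl : x.len = y.len)
    (hX : ∀ i, homs X x i = homs X y (Fin.cast hl i)) :
    tcast E hl hX ≫ gammaIncl E X y = gammaIncl E X x := by
  subst h
  exact Category.id_comp _

theorem gammaIncl_copy (E : TensorFunctor V) (X : VGraph.{w} V) {a b a' b' : X.obj}
    (x : ObjSeq X.obj a b) (ha : a = a') (hb : b = b')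
    (h : (gammaObj E X).hom a b = (gammaObj E X).hom a' b') :
    gammaIncl E X x ≫ eqToHom h = gammaIncl E X (x.copy ha hb) := by
  subst ha hb
  exact Category.comp_id _

/-- The hom maps of the unit of `Γ E`. -/
noncomputable def gammaUnitHom (M : Multitensor V) (X : VGraph.{w} V) (a b : X.obj) :
    X.hom a b ⟶ (gammaObj M.E X).hom a b :=
  M.unit (X.hom a b) ≫ singleCast M.E X a b ≫ gammaIncl M.E X (ObjSeq.single a b)

/-- `E_i (Γ E X)(x_{i-1}, x_i)`; a sequence of objects of `Γ E (X)` is a sequence of objects of `X`. -/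
noncomputable abbrev gammaSeqTensor (E : TensorFunctor V) (X : VGraph.{w} V) {a b : X.obj}
    (x : ObjSeq X.obj a b) : V :=
  (E x.len).obj (fun i => (gammaObj E X).hom (x.vtx i.castSucc) (x.vtx i.succ))

/-- The coproduct inclusions for `(Γ E)² X`. -/
noncomputable abbrev gammaIncl₂ (E : TensorFunctor V) (X : VGraph.{w} V) {a b : X.obj}
    (x : ObjSeq X.obj a b) : gammaSeqTensor E X x ⟶ (gammaObj E (gammaObj E X)).hom a b :=
  gammaIncl E (gammaObj E X) (a := a) (b := b) x

/-- Sequences of sequences of objects of `X` that can be concatenated along `x`. -/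
abbrev ObjSeq.Inner {O : Type w} {a b : O} (x : ObjSeq O a b) :=
  ∀ i : Fin x.len, ObjSeq O (x.vtx i.castSucc) (x.vtx i.succ)

theorem gammaMul_existsUnique (M : Multitensor V) (hM : IsDistributive.{w} M.E) (X : VGraph.{w} V)
    {a b : X.obj} (x : ObjSeq X.obj a b) :
    ∃! h : gammaSeqTensor M.E X x ⟶ (gammaObj M.E X).hom a b, ∀ y : x.Inner,
      tmap M.E (fun i => gammaIncl M.E X (y i)) ≫ h =
        M.subst (fun i => (y i).len) (fun i => homs X (y i)) ≫
          concatCast M.E X x y ≫ gammaIncl M.E X (x.concat y) :=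
  hM.existsUnique (J := fun i : Fin x.len => ObjSeq X.obj (x.vtx i.castSucc) (x.vtx i.succ))
    (fun _ y => seqTensor M.E X y) _
    (fun _ y => gammaIncl M.E X y) (fun _ => ⟨coproductIsCoproduct _⟩) _

/-- The hom maps of the multiplication of `Γ E`: the unique maps compatible with `σ` and the
coproduct inclusions `k` and `k^{(2)}`. -/
noncomputable def gammaMulHom (M : Multitensor V) (hM : IsDistributive.{w} M.E) (X : VGraph.{w} V)
    (a b : X.obj) : (gammaObj M.E (gammaObj M.E X)).hom a b ⟶ (gammaObj M.E X).hom a b :=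
  Sigma.desc fun x : ObjSeq X.obj a b => (gammaMul_existsUnique M hM X x).choose

theorem gammaIncl₂_mul (M : Multitensor V) (hM : IsDistributive.{w} M.E) (X : VGraph.{w} V)
    {a b : X.obj} (x : ObjSeq X.obj a b) :
    gammaIncl₂ M.E X x ≫ gammaMulHom M hM X a b = (gammaMul_existsUnique M hM X x).choose :=
  Sigma.ι_desc _ _

theorem gammaMul_spec (M : Multitensor V) (hM : IsDistributive.{w} M.E) (X : VGraph.{w} V)
    {a b : X.obj} (x : ObjSeq X.obj a b) (y : x.Inner) :
    tmap M.E (fun i => gammaIncl M.E X (y i)) ≫ gammaIncl₂ M.E X x ≫ gammaMulHom M hM X a b =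
      M.subst (fun i => (y i).len) (fun i => homs X (y i)) ≫
        concatCast M.E X x y ≫ gammaIncl M.E X (x.concat y) :=
  (whisker_eq _ (gammaIncl₂_mul M hM X x)).trans
    ((gammaMul_existsUnique M hM X x).choose_spec.1 y)

/-- Maps out of `E_i (Γ E X)(x_{i-1}, x_i)` are determined on doubly nested sequences. -/
theorem gamma_hom_ext_two {E : TensorFunctor V} (hE : IsDistributive.{w} E) {X : VGraph.{w} V}
    {a b : X.obj} (x : ObjSeq X.obj a b) {A : V} {f g : gammaSeqTensor E X x ⟶ A}
    (h : ∀ y : x.Inner,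
      tmap E (fun i => gammaIncl E X (y i)) ≫ f = tmap E (fun i => gammaIncl E X (y i)) ≫ g) :
    f = g :=
  (hE.existsUnique (J := fun i : Fin x.len => ObjSeq X.obj (x.vtx i.castSucc) (x.vtx i.succ))
    (fun _ y => seqTensor E X y) _
    (fun _ y => gammaIncl E X y) (fun _ => ⟨coproductIsCoproduct _⟩) _).unique h (fun _ => rfl)

theorem gammaUnit_natural (M : Multitensor V) {X Y : VGraph.{w} V} (f : X ⟶ Y) (a b : X.obj) :
    f.hom a b ≫ gammaUnitHom M Y (f.obj a) (f.obj b) =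
      gammaUnitHom M X a b ≫ gammaMapHom M.E f a b := by
  have h1 := M.isMultitensor.unit_natural (f.hom a b)
  have hmap : (ObjSeq.single a b).map f.obj = ObjSeq.single (f.obj a) (f.obj b) :=
    ObjSeq.ext_of rfl fun i => (congrArg f.obj (ObjSeq.single_succ a b i)).trans
      (ObjSeq.single_succ (f.obj a) (f.obj b) i).symm
  have hV : ∀ i, homs Y ((ObjSeq.single a b).map f.obj) i
      = homs Y (ObjSeq.single (f.obj a) (f.obj b)) i := fun i => congrArg₂ Y.hom
    ((congrArg f.obj (ObjSeq.single_castSucc a b i)).trans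
      (ObjSeq.single_castSucc (f.obj a) (f.obj b) i).symm)
    ((congrArg f.obj (ObjSeq.single_succ a b i)).trans
      (ObjSeq.single_succ (f.obj a) (f.obj b) i).symm)
  have hU : ∀ i : Fin 1, Y.hom (f.obj a) (f.obj b) =
      homs Y ((ObjSeq.single a b).map f.obj) i := fun i => congrArg₂ Y.hom
    (congrArg f.obj (ObjSeq.single_castSucc a b i)).symm
    (congrArg f.obj (ObjSeq.single_succ a b i)).symm
  have h2 : tmap M.E (fun _ : Fin 1 => f.hom a b) ≫ tcast M.E rfl hU =
      singleCast M.E X a b ≫ seqTensorMap M.E f (ObjSeq.single a b) :=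
    tcast_tmap M.E rfl _ _ _ _ fun i => VGraph.hom_eqToHom f
      (ObjSeq.single_castSucc a b i).symm (ObjSeq.single_succ a b i).symm _ _
  have h3 := gammaIncl_congr M.E Y hmap rfl hV
  have h4 : tcast M.E rfl hU ≫ tcast M.E rfl hV = singleCast M.E Y (f.obj a) (f.obj b) :=
    tcast_trans M.E _ _ _ _
  have h5 := gammaIncl_map M.E f (ObjSeq.single a b)
  unfold gammaUnitHom
  rw [Category.assoc, Category.assoc, h5, ← h4, ← h3]
  refine (comp_whisker h1 _).trans (whisker_eq _ ?_)
  refine (whisker_eq _ (Category.assoc _ _ _)).trans ?_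
  exact comp_whisker h2 _

theorem gammaMul_natural (M : Multitensor V) (hM : IsDistributive.{w} M.E) {X Y : VGraph.{w} V}
    (f : X ⟶ Y) (a b : X.obj) :
    gammaMapHom M.E (gammaMap M.E f) a b ≫ gammaMulHom M hM Y (f.obj a) (f.obj b) =
      gammaMulHom M hM X a b ≫ gammaMapHom M.E f a b :=
  gamma_hom_ext_one (X := gammaObj M.E X) (a := a) (b := b) fun x =>
    gamma_hom_ext_two (X := X) hM x fun y => by
    have hV : ∀ l, homs Y ((x.map f.obj).concat (fun i => (y i).map f.obj)) l
        = homs Y ((x.concat y).map f.obj) l := fun l =>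
      congrArg₂ Y.hom (ObjSeq.concat_map_vtx f.obj x y _) (ObjSeq.concat_map_vtx f.obj x y _)
    have h1 := gammaIncl_map M.E (gammaMap M.E f) x
    have h2 : tmap M.E (fun i => gammaIncl M.E X (y i)) ≫
          seqTensorMap M.E (gammaMap M.E f) x =
        tmap M.E (fun i => seqTensorMap M.E f (y i)) ≫
          tmap M.E (fun i => gammaIncl M.E Y ((y i).map f.obj)) :=
      (tmap_comp M.E _ _).trans ((congrArg (tmap M.E)
        (funext fun i => gammaIncl_map M.E f (y i))).trans (tmap_comp M.E _ _).symm)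
    have h3 := gammaMul_spec M hM Y (x.map f.obj) (fun i => (y i).map f.obj)
    have h4 := M.isMultitensor.subst_natural (fun i => (y i).len) (fun i => homs X (y i))
      (fun i => homs Y ((y i).map f.obj)) (fun _ _ => f.hom _ _)
    have h5 : tmap M.E (X := flat (fun i => homs X (y i)))
          (Y := flat (fun i => homs Y ((y i).map f.obj))) (fun _ => f.hom _ _) ≫
          concatCast M.E Y (x.map f.obj) (fun i => (y i).map f.obj) ≫ tcast M.E rfl hV =
        concatCast M.E X x y ≫ seqTensorMap M.E f (x.concat y) := by
      unfold concatCast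
      refine (whisker_eq _ (tcast_trans M.E _ _ _ _)).trans ?_
      exact tcast_tmap M.E rfl _ _ _ _ fun l => VGraph.hom_eqToHom f
        (ObjSeq.concat_castSucc x y l) (ObjSeq.concat_succ x y l) _ _
    have h6 := gammaIncl_congr M.E Y (ObjSeq.concat_map f.obj x y) rfl hV
    have h7 := gammaMul_spec M hM X x y
    have h8 := gammaIncl_map M.E f (x.concat y)
    -- left hand side
    refine (whisker_eq _ (comp_whisker h1 (gammaMulHom M hM Y _ _))).trans ?_
    refine (comp_whisker h2 _).trans ?_
    refine (whisker_eq _ h3).trans ?_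
    refine (comp_whisker h4 _).trans ?_
    refine Eq.trans ?_ (Eq.trans (eq_whisker h7 (gammaMapHom M.E f a b)).symm ?_)
    · refine Eq.trans ?_ (Category.assoc _ _ _).symm
      refine whisker_eq _ ?_
      refine Eq.trans ?_ (Category.assoc _ _ _).symm
      refine Eq.trans ?_ (whisker_eq _ h8.symm)
      refine Eq.trans (whisker_eq _ (whisker_eq _ h6.symm)) ?_
      refine Eq.trans (whisker_eq _ (Category.assoc _ _ _).symm) ?_
      exact comp_whisker h5 _
    · exact (Category.assoc _ _ _).trans (whisker_eq _ (Category.assoc _ _ _))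

theorem gamma_left_unit (M : Multitensor V) (hM : IsDistributive.{w} M.E) (X : VGraph.{w} V)
    (a b : X.obj) :
    gammaUnitHom M (gammaObj M.E X) a b ≫ gammaMulHom M hM X a b = 𝟙 _ :=
  gamma_hom_ext_one fun x => by
    let y : (ObjSeq.single a b).Inner := fun i =>
      x.copy (ObjSeq.single_castSucc a b i).symm (ObjSeq.single_succ a b i).symm
    have h1 := M.isMultitensor.unit_natural (gammaIncl M.E X x)
    have h2 : tmap M.E (fun _ : Fin 1 => gammaIncl M.E X x) ≫ singleCast M.E (gammaObj M.E X) a b =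
        tmap M.E (fun i => gammaIncl M.E X (y i)) := by
      refine (tcast_tmap M.E (X := fun _ : Fin 1 => seqTensor M.E X x)
        (Y := fun i => seqTensor M.E X (y i)) rfl (fun _ => rfl) _ _
        (fun i => gammaIncl M.E X (y i)) fun i => ?_).trans (Category.id_comp _)
      exact (gammaIncl_copy M.E X x (ObjSeq.single_castSucc a b i).symm
        (ObjSeq.single_succ a b i).symm _).trans (Category.id_comp _).symm
    have h3 := gammaMul_spec M hM X (ObjSeq.single a b) y
    have h4 := M.isMultitensor.unit_left (homs X x)
    have hl : ∑ _i : Fin 1, x.len = x.len := by simp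
    have hX := homs_congr X (ObjSeq.concat_single_left x) hl
    have h5 := gammaIncl_congr M.E X (ObjSeq.concat_single_left x) hl hX
    have h6 : concatCast M.E X (ObjSeq.single a b) y ≫ tcast M.E hl hX =
        tcast M.E hl (flat_unit_left (homs X x)) := tcast_trans M.E _ _ _ _
    refine Eq.trans ?_ (Category.comp_id _).symm
    unfold gammaUnitHom
    refine (whisker_eq _ (Category.assoc _ _ _)).trans ?_
    refine (comp_whisker h1 _).trans ?_
    refine (whisker_eq _ (whisker_eq _ (Category.assoc _ _ _))).trans ?_
    refine (whisker_eq _ ((Category.assoc _ _ _).symm.trans (eq_whisker h2 _))).trans ?_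
    refine (whisker_eq _ h3).trans ?_
    refine (whisker_eq _ (whisker_eq _ (whisker_eq _ h5.symm))).trans ?_
    refine (whisker_eq _ (whisker_eq _ (Category.assoc _ _ _).symm)).trans ?_
    refine (whisker_eq _ (whisker_eq _ (eq_whisker h6 _))).trans ?_
    refine (whisker_eq _ (Category.assoc _ _ _).symm).trans ?_
    refine (Category.assoc _ _ _).symm.trans ?_
    exact (eq_whisker h4 _).trans (Category.id_comp _)

/-- The unit of `Γ E` as a morphism of graphs. -/
noncomputable abbrev gammaUnit (M : Multitensor V) (X : VGraph.{w} V) : X ⟶ gammaObj M.E X :=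
  ⟨id, gammaUnitHom M X⟩

/-- The multiplication of `Γ E` as a morphism of graphs. -/
noncomputable abbrev gammaMul (M : Multitensor V) (hM : IsDistributive.{w} M.E)
    (X : VGraph.{w} V) : gammaObj M.E (gammaObj M.E X) ⟶ gammaObj M.E X :=
  ⟨id, gammaMulHom M hM X⟩

theorem gamma_right_unit (M : Multitensor V) (hM : IsDistributive.{w} M.E) (X : VGraph.{w} V)
    (a b : X.obj) :
    gammaMapHom M.E (gammaUnit M X) a b ≫ gammaMulHom M hM X a b = 𝟙 _ :=
  gamma_hom_ext_one fun x => by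
    let y : x.Inner := fun i => ObjSeq.single (x.vtx i.castSucc) (x.vtx i.succ)
    have h1 := gammaIncl_map M.E (gammaUnit M X) x
    have h2 : seqTensorMap M.E (gammaUnit M X) x =
        tmap M.E (fun i => M.unit (homs X x i)) ≫
          tmap M.E (fun i => singleCast M.E X (x.vtx i.castSucc) (x.vtx i.succ)) ≫
            tmap M.E (fun i => gammaIncl M.E X (y i)) := by
      rw [tmap_comp, tmap_comp]
      rfl
    have h3 := gammaMul_spec M hM X x y
    have h4 := M.isMultitensor.unit_right (homs X x)
    have hl : ∑ _i : Fin x.len, 1 = x.len := by simp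
    have hX := homs_congr X (ObjSeq.concat_single_right x) hl
    have h5 := gammaIncl_congr M.E X (ObjSeq.concat_single_right x) hl hX
    have hS : ∀ i (j : Fin 1), homs X x i = homs X (y i) j := fun i j => (congrArg₂ X.hom
      (ObjSeq.single_castSucc (x.vtx i.castSucc) (x.vtx i.succ) j)
      (ObjSeq.single_succ (x.vtx i.castSucc) (x.vtx i.succ) j)).symm
    have h6 : tmap M.E (fun i => singleCast M.E X (x.vtx i.castSucc) (x.vtx i.succ)) ≫
          M.subst (fun i => (y i).len) (fun i => homs X (y i)) =
        M.subst (fun _ => 1) (fun i _ => homs X x i) ≫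
          tcast M.E rfl (fun l => hS _ (finSigmaFinEquiv.symm l).2) := by
      refine (eq_whisker (tmap_eqToHom M.E (fun i => tobj_congr M.E rfl (hS i))) _).trans ?_
      exact subst_tcast (E := M.E) M.subst rfl (n := fun _ => 1) (n' := fun i => (y i).len)
        (fun _ => rfl) hS _ rfl _
    have h7 : tcast M.E rfl (fun l => hS _ (finSigmaFinEquiv.symm l).2) ≫
        concatCast M.E X x y ≫ tcast M.E hl hX = tcast M.E hl (flat_unit_right (homs X x)) :=
      (whisker_eq _ (tcast_trans M.E _ _ _ _)).trans (tcast_trans M.E _ _ _ _)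
    refine Eq.trans ?_ (Category.comp_id _).symm
    refine (comp_whisker h1 _).trans ?_
    refine (eq_whisker h2 _).trans ?_
    refine (Category.assoc _ _ _).trans ?_
    refine (whisker_eq _ ((Category.assoc _ _ _).trans (whisker_eq _ h3))).trans ?_
    refine (whisker_eq _ (comp_whisker h6 _)).trans ?_
    refine (whisker_eq _ (whisker_eq _ (whisker_eq _ (whisker_eq _ h5.symm)))).trans ?_
    refine (whisker_eq _ (whisker_eq _ (whisker_eq _ (Category.assoc _ _ _).symm))).trans ?_
    refine (whisker_eq _ (whisker_eq _ ((Category.assoc _ _ _).symm.trans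
      (eq_whisker h7 _)))).trans ?_
    refine (whisker_eq _ (Category.assoc _ _ _).symm).trans ?_
    refine (Category.assoc _ _ _).symm.trans ?_
    exact (eq_whisker h4 _).trans (Category.id_comp _)

/-- Maps out of `E_i (Γ E)² X(x_{i-1}, x_i)` are determined on triply nested sequences. -/
theorem gamma_hom_ext_three {E : TensorFunctor V} (hE : IsDistributive.{w} E) {X : VGraph.{w} V}
    {a b : X.obj} (x : ObjSeq X.obj a b) (y : x.Inner) {A : V}
    {f g : (E x.len).obj (fun i => gammaSeqTensor E X (y i)) ⟶ A}
    (h : ∀ z : ∀ i, (y i).Inner,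
      tmap E (fun i => tmap E (fun j => gammaIncl E X (z i j))) ≫ f =
        tmap E (fun i => tmap E (fun j => gammaIncl E X (z i j))) ≫ g) :
    f = g := by
  have hc : ∀ i, Nonempty (IsColimit (Cofan.mk (gammaSeqTensor E X (y i))
      (fun z : (y i).Inner => tmap E (fun j => gammaIncl E X (z j))))) := fun i => by
    have hex := fun (B : V) (k : ∀ z : (y i).Inner,
        (E (y i).len).obj (fun j => seqTensor E X (z j)) ⟶ B) =>
      hE.existsUnique (J := fun j : Fin (y i).len =>
        ObjSeq X.obj ((y i).vtx j.castSucc) ((y i).vtx j.succ))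
        (fun _ z => seqTensor E X z) _ (fun _ z => gammaIncl E X z)
        (fun _ => ⟨coproductIsCoproduct _⟩) k
    exact ⟨Cofan.IsColimit.mk _ (fun s => (hex s.pt s.inj).choose)
      (fun s z => (hex s.pt s.inj).choose_spec.1 z)
      (fun s m hm => (hex s.pt s.inj).choose_spec.2 m hm)⟩
  exact (hE.existsUnique (J := fun i : Fin x.len => (y i).Inner)
    (fun i z => (E (y i).len).obj (fun j => seqTensor E X (z j))) _
    (fun _ z => tmap E (fun j => gammaIncl E X (z j))) hc _).unique h (fun _ => rfl)

theorem gamma_assoc (M : Multitensor V) (hM : IsDistributive.{w} M.E) (X : VGraph.{w} V)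
    (a b : X.obj) :
    gammaMapHom M.E (gammaMul M hM X) a b ≫ gammaMulHom M hM X a b =
      gammaMulHom M hM (gammaObj M.E X) a b ≫ gammaMulHom M hM X a b :=
  gamma_hom_ext_one (X := gammaObj M.E (gammaObj M.E X)) (a := a) (b := b) fun x =>
    gamma_hom_ext_two (X := gammaObj M.E X) (a := a) (b := b) hM x fun y =>
      gamma_hom_ext_three (X := X) hM x y fun z => by
    let c : x.Inner := fun i => (y i).concat (z i)
    let w : (x.concat y).Inner := fun l =>
      (z (finSigmaFinEquiv.symm l).1 (finSigmaFinEquiv.symm l).2).copy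
        (ObjSeq.concat_castSucc x y l) (ObjSeq.concat_succ x y l)
    have h1 := gammaIncl_map M.E (gammaMul M hM X) x
    have h2 : tmap M.E (fun i => tmap M.E (fun j => gammaIncl M.E X (z i j))) ≫
          tmap M.E (fun i => gammaIncl₂ M.E X (y i)) ≫
            seqTensorMap M.E (gammaMul M hM X) x =
        tmap M.E (fun i => M.subst (fun j => (z i j).len) (fun j => homs X (z i j))) ≫
          tmap M.E (fun i => concatCast M.E X (y i) (z i)) ≫
            tmap M.E (fun i => gammaIncl M.E X (c i)) := by
      refine (whisker_eq _ (tmap_comp M.E _ _)).trans ((tmap_comp M.E _ _).trans ?_)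
      refine Eq.trans ?_ ((whisker_eq _ (tmap_comp M.E _ _)).trans (tmap_comp M.E _ _)).symm
      exact congrArg (tmap M.E) (funext fun i => gammaMul_spec M hM X (y i) (z i))
    have h3 := gammaMul_spec M hM X x c
    have hC : ∀ i l, flat (fun j => homs X (z i j)) l = homs X (c i) l := fun i l =>
      congrArg₂ X.hom (ObjSeq.concat_castSucc (y i) (z i) l) (ObjSeq.concat_succ (y i) (z i) l)
    have hF : ∀ l, flat (fun i => flat (fun j => homs X (z i j))) l =
        flat (fun i => homs X (c i)) l := fun l => congrArg₂ X.hom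
          (ObjSeq.concat_castSucc _ (z _) _) (ObjSeq.concat_succ _ (z _) _)
    have h4 : tmap M.E (fun i => concatCast M.E X (y i) (z i)) ≫
          M.subst (fun i => (c i).len) (fun i => homs X (c i)) =
        M.subst (fun i => ∑ j, (z i j).len) (fun i => flat (fun j => homs X (z i j))) ≫
          tcast M.E rfl hF := by
      refine (eq_whisker (tmap_eqToHom M.E (fun i => tobj_congr M.E rfl (hC i))) _).trans ?_
      exact subst_tcast (E := M.E) M.subst rfl (n := fun i => ∑ j, (z i j).len)
        (n' := fun i => (c i).len) (fun _ => rfl) hC _ rfl hF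
    have r1 := gammaMul_spec M hM (gammaObj M.E X) x y
    have r1' : tmap M.E (fun i => gammaIncl₂ M.E X (y i)) ≫
          gammaIncl₂ M.E (gammaObj M.E X) x ≫ gammaMulHom M hM (gammaObj M.E X) a b ≫
            gammaMulHom M hM X a b =
        M.subst (fun i => (y i).len) (fun i => homs (gammaObj M.E X) (y i)) ≫
          concatCast M.E (gammaObj M.E X) x y ≫ gammaIncl₂ M.E X (x.concat y) ≫
            gammaMulHom M hM X a b :=
      (whisker_eq _ (Category.assoc _ _ _).symm).trans ((Category.assoc _ _ _).symm.trans
        ((eq_whisker r1 _).trans ((Category.assoc _ _ _).trans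
          (whisker_eq _ (Category.assoc _ _ _)))))
    have r2 := M.isMultitensor.subst_natural (fun i => (y i).len)
      (fun i j => seqTensor M.E X (z i j)) (fun i => homs (gammaObj M.E X) (y i))
      (fun i j => gammaIncl M.E X (z i j))
    have r3 : tmap M.E (X := flat (fun i j => seqTensor M.E X (z i j)))
          (Y := flat (fun i => homs (gammaObj M.E X) (y i)))
          (fun l => gammaIncl M.E X
            (z (finSigmaFinEquiv.symm l).1 (finSigmaFinEquiv.symm l).2)) ≫
          concatCast M.E (gammaObj M.E X) x y =
        𝟙 _ ≫ tmap M.E (fun l => gammaIncl M.E X (w l)) := by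
      refine (tcast_tmap M.E (X := flat (fun i j => seqTensor M.E X (z i j)))
        (Y := fun l => seqTensor M.E X (w l)) rfl (fun _ => rfl) _ _
        (fun l => gammaIncl M.E X (w l)) fun l => ?_)
      exact (gammaIncl_copy M.E X _ (ObjSeq.concat_castSucc x y l)
        (ObjSeq.concat_succ x y l) _).trans (Category.id_comp _).symm
    have r4 := gammaMul_spec M hM X (x.concat y) w
    have h5 := M.isMultitensor.assoc (fun i => (y i).len) (fun i j => (z i j).len)
      (fun i j => homs X (z i j))
    have h5' := comp_whisker ((Category.assoc _ _ _).trans h5)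
      (concatCast M.E X (x.concat y) w ≫ gammaIncl M.E X ((x.concat y).concat w))
    have hl : (x.concat c).len = ((x.concat y).concat w).len :=
      (sum_flat fun i j => (z i j).len).symm
    have hX := homs_congr X (ObjSeq.concat_concat x y z) hl
    have h6 := gammaIncl_congr M.E X (ObjSeq.concat_concat x y z) hl hX
    have h7 : tcast M.E rfl hF ≫ concatCast M.E X x c ≫ tcast M.E hl hX =
        tcast M.E (sum_flat fun i j => (z i j).len).symm
          (flat_flat (fun i j => (z i j).len) (fun i j => homs X (z i j))) ≫
          concatCast M.E X (x.concat y) w :=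
      ((whisker_eq _ (tcast_trans M.E _ _ _ _)).trans (tcast_trans M.E _ _ _ _)).trans
        (tcast_trans M.E _ _ _ _).symm
    -- left hand side
    refine (whisker_eq _ (whisker_eq _ (comp_whisker h1 (gammaMulHom M hM X a b)))).trans ?_
    refine (whisker_eq _ (Category.assoc _ _ _).symm).trans ?_
    refine (Category.assoc _ _ _).symm.trans ?_
    refine (eq_whisker h2 _).trans ?_
    refine (Category.assoc _ _ _).trans ?_
    refine (whisker_eq _ (Category.assoc _ _ _)).trans ?_
    refine (whisker_eq _ (whisker_eq _ h3)).trans ?_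
    refine (whisker_eq _ (comp_whisker h4 _)).trans ?_
    refine (whisker_eq _ (whisker_eq _ (whisker_eq _ (whisker_eq _ h6.symm)))).trans ?_
    refine (whisker_eq _ (whisker_eq _ (whisker_eq _ (Category.assoc _ _ _).symm))).trans ?_
    refine (whisker_eq _ (whisker_eq _ ((Category.assoc _ _ _).symm.trans
      (eq_whisker h7 _)))).trans ?_
    refine (whisker_eq _ (whisker_eq _ (Category.assoc _ _ _))).trans ?_
    -- right hand side
    refine Eq.trans ?_ (whisker_eq _ r1').symm
    refine Eq.trans ?_ (comp_whisker r2 _).symm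
    refine Eq.trans ?_ (whisker_eq _ (comp_whisker r3 _)).symm
    refine Eq.trans ?_ (whisker_eq _ (Category.id_comp _)).symm
    refine Eq.trans ?_ (whisker_eq _ r4).symm
    exact (Category.assoc _ _ _).symm.trans h5'

/-- The monad `Γ E` on `G V` induced by a distributive multitensor `E`. -/
noncomputable def gammaMonad (M : Multitensor V) (hM : IsDistributive.{w} M.E) :
    Monad (VGraph.{w} V) where
  toFunctor := gammaFunctor M.E
  η :=
    { app := gammaUnit M
      naturality := fun _ _ f => VGraph.hom_ext fun a b => gammaUnit_natural M f a b }
  μ :=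
    { app := gammaMul M hM
      naturality := fun _ _ f => VGraph.hom_ext fun a b => gammaMul_natural M hM f a b }
  left_unit X := VGraph.hom_ext fun a b => gamma_left_unit M hM X a b
  right_unit X := VGraph.hom_ext fun a b => gamma_right_unit M hM X a b
  assoc X := VGraph.hom_ext fun a b => gamma_assoc M hM X a b

end Gamma

/-- Distributive laws `λ_X : Γ(E) G(T) X ⟶ G(T) Γ(E) X` of `G(T)` over `Γ(E)` whose components are
identities on objects. -/
abbrev IdOnObjDistributiveLaw {V : Type u} [Category.{v} V] [HasCoproducts.{w} V]
    (M : Multitensor V) (T : Monad V) (hM : IsDistributive.{w} M.E) :=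
  {l : DistributiveLaw (graphMonad.{w} T) (gammaMonad M hM) // ∀ X, (l.app X).obj = id}

end EnrichedMultitensor

open EnrichedMultitensor

namespace EnrichedMultitensor

/-! The substitution `σ'` of a composite multitensor mixes three operations: the multiplication of
`T`, the substitution of `E`, and an exchange of `E` past `T`. The conditions in 2 force the first
two. The middle unit law together with `Tu` being a monad map makes `σ'` restrict to `μ`
(`inl_substLeft`). The middle unit law together with `ηE` being a multitensor map makes it restrict
to `Tσ` (`map_η_subst`). Only the exchange is free, and it is isolated by inserting units: `τ` is
`η` outside, `Tu` in every variable, then `σ'`. The factorization `σ' = Tσ ∘ μ ∘ Tτ` follows from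
`map_inl_substRight` and `map_inl_substRight_map_subst`, so passing from `σ'` to `τ` and back loses
nothing. Conversely, when `σ'` is defined by this factorization, associativity is a diagram built
from the axioms on `τ`, associativity of `σ` and associativity of `μ` (`comp_assoc_aux`).

For distributive `E`, an `E`-category yields an action of `Γ(E)` on its graph, `E`-functors are the
graph maps that preserve the actions (`ECat.isFunctor_iff`), and `Γ(E)G` is the free `E`-category on
`G`. Beck's argument then turns a lifting into a distributive law (`LiftingData.law`) from which the
lifting can be reconstructed (`law_action`). The law of the lifting defined by `τ` is `T(k) ∘ τ` on
each summand (`law_app`).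

To pass from a law `λ` back to `τ`, a sequence `X_1, …, X_n` is realized as the consecutive homs of
a path graph on `0, …, n` whose other homs are initial. Distributivity makes `E` initial on every
sequence with an initial entry, so the full path is the only contribution to `Γ(E)(0, n)` and its
inclusion `k` is invertible (`pathGraph_isIso`). Hence `λ` on the path graph is a map `E_i T X_i ⟶ T
E_i X_i`. Naturality of `λ` along maps out of path graphs determines it on every graph, and
cancelling the invertible `T(k)` turns each axiom for `λ` into one for `τ` (`exists_coherence`).

For the isomorphism of categories, a `TE`-category restricts along `ηE` to an `E`-category and along
`Tu` to a `T`-algebra structure on every hom. Its composition is recovered as `T` of the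
`E`-composition followed by the action (`map_restrict_comp`). The comparison functor is therefore
full, faithful and bijective on objects. -/

theorem heq_apply_of_eq {α ι : Sort*} {n : ι → ℕ} (Z : ∀ i, Fin (n i) → α) {i i' : ι} (h : i = i')
    (k : Fin (n i)) (hn : n i = n i') : Z i k = Z i' (Fin.cast hn k) := by
  subst h
  rfl

/-! ### Substitution with reindexing and along singleton sequences -/

section Substitution

variable {V : Type u} [Category.{v} V]

theorem comp_eqToHom_of_eq {ι : Sort*} {X Y : ι → V} (f : ∀ i, X i ⟶ Y i) {i j : ι} (h : i = j)
    (hX : X i = X j) (hY : Y i = Y j) : f i ≫ eqToHom hY = eqToHom hX ≫ f j := by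
  subst h
  simp

namespace Multitensor

variable (M : Multitensor V)

/-- The substitution, with values in any sequence equal to the concatenated one. -/
def substTo {m : ℕ} {n : Fin m → ℕ} (Z : ∀ i, Fin (n i) → V) {N : ℕ} {W : Fin N → V}
    (h : ∑ i, n i = N) (hW : ∀ l, flat Z l = W (Fin.cast h l)) :
    (M.E m).obj (fun i => (M.E (n i)).obj (Z i)) ⟶ (M.E N).obj W :=
  M.subst n Z ≫ tcast M.E h hW

theorem substTo_rfl {m : ℕ} {n : Fin m → ℕ} (Z : ∀ i, Fin (n i) → V) :
    M.substTo Z rfl (fun _ => rfl) = M.subst n Z :=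
  Category.comp_id _

theorem substTo_natural {m : ℕ} {n : Fin m → ℕ} {Z Z' : ∀ i, Fin (n i) → V}
    (f : ∀ i j, Z i j ⟶ Z' i j) {N : ℕ} {W W' : Fin N → V} (h : ∑ i, n i = N)
    (hW : ∀ l, flat Z l = W (Fin.cast h l)) (hW' : ∀ l, flat Z' l = W' (Fin.cast h l))
    (g : ∀ l, W l ⟶ W' l)
    (hg : ∀ l, f (finSigmaFinEquiv.symm l).1 (finSigmaFinEquiv.symm l).2 ≫ eqToHom (hW' l) =
      eqToHom (hW l) ≫ g (Fin.cast h l)) :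
    tmap M.E (fun i => tmap M.E (f i)) ≫ M.substTo Z' h hW' = M.substTo Z h hW ≫ tmap M.E g := by
  refine (comp_whisker (M.isMultitensor.subst_natural n Z Z' f) _).trans ?_
  refine (whisker_eq _ (tcast_tmap M.E h hW hW' _ g hg)).trans ?_
  exact (Category.assoc _ _ _).symm

/-- All lengths and sequences that should agree are separate variables linked by equations. Each
equation can therefore be eliminated, which leaves the associativity axiom, while an application may
choose whichever presentation of the concatenations is convenient. -/
theorem substTo_assoc {m : ℕ} {n : Fin m → ℕ} {p : ∀ i, Fin (n i) → ℕ}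
    (Z : ∀ i (j : Fin (n i)), Fin (p i j) → V)
    {q : Fin m → ℕ} {W : ∀ i, Fin (q i) → V} (hq : ∀ i, ∑ j, p i j = q i)
    (hW : ∀ i l, flat (Z i) l = W i (Fin.cast (hq i) l))
    {N : ℕ} {Y : Fin N → V} (hN : ∑ i, q i = N) (hY : ∀ l, flat W l = Y (Fin.cast hN l))
    {r : ℕ} {b : Fin r → ℕ} {B : ∀ l, Fin (b l) → V} (hr : ∑ i, n i = r)
    (hb : ∀ l, flat p l = b (Fin.cast hr l))
    (hB : ∀ l k, Z (finSigmaFinEquiv.symm l).1 (finSigmaFinEquiv.symm l).2 k =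
      B (Fin.cast hr l) (Fin.cast (hb l) k))
    (hE : ∀ l, flat (fun i j => (M.E (p i j)).obj (Z i j)) l =
      (M.E (b (Fin.cast hr l))).obj (B (Fin.cast hr l)))
    (hN' : ∑ l, b l = N) (hY' : ∀ l, flat B l = Y (Fin.cast hN' l)) :
    tmap M.E (fun i => M.substTo (Z i) (hq i) (hW i)) ≫ M.substTo W hN hY =
      M.substTo (fun i j => (M.E (p i j)).obj (Z i j)) hr hE ≫ M.substTo B hN' hY' := by
  obtain rfl : (fun i => ∑ j, p i j) = q := funext hq
  obtain rfl : (fun i => flat (Z i)) = W := funext fun i => funext fun l => hW i l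
  subst hr
  obtain rfl : flat p = b := funext hb
  obtain rfl : (fun r => Z (finSigmaFinEquiv.symm r).1 (finSigmaFinEquiv.symm r).2) = B :=
    funext fun l => funext fun k => hB l k
  subst hN'
  obtain rfl : flat (n := flat p)
    (fun r => Z (finSigmaFinEquiv.symm r).1 (finSigmaFinEquiv.symm r).2) = Y := funext hY'
  have h1 : (fun i => M.substTo (Z i) (hq i) (hW i)) = fun i => M.subst (p i) (Z i) :=
    funext fun i => M.substTo_rfl (Z i)
  have h2 : M.substTo (n := flat p)
      (fun r => Z (finSigmaFinEquiv.symm r).1 (finSigmaFinEquiv.symm r).2) rfl hY' =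
      M.subst _ _ := M.substTo_rfl _
  have h3 : M.substTo (fun i j => (M.E (p i j)).obj (Z i j)) rfl hE = M.subst _ _ :=
    M.substTo_rfl _
  rw [h1, h2]
  refine Eq.trans ?_ (eq_whisker h3 _).symm
  exact M.isMultitensor.assoc n p Z

/-- Substitution of a single sequence. -/
def substLeft {n : ℕ} (X : Fin n → V) :
    (M.E 1).obj (fun _ => (M.E n).obj X) ⟶ (M.E n).obj X :=
  M.substTo (fun _ : Fin 1 => X) (by simp) (flat_unit_left X)

/-- Substitution of sequences of length one. -/
def substRight {n : ℕ} (X : Fin n → V) :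
    (M.E n).obj (fun i => (M.E 1).obj (fun _ => X i)) ⟶ (M.E n).obj X :=
  M.substTo (fun i (_ : Fin 1) => X i) (by simp) (flat_unit_right X)

theorem unit_substLeft {n : ℕ} (X : Fin n → V) :
    M.unit ((M.E n).obj X) ≫ M.substLeft X = 𝟙 _ :=
  M.isMultitensor.unit_left X

theorem unit_substRight {n : ℕ} (X : Fin n → V) :
    tmap M.E (fun i => M.unit (X i)) ≫ M.substRight X = 𝟙 _ :=
  M.isMultitensor.unit_right X

/-- Concatenation applied to the identity sequence reads off the index itself. -/
theorem finSigma_symm_one_snd {n : ℕ} (l : Fin (∑ _i : Fin 1, n)) :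
    (finSigmaFinEquiv.symm l).2 = Fin.cast (by simp) l :=
  flat_unit_left (fun i : Fin n => i) l

theorem finSigma_symm_one_fst {n : ℕ} (l : Fin (∑ _i : Fin n, 1)) :
    (finSigmaFinEquiv.symm l).1 = Fin.cast (by simp) l :=
  flat_unit_right (fun i : Fin n => i) l

theorem substLeft_natural {n : ℕ} {X Y : Fin n → V} (f : ∀ i, X i ⟶ Y i) :
    tmap M.E (fun _ : Fin 1 => tmap M.E f) ≫ M.substLeft Y = M.substLeft X ≫ tmap M.E f :=
  M.substTo_natural (fun (_ : Fin 1) j => f j) _ _ _ f fun l =>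
    comp_eqToHom_of_eq f (finSigma_symm_one_snd l) _ _

theorem substRight_natural {n : ℕ} {X Y : Fin n → V} (f : ∀ i, X i ⟶ Y i) :
    tmap M.E (fun i => tmap M.E (fun _ : Fin 1 => f i)) ≫ M.substRight Y =
      M.substRight X ≫ tmap M.E f :=
  M.substTo_natural (fun j (_ : Fin 1) => f j) _ _ _ f fun l =>
    comp_eqToHom_of_eq f (finSigma_symm_one_fst l) _ _

/-- This and the next five lemmas are associativity for triply nested sequences in which one or two
of the three levels have length one. They are the only forms of associativity needed to recover `τ`
from `σ'`. -/
theorem map_subst_substLeft {m : ℕ} (n : Fin m → ℕ) (Z : ∀ i, Fin (n i) → V) :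
    tmap M.E (fun _ : Fin 1 => M.subst n Z) ≫ M.substLeft (flat Z) =
      M.substLeft (fun i => (M.E (n i)).obj (Z i)) ≫ M.subst n Z := by
  rw [← M.substTo_rfl Z]
  exact M.substTo_assoc (fun (_ : Fin 1) i => Z i) (fun _ => rfl) (fun _ _ => rfl) _ _ (B := Z)
    (by simp) (fun l => congrArg n (finSigma_symm_one_snd l))
    (fun l k => heq_apply_of_eq Z (finSigma_symm_one_snd l) k _) _ _ _

theorem map_substRight_subst {m : ℕ} (n : Fin m → ℕ) (Z : ∀ i, Fin (n i) → V) :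
    tmap M.E (fun i => M.substRight (Z i)) ≫ M.subst n Z =
      M.subst n (fun i j => (M.E 1).obj (fun _ => Z i j)) ≫ M.substRight (flat Z) := by
  rw [← M.substTo_rfl Z, ← M.substTo_rfl (fun i j => (M.E 1).obj (fun _ => Z i j))]
  exact M.substTo_assoc (fun i j (_ : Fin 1) => Z i j) _ _ _ _ (B := fun l (_ : Fin 1) => flat Z l)
    rfl (fun _ => rfl) (fun _ _ => rfl) _ _ _

theorem map_substLeft_subst {m : ℕ} (n : Fin m → ℕ) (Z : ∀ i, Fin (n i) → V) :
    tmap M.E (fun i => M.substLeft (Z i)) ≫ M.subst n Z =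
      M.substRight (fun i => (M.E (n i)).obj (Z i)) ≫ M.subst n Z := by
  rw [← M.substTo_rfl Z]
  exact M.substTo_assoc (fun i (_ : Fin 1) => Z i) _ _ _ _ (B := Z)
    (by simp) (fun l => congrArg n (finSigma_symm_one_fst l))
    (fun l k => heq_apply_of_eq Z (finSigma_symm_one_fst l) k _) _ _ _

theorem map_substRight_substLeft {n : ℕ} (X : Fin n → V) :
    tmap M.E (fun _ : Fin 1 => M.substRight X) ≫ M.substLeft X =
      M.substLeft (fun i => (M.E 1).obj (fun _ => X i)) ≫ M.substRight X :=
  M.substTo_assoc (fun (_ : Fin 1) i (_ : Fin 1) => X i) _ _ _ _ (B := fun i (_ : Fin 1) => X i)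
    (by simp) (fun _ => rfl) (fun l _ => congrArg X (finSigma_symm_one_snd l)) _ _ _

theorem map_substRight_substRight {n : ℕ} (X : Fin n → V) :
    tmap M.E (fun i => M.substRight (fun _ : Fin 1 => X i)) ≫ M.substRight X =
      M.substRight (fun i => (M.E 1).obj (fun _ => X i)) ≫ M.substRight X :=
  M.substTo_assoc (fun i (_ : Fin 1) (_ : Fin 1) => X i) _ _ _ _ (B := fun i (_ : Fin 1) => X i)
    (by simp) (fun _ => rfl) (fun l _ => congrArg X (finSigma_symm_one_fst l)) _ _ _

theorem map_substLeft_substLeft {n : ℕ} (X : Fin n → V) :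
    tmap M.E (fun _ : Fin 1 => M.substLeft X) ≫ M.substLeft X =
      M.substLeft (fun _ : Fin 1 => (M.E n).obj X) ≫ M.substLeft X :=
  M.substTo_assoc (fun (_ : Fin 1) (_ : Fin 1) => X) _ _ _ _ (B := fun (_ : Fin 1) => X)
    (by simp) (fun _ => rfl) (fun _ _ => rfl) _ _ _

end Multitensor

end Substitution

/-! ### From monoidal coherences to composite multitensors -/

section Composite

variable {V : Type u} [Category.{v} V] {M : Multitensor V} {T : Monad V}

theorem tcast_compTensor {n n' : ℕ} (h : n = n') {X : Fin n → V}
    {Y : Fin n' → V} (hX : ∀ i, X i = Y (Fin.cast h i)) :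
    tcast (compTensor M T) h hX = T.map (tcast M.E h hX) := by
  subst h
  obtain rfl : X = Y := funext hX
  exact (T.map_id _).symm

theorem tmap_comp₂ (E : TensorFunctor V) {n : ℕ} {A B C D : Fin n → V} (f : ∀ i, A i ⟶ B i)
    (g : ∀ i, B i ⟶ C i) (h : ∀ i, C i ⟶ D i) :
    tmap E (fun i => f i ≫ g i ≫ h i) = tmap E f ≫ tmap E g ≫ tmap E h := by
  rw [tmap_comp, tmap_comp]

/-- The associativity of a composite substitution, reduced to that of its factors. -/
theorem comp_assoc_aux (T : Monad V) {A A₁ A₂ A₃ B B₁ B₂ C C₁ D D₁ : V}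
    {eTτ : A ⟶ A₁} {eμ : A₁ ⟶ A₂} {eTσ : A₂ ⟶ A₃}
    {τ₀ : A ⟶ T.obj B} {τ₁ : A₁ ⟶ T.obj B₁} {τ₂ : A₂ ⟶ T.obj B₂} {τ₃ : A₃ ⟶ T.obj C}
    {eτ : B ⟶ B₁} {τ₁' : B₁ ⟶ T.obj B₂} {eσ : B₂ ⟶ C} {σ₁ : C ⟶ D}
    {σ₂ : B ⟶ C₁} {τ₄ : C₁ ⟶ T.obj D₁} {σ₃ : B₂ ⟶ D₁} {σ₄ : D₁ ⟶ D}
    (n₁ : eTτ ≫ τ₁ = τ₀ ≫ T.map eτ) (n₂ : eμ ≫ τ₂ = τ₁ ≫ T.map τ₁' ≫ T.μ.app _)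
    (n₃ : eTσ ≫ τ₃ = τ₂ ≫ T.map eσ)
    (a : eσ ≫ σ₁ = σ₃ ≫ σ₄) (s : σ₂ ≫ τ₄ = eτ ≫ τ₁' ≫ T.map σ₃) :
    T.map (eTτ ≫ eμ ≫ eTσ) ≫ T.map τ₃ ≫ T.μ.app _ ≫ T.map σ₁ =
      (T.map τ₀ ≫ T.μ.app _ ≫ T.map σ₂) ≫ T.map τ₄ ≫ T.μ.app _ ≫ T.map σ₄ := by
  have e1 : eTτ ≫ eμ ≫ eTσ ≫ τ₃ = τ₀ ≫ T.map eτ ≫ T.map τ₁' ≫ T.μ.app _ ≫ T.map eσ := by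
    rw [n₃, reassoc_of% n₂, reassoc_of% n₁]
  have l : T.map (eTτ ≫ eμ ≫ eTσ) ≫ T.map τ₃ = T.map τ₀ ≫ T.map (T.map (eτ ≫ τ₁')) ≫
      T.map (T.μ.app _) ≫ T.map (T.map eσ) := by
    rw [← T.map_comp, Category.assoc, Category.assoc, e1]
    simp only [T.map_comp, Category.assoc]
  have r : T.map σ₂ ≫ T.map τ₄ = T.map (eτ ≫ τ₁') ≫ T.map (T.map σ₃) := by
    rw [← T.map_comp, s, ← T.map_comp, Category.assoc]
  -- Both sides reduce to two uses of `τ`, two multiplications and two substitutions. Naturality of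
  -- `μ` brings the multiplications together, and `m4` exchanges the inner one for the outer one.
  have m1 := T.μ.naturality (eτ ≫ τ₁')
  have m2 := T.μ.naturality eσ
  have m3 := T.μ.naturality σ₃
  have m4 := T.assoc B₂
  dsimp only [Functor.comp_map] at m1 m2 m3
  have a' : T.map eσ ≫ T.map σ₁ = T.map σ₃ ≫ T.map σ₄ := by rw [← T.map_comp, a, T.map_comp]
  rw [reassoc_of% l]
  simp only [Category.assoc]
  rw [reassoc_of% m2, reassoc_of% m4, a', reassoc_of% r, reassoc_of% m3, reassoc_of% m1]

theorem tcast_family (τ : ∀ {n : ℕ} (X : Fin n → V),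
      (M.E n).obj (fun i => T.obj (X i)) ⟶ T.obj ((M.E n).obj X)) {n n' : ℕ} (h : n = n')
    {X : Fin n → V} {Y : Fin n' → V} (hX : ∀ i, X i = Y (Fin.cast h i))
    (hX' : ∀ i, T.obj (X i) = T.obj (Y (Fin.cast h i))) :
    tcast M.E h hX' ≫ τ Y = τ X ≫ T.map (tcast M.E h hX) := by
  subst h
  obtain rfl : X = Y := funext hX
  exact (Category.id_comp _).trans
    ((Category.comp_id _).symm.trans (whisker_eq _ (T.map_id _).symm))

namespace MonoidalCoherence

/-- The substitution `T E_i T E_j X_{ij} ⟶ T E_{ij} X_{ij}` of the composite multitensor. -/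
def compSubst (c : MonoidalCoherence M T) : TensorSubst (compTensor M T) := fun n Z =>
  T.map (c.τ fun i => (M.E (n i)).obj (Z i)) ≫ T.μ.app _ ≫ T.map (M.subst n Z)

theorem compSubst_natural (c : MonoidalCoherence M T) {m : ℕ} (n : Fin m → ℕ)
    (Z Z' : ∀ i, Fin (n i) → V) (f : ∀ i j, Z i j ⟶ Z' i j) :
    tmap (compTensor M T) (fun i => tmap (compTensor M T) (f i)) ≫ c.compSubst n Z' =
      c.compSubst n Z ≫
        tmap (compTensor M T) (fun l => f (finSigmaFinEquiv.symm l).1 (finSigmaFinEquiv.symm l).2) := by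
  have h1 := congrArg T.map (c.natural fun i => tmap M.E (f i))
  have h2 := congrArg T.map (M.isMultitensor.subst_natural n Z Z' f)
  have h3 := T.μ.naturality (tmap M.E fun i => tmap M.E (f i))
  rw [T.map_comp, T.map_comp] at h1 h2
  refine (comp_whisker h1 _).trans ?_
  refine (whisker_eq _ (comp_whisker h3 _)).trans ?_
  refine (whisker_eq _ (whisker_eq _ h2)).trans ?_
  exact (whisker_eq _ (Category.assoc _ _ _).symm).trans (Category.assoc _ _ _).symm

/-- An `η` on the outer `T` slides past `Tτ` by naturality and cancels `μ`, so only `τ` and `Tσ`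
survive. In `map_η_compSubst` the `η`s are inserted on the inner `T`s instead: there the unit axiom
absorbs `τ` and only `Tσ` survives. These two restrictions give the unit laws of `TE` and the
compatibility of `ηE` with substitution. -/
theorem η_compSubst (c : MonoidalCoherence M T) {m : ℕ} (n : Fin m → ℕ)
    (Z : ∀ i, Fin (n i) → V) :
    T.η.app _ ≫ c.compSubst n Z =
      c.τ (fun i => (M.E (n i)).obj (Z i)) ≫ T.map (M.subst n Z) := by
  have h := T.η.naturality (c.τ fun i => (M.E (n i)).obj (Z i))
  refine (comp_whisker h.symm _).trans ?_
  refine whisker_eq _ ?_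
  refine (Category.assoc _ _ _).symm.trans ?_
  exact (eq_whisker (T.left_unit _) _).trans (Category.id_comp _)

theorem map_η_compSubst (c : MonoidalCoherence M T) {m : ℕ} (n : Fin m → ℕ)
    (Z : ∀ i, Fin (n i) → V) :
    T.map (tmap M.E fun i => T.η.app ((M.E (n i)).obj (Z i))) ≫ c.compSubst n Z =
      T.map (M.subst n Z) := by
  have h := congrArg T.map (c.monad_unit fun i => (M.E (n i)).obj (Z i))
  rw [T.map_comp] at h
  refine (Category.assoc _ _ _).symm.trans ((eq_whisker h _).trans ?_)
  refine (Category.assoc _ _ _).symm.trans ?_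
  exact (eq_whisker (T.right_unit _) _).trans (Category.id_comp _)

theorem compSubst_unit_left (c : MonoidalCoherence M T) {n : ℕ} (Z : Fin n → V) :
    compUnit M T (T.obj ((M.E n).obj Z)) ≫ c.compSubst (fun _ : Fin 1 => n) (fun _ => Z) ≫
      tcast (compTensor M T) (by simp) (flat_unit_left Z) = 𝟙 _ := by
  have h1 := c.η_compSubst (fun _ : Fin 1 => n) (fun _ => Z)
  have h2 := c.unit ((M.E n).obj Z)
  have h3 := M.isMultitensor.unit_left Z
  rw [tcast_compTensor]
  refine (Category.assoc _ _ _).trans ?_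
  refine (whisker_eq _ (comp_whisker h1 _)).trans ?_
  refine (comp_whisker (h2.trans (Category.comp_id _).symm) _).trans ?_
  refine (whisker_eq _ (Category.id_comp _)).trans ?_
  refine (whisker_eq _ (T.map_comp _ _).symm).trans ?_
  exact (T.map_comp _ _).symm.trans ((congrArg T.map h3).trans (T.map_id _))

theorem compSubst_unit_right (c : MonoidalCoherence M T) {n : ℕ} (Z : Fin n → V) :
    tmap (compTensor M T) (fun i => compUnit M T (Z i)) ≫
      c.compSubst (fun _ : Fin n => 1) (fun i _ => Z i) ≫
      tcast (compTensor M T) (by simp) (flat_unit_right Z) = 𝟙 _ := by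
  have h1 := c.map_η_compSubst (fun _ : Fin n => 1) (fun i _ => Z i)
  have h3 := M.isMultitensor.unit_right Z
  have h4 : tmap (compTensor M T) (fun i => compUnit M T (Z i)) =
      T.map (tmap M.E fun i => M.unit (Z i)) ≫
        T.map (tmap M.E fun i => T.η.app ((M.E 1).obj fun _ => Z i)) :=
    (congrArg T.map (tmap_comp M.E _ _).symm).trans (T.map_comp _ _)
  rw [tcast_compTensor]
  refine (eq_whisker h4 _).trans ?_
  refine (Category.assoc _ _ _).trans ?_
  refine (whisker_eq _ ((Category.assoc _ _ _).symm.trans (eq_whisker h1 _))).trans ?_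
  refine (whisker_eq _ (T.map_comp _ _).symm).trans ?_
  exact (T.map_comp _ _).symm.trans ((congrArg T.map h3).trans (T.map_id _))

/-- The inputs are naturality of `τ` (twice), its compatibility with `μ` and with `σ`, and
associativity of `σ`. The unit axioms for `τ` play no role. -/
theorem compSubst_assoc (c : MonoidalCoherence M T) {m : ℕ} (n : Fin m → ℕ)
    (p : ∀ i, Fin (n i) → ℕ) (Z : ∀ i (j : Fin (n i)), Fin (p i j) → V) :
    tmap (compTensor M T) (fun i => c.compSubst (p i) (Z i)) ≫
        c.compSubst (fun i => ∑ j, p i j) (fun i => flat (Z i)) ≫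
          tcast (compTensor M T) (sum_flat p).symm (flat_flat p Z) =
      c.compSubst n (fun i j => (compTensor M T (p i j)).obj (Z i j)) ≫
        c.compSubst (flat p) (fun r => Z (finSigmaFinEquiv.symm r).1 (finSigmaFinEquiv.symm r).2) := by
  have h0 : tmap (compTensor M T) (fun i => c.compSubst (p i) (Z i)) =
      T.map (tmap M.E (fun i => T.map (c.τ fun j => (M.E (p i j)).obj (Z i j))) ≫
        tmap M.E (fun i => T.μ.app ((M.E (n i)).obj fun j => (M.E (p i j)).obj (Z i j))) ≫
        tmap M.E (fun i => T.map (M.subst (p i) (Z i)))) :=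
    congrArg T.map (tmap_comp₂ M.E _ _ _)
  have h1 := c.natural fun i => c.τ fun j => (M.E (p i j)).obj (Z i j)
  have h2 := c.monad_mul fun i => (M.E (n i)).obj fun j => (M.E (p i j)).obj (Z i j)
  have h3 := c.natural fun i => M.subst (p i) (Z i)
  have h4 := M.isMultitensor.assoc n p Z
  have h5 := c.subst n fun i j => (M.E (p i j)).obj (Z i j)
  rw [tcast_compTensor]
  have key := comp_assoc_aux T h1 h2 h3 h4 h5.symm
  refine (eq_whisker h0 _).trans (Eq.trans ?_ key)
  refine whisker_eq _ ?_
  refine (Category.assoc _ _ _).trans (whisker_eq _ ((Category.assoc _ _ _).trans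
    (whisker_eq _ (T.map_comp _ _).symm)))

theorem isMultitensor_compSubst (c : MonoidalCoherence M T) :
    IsMultitensor (compTensor M T) (compUnit M T) c.compSubst where
  unit_natural {X Y} f := by
    refine (comp_whisker (M.isMultitensor.unit_natural f) _).trans ?_
    refine (whisker_eq _ (T.η.naturality _)).trans ?_
    exact (Category.assoc _ _ _).symm
  subst_natural := c.compSubst_natural
  unit_left := c.compSubst_unit_left
  unit_right := c.compSubst_unit_right
  assoc := c.compSubst_assoc

theorem middle_unit (c : MonoidalCoherence M T) {n : ℕ} (X : Fin n → V) :
    T.map (M.unit ((M.E n).obj X)) ≫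
        T.map (tmap M.E (fun _ : Fin 1 => T.η.app ((M.E n).obj X))) ≫
        c.compSubst (fun _ : Fin 1 => n) (fun _ => X) ≫
          tcast (compTensor M T) (by simp) (flat_unit_left X) = 𝟙 _ := by
  have h1 := c.map_η_compSubst (fun _ : Fin 1 => n) (fun _ => X)
  rw [tcast_compTensor]
  refine (whisker_eq _ ((Category.assoc _ _ _).symm.trans (eq_whisker h1 _))).trans ?_
  refine (whisker_eq _ (T.map_comp _ _).symm).trans ?_
  exact (T.map_comp _ _).symm.trans ((congrArg T.map (M.isMultitensor.unit_left X)).trans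
    (T.map_id _))

/-- `T u : T ⟶ T E_1` is a map of monads. -/
def unaryMonadHom (c : MonoidalCoherence M T) :
    T ⟶ Multitensor.unaryMonad ⟨compTensor M T, compUnit M T, c.compSubst,
      c.isMultitensor_compSubst⟩ where
  app X := T.map (M.unit X)
  naturality X Y f := by
    refine (T.map_comp _ _).symm.trans ?_
    exact (congrArg T.map (M.isMultitensor.unit_natural f)).trans (T.map_comp _ _)
  app_η X := (T.η.naturality _).symm
  app_μ X := by
    have h1 := congrArg T.map (c.unit ((M.E 1).obj fun _ => X))
    have h2 := congrArg T.map (M.isMultitensor.unit_left fun _ : Fin 1 => X)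
    rw [T.map_comp] at h1 h2
    have h3 := T.μ.naturality (M.unit X)
    have h4 := T.μ.naturality (M.unit ((M.E 1).obj fun _ => X))
    -- The unit axiom for `τ` makes `σ'`, precomposed with `Tu` on the outer level, equal to `μ`.
    -- The rest is naturality of `μ`.
    have h5 : T.map (M.unit (T.obj ((M.E 1).obj fun _ => X))) ≫
        c.compSubst (fun _ : Fin 1 => 1) (fun _ _ => X) ≫
          tcast (compTensor M T) (by simp) (flat_unit_left fun _ : Fin 1 => X) = T.μ.app _ := by
      rw [tcast_compTensor]
      refine (whisker_eq _ (Category.assoc _ _ _)).trans ?_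
      refine (comp_whisker (h1.trans (Category.comp_id _).symm) _).trans ?_
      refine (whisker_eq _ (Category.id_comp _)).trans ?_
      refine (whisker_eq _ ((Category.assoc _ _ _).trans
        (whisker_eq _ (T.map_comp _ _).symm))).trans ?_
      refine (comp_whisker h4 _).trans ?_
      exact (whisker_eq _ h2).trans ((whisker_eq _ (T.map_id _)).trans (Category.comp_id _))
    refine Eq.trans ?_ (Category.assoc _ _ _).symm
    exact h3.symm.trans (whisker_eq _ h5.symm)

/-- The composite multitensor of a monoidal monad. -/
def composite (c : MonoidalCoherence M T) : CompositeMultitensor M T where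
  subst := c.compSubst
  isMultitensor := c.isMultitensor_compSubst
  isMultitensorMap :=
    { natural := fun _ => T.η.naturality _
      unit := fun _ => rfl
      subst := fun n Z => by
        have h1 := c.η_compSubst n Z
        have h2 := c.monad_unit fun i => (M.E (n i)).obj (Z i)
        refine Eq.trans ?_ (whisker_eq _ h1).symm
        refine Eq.trans ?_ ((Category.assoc _ _ _).symm.trans (eq_whisker h2 _)).symm
        exact T.η.naturality _ }
  isMonadMap := ⟨c.unaryMonadHom, fun _ => rfl⟩
  middle_unit := c.middle_unit

/-- The outer `η` cancels `μ`, and the inner units cancel `σ` by the right unit law. The same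
expression, read for an arbitrary `σ'`, is the definition of `CompositeMultitensor.tau`. -/
theorem composite_τ (c : MonoidalCoherence M T) {n : ℕ} (X : Fin n → V) :
    T.η.app ((M.E n).obj fun i => T.obj (X i)) ≫
        T.map (tmap M.E fun i => T.map (M.unit (X i))) ≫
          c.composite.toMultitensor.substRight X = c.τ X := by
  have h1 := c.η_compSubst (fun _ : Fin n => 1) (fun i _ => X i)
  have h2 := c.natural fun i => M.unit (X i)
  have h3 := congrArg T.map (M.isMultitensor.unit_right X)
  rw [T.map_comp] at h3
  refine (comp_whisker (T.η.naturality _).symm _).trans ?_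
  have h4 : T.η.app ((M.E n).obj fun i => T.obj ((M.E 1).obj fun _ => X i)) ≫
      c.composite.toMultitensor.substRight X =
      c.τ (fun i => (M.E 1).obj fun _ => X i) ≫
        T.map (M.subst (fun _ : Fin n => 1) (fun i _ => X i) ≫
          tcast M.E (by simp) (flat_unit_right X)) := by
    refine (comp_whisker h1 _).trans ?_
    refine whisker_eq _ ((whisker_eq _ (tcast_compTensor _ _)).trans (T.map_comp _ _).symm)
  refine (whisker_eq _ h4).trans ?_
  refine (comp_whisker h2 _).trans ?_
  exact (whisker_eq _ (h3.trans (T.map_id _))).trans (Category.comp_id _)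

theorem composite_injective :
    Function.Injective (composite : MonoidalCoherence M T → CompositeMultitensor M T) := by
  intro c c' h
  ext n X
  rw [← c.composite_τ, ← c'.composite_τ, h]

end MonoidalCoherence

/-! ### Recovering `τ` from `σ'` -/

namespace CompositeMultitensor

variable (s : CompositeMultitensor M T)

/-- The maps `T u` as the inclusion of `T` into the composite multitensor. -/
abbrev inl (s : CompositeMultitensor M T) (X : V) : T.obj X ⟶ (s.toMultitensor.E 1).obj fun _ => X :=
  T.map (M.unit X)

theorem inl_natural {X Y : V} (f : X ⟶ Y) :
    T.map f ≫ s.inl Y = s.inl X ≫ tmap s.toMultitensor.E (fun _ => f) := by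
  refine (T.map_comp _ _).symm.trans ?_
  exact (congrArg T.map (M.isMultitensor.unit_natural f)).trans (T.map_comp _ _)

theorem η_inl (X : V) : T.η.app X ≫ s.inl X = s.toMultitensor.unit X :=
  (T.η.naturality _).symm

/-- This is the multiplication law of the monad map `Tu`. The multiplication of the unary monad of
`TE` is `substLeft` at a singleton by definition. -/
theorem inl_inl (X : V) :
    s.inl (T.obj X) ≫ tmap s.toMultitensor.E (fun _ => s.inl X) ≫
      s.toMultitensor.substLeft (fun _ : Fin 1 => X) = T.μ.app X ≫ s.inl X := by
  obtain ⟨φ, hφ⟩ := s.isMonadMap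
  have h1 := φ.app_μ X
  have h2 : T.map (T.map (M.unit X)) ≫ φ.app _ =
      s.inl (T.obj X) ≫ tmap s.toMultitensor.E (fun _ => s.inl X) :=
    (whisker_eq _ (hφ _)).trans (s.inl_natural (s.inl X))
  rw [hφ] at h1
  refine (Category.assoc _ _ _).symm.trans ((eq_whisker h2 _).symm.trans ?_)
  exact h1.symm

theorem inl_η {n : ℕ} (X : Fin n → V) :
    s.inl ((M.E n).obj X) ≫ tmap s.toMultitensor.E (fun _ => T.η.app ((M.E n).obj X)) ≫
      s.toMultitensor.substLeft X = 𝟙 _ :=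
  s.middle_unit X

/-- The middle unit law is inserted as an identity inside the outer level. Associativity for
singletons then brings two copies of `Tu` together, the monad map law replaces them by `μ` followed
by one copy, and the middle unit law removes what is left. -/
theorem inl_substLeft {n : ℕ} (X : Fin n → V) :
    s.inl (T.obj ((M.E n).obj X)) ≫ s.toMultitensor.substLeft X = T.μ.app ((M.E n).obj X) := by
  let S := s.toMultitensor
  let A := (M.E n).obj X
  have h1 : tmap S.E (fun _ : Fin 1 => 𝟙 (T.obj A)) =
      tmap S.E (fun _ => s.inl A) ≫ tmap S.E (fun _ => tmap S.E (fun _ => T.η.app A)) ≫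
        tmap S.E (fun _ => S.substLeft X) :=
    (congrArg (tmap S.E) (funext fun _ => (s.inl_η X).symm)).trans (tmap_comp₂ S.E _ _ _)
  have h1' := (tmap_id S.E (fun _ : Fin 1 => T.obj A)).symm.trans h1
  have h2 := S.map_substLeft_substLeft X
  have h3 := S.substLeft_natural (fun _ : Fin 1 => T.η.app A)
  have h4 := s.inl_inl A
  have h5 := s.inl_η X
  refine (whisker_eq _ (Category.id_comp _).symm).trans ?_
  refine (whisker_eq _ (eq_whisker h1' _)).trans ?_
  refine (whisker_eq _ ((Category.assoc _ _ _).trans (whisker_eq _ (Category.assoc _ _ _)))).trans ?_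
  refine (whisker_eq _ (whisker_eq _ (whisker_eq _ h2))).trans ?_
  refine (whisker_eq _ (whisker_eq _ (comp_whisker h3 _))).trans ?_
  refine (whisker_eq _ (Category.assoc _ _ _).symm).trans ?_
  exact (comp_whisker h4 _).trans ((whisker_eq _ h5).trans (Category.comp_id _))

/-- After precomposition with `η` the claim is the statement that `ηE` respects substitution. To
remove that `η`, the whole composite is preceded by the middle unit identity, and associativity
pulls `σ'` inside the outer level, where the weaker statement applies. -/
theorem map_η_subst {m : ℕ} (n : Fin m → ℕ) (Z : ∀ i, Fin (n i) → V) :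
    tmap s.toMultitensor.E (fun i => T.η.app ((M.E (n i)).obj (Z i))) ≫ s.subst n Z =
      T.map (M.subst n Z) := by
  let S := s.toMultitensor
  let A := (M.E m).obj fun i => (M.E (n i)).obj (Z i)
  let B := (M.E m).obj fun i => T.obj ((M.E (n i)).obj (Z i))
  have h1 := s.inl_η fun i => (M.E (n i)).obj (Z i)
  have h2 := S.substLeft_natural fun i => T.η.app ((M.E (n i)).obj (Z i))
  have h3 := S.map_subst_substLeft n Z
  have h4 := s.isMultitensorMap.subst n Z
  have h5 : T.η.app A ≫ T.map (tmap M.E fun i => T.η.app ((M.E (n i)).obj (Z i))) ≫ s.subst n Z =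
      M.subst n Z ≫ T.η.app _ :=
    (comp_whisker (T.η.naturality _).symm _).trans h4.symm
  have h6 : tmap S.E (fun _ : Fin 1 => T.η.app A) ≫ tmap S.E (fun _ : Fin 1 =>
        T.map (tmap M.E fun i => T.η.app ((M.E (n i)).obj (Z i)))) ≫
        tmap S.E (fun _ : Fin 1 => s.subst n Z) =
      tmap S.E (fun _ : Fin 1 => M.subst n Z) ≫ tmap S.E (fun _ : Fin 1 => T.η.app _) :=
    (tmap_comp₂ S.E _ _ _).symm.trans ((congrArg (tmap S.E) (funext fun _ => h5)).trans
      (tmap_comp S.E _ _).symm)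
  have h7 := s.inl_natural (M.subst n Z)
  have h8 := s.inl_η (flat Z)
  refine (Category.id_comp _).symm.trans ?_
  refine (eq_whisker h1.symm _).trans ?_
  refine (Category.assoc _ _ _).trans (whisker_eq _ ((Category.assoc _ _ _).trans
    (whisker_eq _ (comp_whisker h2.symm _))) |>.trans ?_)
  refine (whisker_eq _ (whisker_eq _ (whisker_eq _ h3.symm))).trans ?_
  refine (whisker_eq _ (whisker_eq _ (Category.assoc _ _ _).symm)).trans ?_
  refine (whisker_eq _ (comp_whisker h6 _)).trans ?_
  refine (comp_whisker h7.symm _).trans ?_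
  exact (whisker_eq _ h8).trans (Category.comp_id _)

/-- The coherence maps of the monoidal monad recovered from a composite multitensor. -/
def tau {n : ℕ} (X : Fin n → V) :
    (M.E n).obj (fun i => T.obj (X i)) ⟶ T.obj ((M.E n).obj X) :=
  T.η.app ((M.E n).obj fun i => T.obj (X i)) ≫
    tmap s.toMultitensor.E (fun i => s.inl (X i)) ≫ s.toMultitensor.substRight X

/-- Here the definition of `τ` loses its initial `η`. By `inl_substLeft`, `μ` is itself an instance
of `σ'`, so `μ ∘ Tτ` becomes a nested substitution. Associativity exposes the `η` hidden in `τ`, and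
the middle unit law cancels it. -/
theorem map_inl_substRight {n : ℕ} (X : Fin n → V) :
    tmap s.toMultitensor.E (fun i => s.inl (X i)) ≫ s.toMultitensor.substRight X =
      T.map (s.tau X) ≫ T.μ.app _ := by
  let S := s.toMultitensor
  have h1 := s.inl_substLeft X
  have h2 := s.inl_natural (s.tau X)
  have h3 : tmap S.E (fun _ : Fin 1 => s.tau X) =
      tmap S.E (fun _ : Fin 1 => T.η.app ((M.E n).obj fun i => T.obj (X i))) ≫
        tmap S.E (fun _ : Fin 1 => tmap S.E fun i => s.inl (X i)) ≫
        tmap S.E (fun _ : Fin 1 => S.substRight X) := tmap_comp₂ S.E _ _ _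
  have h4 := S.map_substRight_substLeft X
  have h5 := S.substLeft_natural fun i => s.inl (X i)
  have h6 := s.inl_η fun i => T.obj (X i)
  refine Eq.symm ?_
  refine (whisker_eq _ h1.symm).trans ?_
  refine (comp_whisker h2 _).trans ?_
  refine (whisker_eq _ (eq_whisker h3 _)).trans ?_
  refine (whisker_eq _ ((Category.assoc _ _ _).trans (whisker_eq _ (Category.assoc _ _ _)))).trans ?_
  refine (whisker_eq _ (whisker_eq _ (whisker_eq _ h4))).trans ?_
  refine (whisker_eq _ (whisker_eq _ (comp_whisker h5 _))).trans ?_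
  refine (whisker_eq _ (Category.assoc _ _ _).symm).trans ?_
  refine (Category.assoc _ _ _).symm.trans ?_
  exact (eq_whisker h6 _).trans (Category.id_comp _)

/-- This splits `σ'` into a part that only collects `T`s and a part that only substitutes in `E`.
Rewriting `Tσ` by `map_η_subst` and reassociating with a middle level of length one leaves the
middle unit law in each variable. -/
theorem map_inl_substRight_map_subst {m : ℕ} (n : Fin m → ℕ) (Z : ∀ i, Fin (n i) → V) :
    tmap s.toMultitensor.E (fun i => s.inl ((M.E (n i)).obj (Z i))) ≫
      s.toMultitensor.substRight (fun i => (M.E (n i)).obj (Z i)) ≫ T.map (M.subst n Z) =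
    s.subst n Z := by
  let S := s.toMultitensor
  have h1 := s.map_η_subst n Z
  have h2 := S.substRight_natural fun i => T.η.app ((M.E (n i)).obj (Z i))
  have h3 := S.map_substLeft_subst n Z
  have h4 : tmap S.E (fun i => s.inl ((M.E (n i)).obj (Z i))) ≫
      tmap S.E (fun i => tmap S.E fun _ : Fin 1 => T.η.app ((M.E (n i)).obj (Z i))) ≫
        tmap S.E (fun i => S.substLeft (Z i)) = 𝟙 _ :=
    (tmap_comp₂ S.E _ _ _).symm.trans ((congrArg (tmap S.E) (funext fun i => s.inl_η (Z i))).trans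
      (tmap_id S.E _))
  refine (whisker_eq _ (whisker_eq _ h1.symm)).trans ?_
  refine (whisker_eq _ (comp_whisker h2.symm _)).trans ?_
  refine (whisker_eq _ (whisker_eq _ h3.symm)).trans ?_
  refine (whisker_eq _ (Category.assoc _ _ _).symm).trans ?_
  refine (Category.assoc _ _ _).symm.trans ?_
  exact (eq_whisker h4 _).trans (Category.id_comp _)

theorem tau_natural {n : ℕ} {X Y : Fin n → V} (f : ∀ i, X i ⟶ Y i) :
    tmap M.E (fun i => T.map (f i)) ≫ s.tau Y = s.tau X ≫ T.map (tmap M.E f) := by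
  let S := s.toMultitensor
  have h1 := S.substRight_natural f
  have h2 : tmap S.E (fun i => T.map (f i)) ≫ tmap S.E (fun i => s.inl (Y i)) =
      tmap S.E (fun i => s.inl (X i)) ≫ tmap S.E (fun i => tmap S.E fun _ : Fin 1 => f i) :=
    (tmap_comp S.E _ _).trans ((congrArg (tmap S.E) (funext fun i => s.inl_natural (f i))).trans
      (tmap_comp S.E _ _).symm)
  refine (comp_whisker (T.η.naturality _) _).trans ?_
  refine (whisker_eq _ (comp_whisker h2 _)).trans ?_
  refine (whisker_eq _ (whisker_eq _ h1)).trans ?_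
  exact (whisker_eq _ (Category.assoc _ _ _).symm).trans (Category.assoc _ _ _).symm

theorem tau_unit (X : V) : M.unit (T.obj X) ≫ s.tau (fun _ : Fin 1 => X) = T.map (M.unit X) := by
  let S := s.toMultitensor
  have h1 := S.isMultitensor.unit_natural (s.inl X)
  have h2 := S.unit_substLeft fun _ : Fin 1 => X
  refine (Category.assoc _ _ _).symm.trans ?_
  refine (comp_whisker h1.symm _).trans ?_
  exact (whisker_eq _ h2).trans (Category.comp_id _)

theorem tau_subst_eq {m : ℕ} (n : Fin m → ℕ) (Z : ∀ i, Fin (n i) → V) :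
    s.tau (fun i => (M.E (n i)).obj (Z i)) ≫ T.map (M.subst n Z) = T.η.app _ ≫ s.subst n Z :=
  (Category.assoc _ _ _).trans (whisker_eq _ ((Category.assoc _ _ _).trans
    (s.map_inl_substRight_map_subst n Z)))

/-- By `tau_subst_eq` the left side is `E_i τ`, then `η`, then `σ'`. Expanding the inner `τ`s,
associativity and naturality move `Tu` behind `σ'`. The two layers of `η` before `σ'` then merge,
because `ηE` is a multitensor map. -/
theorem tau_subst {m : ℕ} (n : Fin m → ℕ) (Z : ∀ i, Fin (n i) → V) :
    tmap M.E (fun i => s.tau (Z i)) ≫ s.tau (fun i => (M.E (n i)).obj (Z i)) ≫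
        T.map (M.subst n Z) =
      M.subst n (fun i j => T.obj (Z i j)) ≫ s.tau (flat Z) := by
  let S := s.toMultitensor
  have h1 := s.tau_subst_eq n Z
  have h2 := s.isMultitensorMap.subst n fun i j => T.obj (Z i j)
  have h3 := S.isMultitensor.subst_natural n _ _ fun i j => s.inl (Z i j)
  have h4 := S.map_substRight_subst n Z
  have h5 : tmap M.E (fun i => s.tau (Z i)) ≫ T.η.app _ =
      tmap M.E (fun i => T.η.app ((M.E (n i)).obj fun j => T.obj (Z i j))) ≫ T.η.app _ ≫
        tmap S.E (fun i => tmap S.E fun j => s.inl (Z i j)) ≫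
          tmap S.E (fun i => S.substRight (Z i)) := by
    refine (eq_whisker (tmap_comp M.E _ _).symm _).trans ((Category.assoc _ _ _).trans ?_)
    refine whisker_eq _ ((T.η.naturality _).trans (whisker_eq _ ?_))
    exact (tmap_comp S.E _ _).symm
  refine (whisker_eq _ h1).trans ?_
  refine (Category.assoc _ _ _).symm.trans ((eq_whisker h5 _).trans ?_)
  refine (Category.assoc _ _ _).trans (whisker_eq _ ((Category.assoc _ _ _).trans
    (whisker_eq _ ((Category.assoc _ _ _).trans (whisker_eq _ h4)))) |>.trans ?_)
  refine (whisker_eq _ (whisker_eq _ (comp_whisker h3 _))).trans ?_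
  refine (whisker_eq _ (Category.assoc _ _ _).symm).trans ?_
  refine (Category.assoc _ _ _).symm.trans ?_
  exact (eq_whisker h2.symm _).trans (Category.assoc _ _ _)

theorem tau_monad_unit {n : ℕ} (X : Fin n → V) :
    tmap M.E (fun i => T.η.app (X i)) ≫ s.tau X = T.η.app ((M.E n).obj X) := by
  let S := s.toMultitensor
  have h1 : tmap S.E (fun i => T.η.app (X i)) ≫ tmap S.E (fun i => s.inl (X i)) =
      tmap S.E (fun i => S.unit (X i)) :=
    (tmap_comp S.E _ _).trans (congrArg (tmap S.E) (funext fun i => s.η_inl (X i)))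
  have h2 := S.unit_substRight X
  refine (comp_whisker (T.η.naturality _) _).trans ?_
  refine (whisker_eq _ ((Category.assoc _ _ _).symm.trans (eq_whisker h1 _))).trans ?_
  exact (whisker_eq _ h2).trans (Category.comp_id _)

/-- With `map_inl_substRight` the right side contains `Tu` twice in every variable. Associativity
with two levels of length one groups these pairs, and `inl_inl` turns each of them into `μ` followed
by a single `Tu`. -/
theorem tau_monad_mul {n : ℕ} (X : Fin n → V) :
    tmap M.E (fun i => T.μ.app (X i)) ≫ s.tau X =
      s.tau (fun i => T.obj (X i)) ≫ T.map (s.tau X) ≫ T.μ.app ((M.E n).obj X) := by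
  let S := s.toMultitensor
  have h1 := s.map_inl_substRight X
  have h2 := S.substRight_natural fun i => s.inl (X i)
  have h3 := S.map_substRight_substRight X
  have h4 : tmap S.E (fun i => s.inl (T.obj (X i))) ≫
      tmap S.E (fun i => tmap S.E fun _ : Fin 1 => s.inl (X i)) ≫
        tmap S.E (fun i => S.substRight fun _ : Fin 1 => X i) =
      tmap S.E (fun i => T.μ.app (X i)) ≫ tmap S.E (fun i => s.inl (X i)) :=
    (tmap_comp₂ S.E _ _ _).symm.trans ((congrArg (tmap S.E) (funext fun i =>
      s.inl_inl (X i))).trans (tmap_comp S.E _ _).symm)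
  refine Eq.trans ?_ (whisker_eq _ h1)
  refine Eq.trans ?_ (Category.assoc _ _ _).symm
  refine Eq.trans ?_ (whisker_eq _ (Category.assoc _ _ _).symm)
  refine Eq.trans ?_ (whisker_eq _ (whisker_eq _ (comp_whisker h2 _)))
  refine Eq.trans ?_ (whisker_eq _ (whisker_eq _ (whisker_eq _ h3)))
  refine Eq.trans ?_ (whisker_eq _ (whisker_eq _ (Category.assoc _ _ _)))
  refine Eq.trans ?_ (whisker_eq _ (Category.assoc _ _ _))
  refine Eq.trans ?_ (whisker_eq _ (eq_whisker h4.symm _))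
  refine (comp_whisker (T.η.naturality _) _).trans (whisker_eq _ ?_)
  exact (Category.assoc _ _ _).symm

/-- The monoidal monad recovered from a composite multitensor. -/
def coherence : MonoidalCoherence M T where
  τ := s.tau
  natural := s.tau_natural
  unit := s.tau_unit
  subst := s.tau_subst
  monad_unit := s.tau_monad_unit
  monad_mul := s.tau_monad_mul

/-- Substituting `map_inl_substRight` into `map_inl_substRight_map_subst` gives `σ' = Tσ ∘ μ ∘ Tτ`.
-/
theorem composite_coherence : s.coherence.composite = s := by
  ext m n Z
  refine Eq.trans ?_ (s.map_inl_substRight_map_subst n Z)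
  refine Eq.trans ?_ (Category.assoc _ _ _)
  exact (Category.assoc _ _ _).symm.trans (eq_whisker (s.map_inl_substRight _).symm _)

end CompositeMultitensor

/-- Monoidal monads correspond to composite multitensors. -/
noncomputable def compositeEquiv (M : Multitensor V) (T : Monad V) :
    MonoidalCoherence M T ≃ CompositeMultitensor M T :=
  Equiv.ofBijective MonoidalCoherence.composite
    ⟨MonoidalCoherence.composite_injective, fun s => ⟨s.coherence, s.composite_coherence⟩⟩

end Composite

/-! ### Liftings to enriched categories as structures on the graphs `S X` -/

section LiftingData

variable {V : Type u} [Category.{v} V]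

/-- A morphism between the underlying graphs of `E`-categories is an `E`-functor. -/
def ECat.IsFunctor {M : Multitensor V} (X Y : ECat.{w} M) (f : X.graph ⟶ Y.graph) : Prop :=
  ∀ (a b : X.graph.obj) (x : ObjSeq X.graph.obj a b),
    X.comp x ≫ f.hom a b = seqTensorMap M.E f x ≫ Y.comp (x.map f.obj)

/-- The structure of an `E`-category on a graph. -/
structure ECatStruct (M : Multitensor V) (G : VGraph.{w} V) where
  /-- the composition maps -/
  comp : ∀ {a b : G.obj} (x : ObjSeq G.obj a b), seqTensor M.E G x ⟶ G.hom a b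
  unit_comp : ∀ a b : G.obj,
    M.unit (G.hom a b) ≫ singleCast M.E G a b ≫ comp (ObjSeq.single a b) = 𝟙 _
  subst_comp : ∀ {a b : G.obj} (x : ObjSeq G.obj a b)
    (y : ∀ i : Fin x.len, ObjSeq G.obj (x.vtx i.castSucc) (x.vtx i.succ)),
    tmap M.E (fun i => comp (y i)) ≫ comp x =
      M.subst (fun i => (y i).len) (fun i => homs G (y i)) ≫
        concatCast M.E G x y ≫ comp (x.concat y)

/-- The `E`-category given by a structure on a graph. -/
abbrev ECatStruct.toECat {M : Multitensor V} {G : VGraph.{w} V} (s : ECatStruct M G) : ECat.{w} M :=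
  ⟨G, s.comp, s.unit_comp, s.subst_comp⟩

theorem ECatStruct.toECat_injective {M : Multitensor V} {G : VGraph.{w} V} :
    Function.Injective (toECat : ECatStruct M G → ECat.{w} M) := by
  rintro ⟨k, _, _⟩ ⟨k', _, _⟩ h
  injection h with _ h
  obtain rfl : @k = @k' := h
  rfl

theorem ECatStruct.exists_toECat_eq {M : Multitensor V} {G : VGraph.{w} V} (X : ECat.{w} M)
    (h : X.graph = G) : ∃ s : ECatStruct M G, s.toECat = X := by
  subst h
  exact ⟨⟨X.comp, X.unit_comp, X.subst_comp⟩, rfl⟩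

/-- The data determining a lifting of a monad on graphs to enriched categories: enriched category
structures on the graphs `S X` for which the structure maps of `S` are enriched functors. -/
structure LiftingData (M : Multitensor V) (S : Monad (VGraph.{w} V)) where
  /-- the composition maps on `S X` -/
  str : ∀ X : ECat.{w} M, ECatStruct M (S.obj X.graph)
  map : ∀ {X Y : ECat.{w} M} (f : X ⟶ Y),
    ECat.IsFunctor (str X).toECat (str Y).toECat (S.map f.toHom)
  unit : ∀ X, ECat.IsFunctor X (str X).toECat (S.η.app X.graph)
  mul : ∀ X, ECat.IsFunctor (str (str X).toECat).toECat (str X).toECat (S.μ.app X.graph)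

namespace LiftingData

variable {M : Multitensor V} {S : Monad (VGraph.{w} V)}

theorem ext_str {L L' : LiftingData M S} (h : ∀ X, L.str X = L'.str X) : L = L' := by
  obtain ⟨s, _, _, _⟩ := L
  obtain ⟨s', _, _, _⟩ := L'
  obtain rfl : s = s' := funext h
  rfl

/-- The lifted functor. -/
def functor (L : LiftingData M S) : ECat.{w} M ⥤ ECat.{w} M where
  obj X := (L.str X).toECat
  map f := ⟨S.map f.toHom, L.map f _ _⟩
  map_id _ := ECat.Hom.ext (S.map_id _)
  map_comp _ _ := ECat.Hom.ext (S.map_comp _ _)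

/-- The lifted monad. -/
def monad (L : LiftingData M S) : Monad (ECat.{w} M) where
  toFunctor := L.functor
  η :=
    { app := fun X => ⟨S.η.app X.graph, L.unit X _ _⟩
      naturality := fun _ _ _ => ECat.Hom.ext (S.η.naturality _) }
  μ :=
    { app := fun X => ⟨S.μ.app X.graph, L.mul X _ _⟩
      naturality := fun _ _ _ => ECat.Hom.ext (S.μ.naturality _) }
  left_unit _ := ECat.Hom.ext (S.left_unit _)
  right_unit _ := ECat.Hom.ext (S.right_unit _)
  assoc _ := ECat.Hom.ext (S.assoc _)

/-- The lifting given by lifting data. -/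
def toLifting (L : LiftingData M S) : Lifting M S where
  monad := L.monad
  functor_eq := rfl
  unit_eq _ := Category.comp_id _
  mul_eq _ := (Category.comp_id _).trans ((Category.id_comp _).symm.trans
    ((Category.id_comp _).symm.trans (eq_whisker (S.map_id _).symm _)))

theorem toLifting_injective : Function.Injective (toLifting : LiftingData M S → Lifting M S) :=
  fun _ _ h => ext_str fun X =>
    ECatStruct.toECat_injective (congrArg (fun l : Lifting M S => l.monad.obj X) h)

/-- The forgetful functor is faithful and the lifting equations are strict. All morphism data of a
lifting are thus forced by `S`, and only the compositions on the graphs `S X` are free. -/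
theorem toLifting_surjective : Function.Surjective (toLifting : LiftingData M S → Lifting M S) := by
  rintro ⟨⟨⟨obj, map, map_id, map_comp⟩, η, μ, _, _, _⟩, hF, hη, hμ⟩
  have hs : ∀ X, ∃ s : ECatStruct M (S.obj X.graph), s.toECat = obj X := fun X =>
    ECatStruct.exists_toECat_eq _ (Functor.congr_obj hF X).symm
  choose str hstr using hs
  -- From here on the graph of the lifted object is `S X` by definition, so every `eqToHom` in the
  -- lifting equations is an identity.
  obtain rfl : (fun X => (str X).toECat) = obj := funext hstr
  have hmap : ∀ {X Y : ECat.{w} M} (f : X ⟶ Y), (map f).toHom = S.map f.toHom := fun f =>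
    ((Functor.congr_hom hF f).trans ((Category.id_comp _).trans (Category.comp_id _))).symm
  have hη' : ∀ X, (η.app X).toHom = S.η.app X.graph := fun X =>
    (hη X).symm.trans (Category.comp_id _)
  have hμ' : ∀ X, (μ.app X).toHom = S.μ.app X.graph := fun X =>
    ((Category.comp_id _).symm.trans ((hμ X).trans ((eq_whisker (S.map_id _) _).trans
      ((Category.id_comp _).trans (Category.id_comp _))))).symm
  have h1 : ∀ {X Y : ECat.{w} M} (f : X ⟶ Y),
      ECat.IsFunctor (str X).toECat (str Y).toECat (S.map f.toHom) := fun f _ _ x => by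
    rw [← hmap f]
    exact (map f).comm x
  have h2 : ∀ X, ECat.IsFunctor X (str X).toECat (S.η.app X.graph) := fun X _ _ x => by
    rw [← hη' X]
    exact (η.app X).comm x
  have h3 : ∀ X, ECat.IsFunctor (str (str X).toECat).toECat (str X).toECat (S.μ.app X.graph) :=
    fun X _ _ x => by
    rw [← hμ' X]
    exact (μ.app X).comm x
  refine ⟨⟨str, h1, h2, h3⟩, ?_⟩
  obtain rfl : @map = @fun X Y f => ⟨S.map f.toHom, h1 f _ _⟩ :=
    funext fun X => funext fun Y => funext fun f => ECat.Hom.ext (hmap f)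
  obtain rfl : η = (LiftingData.mk str h1 h2 h3).monad.η :=
    NatTrans.ext (funext fun X => ECat.Hom.ext (hη' X))
  obtain rfl : μ = (LiftingData.mk str h1 h2 h3).monad.μ :=
    NatTrans.ext (funext fun X => ECat.Hom.ext (hμ' X))
  rfl

end LiftingData

namespace MonoidalCoherence

variable {M : Multitensor V} {T : Monad V}

/-- The `E`-category structure on `G(T) X` for an `E`-category `X`. -/
def liftStruct (c : MonoidalCoherence M T) (X : ECat.{w} M) :
    ECatStruct M ((graphMonad T).obj X.graph) where
  comp x := c.τ (homs X.graph x) ≫ T.map (X.comp x)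
  unit_comp a b := by
    have h1 := c.unit (X.graph.hom a b)
    have h2 := tcast_family c.τ (n := 1) (X := fun _ => X.graph.hom a b)
      (Y := homs X.graph (ObjSeq.single a b)) rfl (fun i => (congrArg₂ X.graph.hom
        (ObjSeq.single_castSucc a b i) (ObjSeq.single_succ a b i)).symm)
      (fun i => congrArg T.obj (congrArg₂ X.graph.hom
        (ObjSeq.single_castSucc a b i) (ObjSeq.single_succ a b i)).symm)
    have h3 := congrArg T.map (X.unit_comp a b)
    rw [T.map_comp, T.map_comp, T.map_id] at h3
    refine (whisker_eq _ (comp_whisker h2 _)).trans ?_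
    refine (Category.assoc _ _ _).symm.trans ?_
    exact (eq_whisker h1 _).trans h3
  subst_comp x y := by
    have h1 : tmap M.E (fun i => c.τ (homs X.graph (y i)) ≫ T.map (X.comp (y i))) =
        tmap M.E (fun i => c.τ (homs X.graph (y i))) ≫
          tmap M.E (fun i => T.map (X.comp (y i))) := (tmap_comp M.E _ _).symm
    have h2 := c.natural fun i => X.comp (y i)
    have h3 := congrArg T.map (X.subst_comp x y)
    rw [T.map_comp, T.map_comp, T.map_comp] at h3
    have h4 := c.subst (fun i => (y i).len) (fun i => homs X.graph (y i))
    have h5 := tcast_family c.τ (X := flat fun i => homs X.graph (y i))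
      (Y := homs X.graph (x.concat y)) rfl (fun l => congrArg₂ X.graph.hom
        (ObjSeq.concat_castSucc x y l) (ObjSeq.concat_succ x y l))
      (fun l => congrArg T.obj (congrArg₂ X.graph.hom
        (ObjSeq.concat_castSucc x y l) (ObjSeq.concat_succ x y l)))
    refine (eq_whisker h1 _).trans ?_
    refine (Category.assoc _ _ _).trans ?_
    refine (whisker_eq _ (comp_whisker h2 _)).trans ?_
    refine (whisker_eq _ (whisker_eq _ h3)).trans ?_
    refine (whisker_eq _ (Category.assoc _ _ _).symm).trans ?_
    refine (comp_whisker h4 _).trans ?_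
    exact whisker_eq _ (comp_whisker h5.symm _)

/-- The lifting data of a monoidal monad. -/
def liftingData (c : MonoidalCoherence M T) : LiftingData.{w} M (graphMonad T) where
  str := c.liftStruct
  map {X Y} f a b x := by
    have h1 := congrArg T.map (f.comm x)
    rw [T.map_comp, T.map_comp] at h1
    have h2 := c.natural (X := homs X.graph x) (Y := homs Y.graph (x.map f.toHom.obj))
      fun _ => f.toHom.hom _ _
    refine (Category.assoc _ _ _).trans ?_
    refine (whisker_eq _ h1).trans ?_
    exact comp_whisker h2.symm _
  unit X a b x := by
    have h1 := c.monad_unit (homs X.graph x)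
    refine (T.η.naturality (X.comp x)).trans ?_
    exact (eq_whisker h1.symm _).trans (Category.assoc _ _ _)
  mul X a b x := by
    have h1 := c.monad_mul (homs X.graph x)
    have h2 := T.μ.naturality (X.comp x)
    refine (Category.assoc _ _ _).trans ?_
    refine (whisker_eq _ (eq_whisker (T.map_comp _ _) _)).trans ?_
    refine (whisker_eq _ ((Category.assoc _ _ _).trans (whisker_eq _ h2))).trans ?_
    refine (whisker_eq _ (Category.assoc _ _ _).symm).trans ?_
    refine (Category.assoc _ _ _).symm.trans ?_
    exact (eq_whisker h1.symm _).trans (Category.assoc _ _ _)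

end MonoidalCoherence

end LiftingData

/-! ### Beck's construction of a distributive law from a lifting -/

/-- A distributive law of `S` over `R` from actions of `R` on the objects `S R G` and `S S R G`. -/
def DistributiveLaw.ofActions {C : Type*} [Category C] (S R : Monad C)
    (β : ∀ G, R.obj (S.obj (R.obj G)) ⟶ S.obj (R.obj G))
    (γ : ∀ G, R.obj (S.obj (S.obj (R.obj G))) ⟶ S.obj (S.obj (R.obj G)))
    (unit : ∀ G, R.η.app _ ≫ β G = 𝟙 _) (mul : ∀ G, R.μ.app _ ≫ β G = R.map (β G) ≫ β G)
    (natural : ∀ {G H} (f : G ⟶ H), R.map (S.map (R.map f)) ≫ β H = β G ≫ S.map (R.map f))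
    (map_mul : ∀ G, R.map (S.map (R.μ.app G)) ≫ β G = β (R.obj G) ≫ S.map (R.μ.app G))
    (map_action : ∀ G, R.map (S.map (β G)) ≫ γ G = β (S.obj (R.obj G)) ≫ S.map (β G))
    (η_action : ∀ G, R.map (S.η.app (R.obj G)) ≫ β G = R.μ.app G ≫ S.η.app (R.obj G))
    (μ_action : ∀ G, R.map (S.μ.app (R.obj G)) ≫ β G = γ G ≫ S.μ.app (R.obj G)) :
    DistributiveLaw S R where
  -- Beck's formula: the free structure on `R G` is lifted to `S R G`, and its action is restricted
  -- along `S η : S G ⟶ S R G`.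
  app G := R.map (S.map (R.η.app G)) ≫ β G
  natural {G H} f := by
    have h : R.map (S.map f) ≫ R.map (S.map (R.η.app H)) =
        R.map (S.map (R.η.app G)) ≫ R.map (S.map (R.map f)) := by
      rw [← R.map_comp, ← S.map_comp, ← R.map_comp, ← S.map_comp]
      exact congrArg (fun k => R.map (S.map k)) (R.η.naturality f)
    rw [← Category.assoc, h, Category.assoc, Category.assoc, natural]
  unit_left G := by
    have h : R.η.app (S.obj G) ≫ R.map (S.map (R.η.app G)) = S.map (R.η.app G) ≫ R.η.app _ :=
      (R.η.naturality (S.map (R.η.app G))).symm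
    rw [← Category.assoc, h, Category.assoc, unit]
    exact Category.comp_id _
  unit_right G := by
    have h : R.map (S.η.app G) ≫ R.map (S.map (R.η.app G)) =
        R.map (R.η.app G) ≫ R.map (S.η.app _) := by
      rw [← R.map_comp, ← R.map_comp]
      exact congrArg R.map (S.η.naturality (R.η.app G)).symm
    rw [← Category.assoc, h, Category.assoc, η_action, ← Category.assoc, R.right_unit,
      Category.id_comp]
  mul_left G := by
    have h : R.μ.app (S.obj G) ≫ R.map (S.map (R.η.app G)) =
        R.map (R.map (S.map (R.η.app G))) ≫ R.μ.app _ :=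
      (R.μ.naturality (S.map (R.η.app G))).symm
    -- With `map_mul` this shows that the law at `R G` followed by `S μ` is the action `β G` itself.
    have h' : R.map (S.map (R.η.app (R.obj G))) ≫ R.map (S.map (R.μ.app G)) = 𝟙 _ := by
      rw [← R.map_comp, ← S.map_comp, R.left_unit, S.map_id, R.map_id]
    rw [← Category.assoc, h, Category.assoc, mul, Category.assoc, ← map_mul, ← Category.assoc
      (R.map (S.map (R.η.app (R.obj G)))), h', Category.id_comp, R.map_comp, Category.assoc]
  mul_right G := by
    have h : R.map (S.μ.app G) ≫ R.map (S.map (R.η.app G)) =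
        R.map (S.map (S.map (R.η.app G))) ≫ R.map (S.μ.app _) := by
      rw [← R.map_comp, ← R.map_comp]
      exact congrArg R.map (S.μ.naturality (R.η.app G)).symm
    have h1 : R.map (S.map (S.map (R.η.app G))) ≫ R.map (S.map (R.η.app (S.obj (R.obj G)))) =
        R.map (S.map (R.η.app (S.obj G))) ≫ R.map (S.map (R.map (S.map (R.η.app G)))) := by
      rw [← R.map_comp, ← R.map_comp, ← S.map_comp, ← S.map_comp]
      exact congrArg (fun k => R.map (S.map k)) (R.η.naturality (S.map (R.η.app G)))
    have h2 : R.map (S.map (R.η.app (S.obj (R.obj G)))) ≫ R.map (S.map (β G)) = 𝟙 _ := by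
      rw [← R.map_comp, ← S.map_comp, unit, S.map_id, R.map_id]
    -- The twice lifted action is determined by the once lifted one: `β G` is a morphism out of a
    -- free algebra, and the unit splits it.
    have h3 : R.map (S.map (R.η.app (S.obj (R.obj G)))) ≫ β (S.obj (R.obj G)) ≫ S.map (β G) =
        γ G := by
      rw [← map_action, ← Category.assoc, h2, Category.id_comp]
    rw [← Category.assoc, h, Category.assoc, μ_action, ← h3]
    simp only [Category.assoc, S.map_comp]
    rw [← Category.assoc, h1, Category.assoc, ← Category.assoc (R.map (S.map (R.map _))), natural,
      Category.assoc]

section GraphHom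

variable {V : Type u} [Category.{v} V]

theorem VGraph.hom_injective {X Y : VGraph.{w} V} {φ : X.obj → Y.obj}
    {f g : ∀ a b, X.hom a b ⟶ Y.hom (φ a) (φ b)}
    (h : (⟨φ, f⟩ : X ⟶ Y) = ⟨φ, g⟩) (a b : X.obj) : f a b = g a b := by
  injection h with _ h
  exact congrFun (congrFun h a) b

end GraphHom

section Beck

variable {V : Type u} [Category.{v} V] [HasCoproducts.{w} V]

namespace ECat

variable {M : Multitensor V}

/-- The action of `Γ E` on the underlying graph of an `E`-category. -/
noncomputable def action (X : ECat.{w} M) : gammaObj M.E X.graph ⟶ X.graph :=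
  ⟨id, fun _ _ => Sigma.desc fun x => X.comp x⟩

theorem gammaIncl_action (X : ECat.{w} M) {a b : X.graph.obj} (x : ObjSeq X.graph.obj a b) :
    gammaIncl M.E X.graph x ≫ X.action.hom a b = X.comp x :=
  Sigma.ι_desc _ _

theorem gammaUnit_action (X : ECat.{w} M) : gammaUnit M X.graph ≫ X.action = 𝟙 X.graph :=
  VGraph.hom_ext fun a b => by
    refine (Category.assoc _ _ _).trans ?_
    refine (whisker_eq _ ((Category.assoc _ _ _).trans
      (whisker_eq _ (X.gammaIncl_action _)))).trans ?_
    exact X.unit_comp a b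

/-- On a doubly nested sequence the multiplication of `Γ(E)` is `σ`, so the algebra law is
associativity of composition. Distributivity ensures that these sequences detect equality. -/
theorem gammaMul_action (hM : IsDistributive.{w} M.E) (X : ECat.{w} M) :
    gammaMul M hM X.graph ≫ X.action = gammaMap M.E X.action ≫ X.action :=
  VGraph.hom_ext fun a b => gamma_hom_ext_one (X := gammaObj M.E X.graph) (a := a) (b := b) fun x =>
    gamma_hom_ext_two (X := X.graph) hM x fun y => by
    have h1 := gammaMul_spec M hM X.graph x y
    have h2 := gammaIncl_map M.E X.action x
    have h3 : tmap M.E (fun i => gammaIncl M.E X.graph (y i)) ≫ seqTensorMap M.E X.action x =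
        tmap M.E (fun i => X.comp (y i)) :=
      (tmap_comp M.E _ _).trans (congrArg (tmap M.E) (funext fun i => X.gammaIncl_action (y i)))
    have h4 := X.gammaIncl_action x
    have h5 := X.gammaIncl_action (x.concat y)
    refine (whisker_eq _ (Category.assoc _ _ _).symm).trans ?_
    refine (Category.assoc _ _ _).symm.trans ((eq_whisker h1 _).trans ?_)
    refine (Category.assoc _ _ _).trans ?_
    refine (whisker_eq _ ((Category.assoc _ _ _).trans (whisker_eq _ h5))).trans ?_
    refine (X.subst_comp x y).symm.trans ?_
    refine Eq.trans ?_ (whisker_eq _ (comp_whisker h2 _)).symm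
    refine Eq.trans ?_ (whisker_eq _ (whisker_eq _ h4)).symm
    exact (eq_whisker h3.symm _).trans (Category.assoc _ _ _)

/-- This translation lets the conditions of a lifting, which concern `E`-functors, be used as
equations between actions. -/
theorem isFunctor_iff {X Y : ECat.{w} M} (f : X.graph ⟶ Y.graph) :
    IsFunctor X Y f ↔ X.action ≫ f = gammaMap M.E f ≫ Y.action := by
  have h : ∀ {a b : X.graph.obj} (x : ObjSeq X.graph.obj a b),
      (X.comp x ≫ f.hom a b = seqTensorMap M.E f x ≫ Y.comp (x.map f.obj)) ↔
      gammaIncl M.E X.graph x ≫ X.action.hom a b ≫ f.hom a b =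
        gammaIncl M.E X.graph x ≫ gammaMapHom M.E f a b ≫ Y.action.hom _ _ := fun {a b} x => by
    have h1 := comp_whisker (gammaIncl_map M.E f x) (Y.action.hom _ _)
    have h2 := whisker_eq (seqTensorMap M.E f x) (Y.gammaIncl_action (x.map f.obj))
    have h3 := (Category.assoc _ _ _).symm.trans
      (eq_whisker (X.gammaIncl_action x) (f.hom a b))
    constructor
    · exact fun h => h3.trans (h.trans (h1.trans h2).symm)
    · exact fun h => h3.symm.trans (h.trans (h1.trans h2))
  constructor
  · exact fun hf => VGraph.hom_ext fun a b => gamma_hom_ext_one fun x => (h x).1 (hf a b x)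
  · exact fun hf a b x => (h x).2 (whisker_eq _ (VGraph.hom_injective hf a b))

/-- The free `E`-category on a graph. -/
noncomputable def free (hM : IsDistributive.{w} M.E) (G : VGraph.{w} V) : ECat.{w} M where
  graph := gammaObj M.E G
  comp {a b} x := gammaIncl M.E (gammaObj M.E G) x ≫ gammaMulHom M hM G a b
  unit_comp a b := by
    refine Eq.trans ?_ (gamma_left_unit M hM G a b)
    exact ((Category.assoc _ _ _).trans (whisker_eq _ (Category.assoc _ _ _))).symm
  subst_comp {a b} x y := by
    have h1 := gamma_assoc M hM G a b
    have h2 := gammaIncl_map M.E (gammaMul M hM G) x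
    have h3 := gammaMul_spec M hM (gammaObj M.E G) x y
    have h4 := (tmap_comp M.E (fun i => gammaIncl M.E (gammaObj M.E G) (y i))
      fun i => gammaMulHom M hM G _ _)
    refine (eq_whisker h4.symm _).trans ((Category.assoc _ _ _).trans ?_)
    refine (whisker_eq _ (comp_whisker h2.symm _)).trans ?_
    refine (whisker_eq _ (whisker_eq _ h1)).trans ?_
    refine (whisker_eq _ (Category.assoc _ _ _).symm).trans ?_
    refine (Category.assoc _ _ _).symm.trans ((eq_whisker h3 _).trans ?_)
    exact (Category.assoc _ _ _).trans (whisker_eq _ (Category.assoc _ _ _))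

theorem free_action (hM : IsDistributive.{w} M.E) (G : VGraph.{w} V) :
    (free hM G).action = gammaMul M hM G :=
  VGraph.hom_ext fun _ _ => gamma_hom_ext_one (X := gammaObj M.E G) fun x =>
    (free hM G).gammaIncl_action x

/-- The underlying graph of an `E`-category as an algebra of the monad `Γ E`. -/
noncomputable def monadAction (hM : IsDistributive.{w} M.E) (X : ECat.{w} M) :
    (gammaMonad M hM).obj X.graph ⟶ X.graph :=
  X.action

theorem unit_monadAction (hM : IsDistributive.{w} M.E) (X : ECat.{w} M) :
    (gammaMonad M hM).η.app X.graph ≫ X.monadAction hM = 𝟙 _ :=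
  X.gammaUnit_action

theorem mul_monadAction (hM : IsDistributive.{w} M.E) (X : ECat.{w} M) :
    (gammaMonad M hM).μ.app X.graph ≫ X.monadAction hM =
      (gammaMonad M hM).map (X.monadAction hM) ≫ X.monadAction hM :=
  X.gammaMul_action hM

end ECat

namespace LiftingData

variable {M : Multitensor V} {S : Monad (VGraph.{w} V)} (hM : IsDistributive.{w} M.E)
  (L : LiftingData M S)

/-- The action of `Γ E` on `S X` for an `E`-category `X`. -/
noncomputable abbrev strAction (X : ECat.{w} M) :
    (gammaMonad M hM).obj (S.obj X.graph) ⟶ S.obj X.graph :=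
  (L.str X).toECat.monadAction hM

/-- A map of `Γ(E)`-algebras is an `E`-functor, and the lifted functor sends it to an `E`-functor,
hence to a map of algebras again. -/
theorem map_strAction {X Y : ECat.{w} M} (f : X.graph ⟶ Y.graph)
    (h : X.monadAction hM ≫ f = (gammaMonad M hM).map f ≫ Y.monadAction hM) :
    (gammaMonad M hM).map (S.map f) ≫ L.strAction hM Y = L.strAction hM X ≫ S.map f :=
  ((ECat.isFunctor_iff (X := (L.str X).toECat) (Y := (L.str Y).toECat) (S.map f)).1
    (L.map (X := X) (Y := Y) ⟨f, (ECat.isFunctor_iff f).2 h _ _⟩)).symm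

/-- The distributive law of a lifting. -/
noncomputable def law : DistributiveLaw S (gammaMonad M hM) :=
  DistributiveLaw.ofActions S (gammaMonad M hM)
    (fun G => L.strAction hM (ECat.free hM G))
    (fun G => L.strAction hM (L.str (ECat.free hM G)).toECat)
    (fun G => (L.str (ECat.free hM G)).toECat.unit_monadAction hM)
    (fun G => (L.str (ECat.free hM G)).toECat.mul_monadAction hM)
    -- In this argument and the next two the lifting is applied to three `E`-functors out of free
    -- `E`-categories: the one induced by `f`, the multiplication of `Γ(E)`, and the action on `S
    -- Γ(E) G`. They are algebra maps by naturality of the multiplication, its associativity, and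
    -- the algebra law.
    (fun {G H} f => L.map_strAction hM (X := ECat.free hM G) (Y := ECat.free hM H) (gammaMap M.E f)
      ((eq_whisker (ECat.free_action hM G) _).trans (((gammaMonad M hM).μ.naturality f).symm.trans
        (whisker_eq _ (ECat.free_action hM H).symm))))
    (fun G => L.map_strAction hM (X := ECat.free hM (gammaObj M.E G)) (Y := ECat.free hM G)
      (gammaMul M hM G) ((eq_whisker (ECat.free_action hM _) _).trans
        (((gammaMonad M hM).assoc G).symm.trans (whisker_eq _ (ECat.free_action hM G).symm))))
    (fun G => L.map_strAction hM (X := ECat.free hM (S.obj (gammaObj M.E G)))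
      (Y := (L.str (ECat.free hM G)).toECat) (L.strAction hM (ECat.free hM G))
      ((eq_whisker (ECat.free_action hM _) _).trans
        ((L.str (ECat.free hM G)).toECat.mul_monadAction hM)))
    (fun G => ((ECat.isFunctor_iff (X := ECat.free hM G) (Y := (L.str (ECat.free hM G)).toECat)
      (S.η.app (gammaObj M.E G))).1 (L.unit (ECat.free hM G))).symm.trans
        (eq_whisker (ECat.free_action hM G) _))
    (fun G => ((ECat.isFunctor_iff (X := (L.str (L.str (ECat.free hM G)).toECat).toECat)
      (Y := (L.str (ECat.free hM G)).toECat)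
      (S.μ.app (gammaObj M.E G))).1 (L.mul (ECat.free hM G))).symm)

/-- The action of `X` is an `E`-functor from the free `E`-category on the graph of `X`, so the
lifted action on `S X` is compared with the one on the lifted free category. The unit of `Γ(E)`
splits this map, which recovers the lifting from its law. -/
theorem law_action (X : ECat.{w} M) :
    (L.law hM).app X.graph ≫ S.map (X.monadAction hM) = L.strAction hM X := by
  have h := L.map_strAction hM (X := ECat.free hM X.graph) (Y := X) (X.monadAction hM)
    ((eq_whisker (ECat.free_action hM X.graph) _).trans (X.mul_monadAction hM))
  have h' : (gammaMonad M hM).map (S.map ((gammaMonad M hM).η.app X.graph)) ≫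
      (gammaMonad M hM).map (S.map (X.monadAction hM)) = 𝟙 _ := by
    rw [← (gammaMonad M hM).map_comp, ← S.map_comp, ECat.unit_monadAction]
    exact (congrArg (gammaMonad M hM).map (S.map_id _)).trans ((gammaMonad M hM).map_id _)
  refine (Category.assoc _ _ _).trans ?_
  refine (whisker_eq _ h.symm).trans ?_
  refine (Category.assoc _ _ _).symm.trans ?_
  exact (eq_whisker h' _).trans (Category.id_comp _)

end LiftingData

end Beck

/-! ### Path graphs -/

/-- The sequence of objects given by its vertices. -/
abbrev ObjSeq.ofVtx {O : Type w} {n : ℕ} (φ : Fin (n + 1) → O) :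
    ObjSeq O (φ 0) (φ (Fin.last n)) :=
  ⟨n, φ, rfl, rfl⟩

/-- Every step raises the vertex by one, so position `k` carries vertex `k`, and ending at `n` fixes
the length. Any other sequence therefore contains a step whose hom in the path graph is initial. -/
theorem ObjSeq.eq_ofVtx_of_steps {n : ℕ}
    (x : ObjSeq (ULift.{w} (Fin (n + 1))) ⟨0⟩ ⟨Fin.last n⟩)
    (h : ∀ i : Fin x.len, ∃ j : Fin n,
      (x.vtx i.castSucc).down = j.castSucc ∧ (x.vtx i.succ).down = j.succ) :
    x = ObjSeq.ofVtx (ULift.up : Fin (n + 1) → ULift.{w} (Fin (n + 1))) := by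
  have hv : ∀ k : Fin (x.len + 1), (x.vtx k).down.val = k.val := fun k => by
    induction k using Fin.induction with
    | zero => rw [x.head]; rfl
    | succ i ih =>
      obtain ⟨j, h1, h2⟩ := h i
      rw [h1] at ih
      rw [h2, Fin.val_succ, Fin.val_succ]
      exact congrArg (· + 1) ih
  have hl : x.len = n := by
    have := hv (Fin.last x.len)
    rw [x.last] at this
    exact this.symm
  exact ObjSeq.ext_of hl fun i => ULift.ext _ _ (Fin.ext (hv i.succ))

section Initial

variable {V : Type u} [Category.{v} V]

/-- An initial object is an empty coproduct, so this is distributivity in one variable for the index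
type `PEmpty`. -/
theorem IsDistributive.unique_of_initial {E : TensorFunctor V} (hE : IsDistributive.{w} E)
    {n : ℕ} (Q : Fin n → V) (i : Fin n) (hQ : Nonempty (IsInitial (Q i))) (A : V) :
    Nonempty (Unique ((E n).obj Q ⟶ A)) := by
  obtain ⟨hQ⟩ := hQ
  obtain ⟨h, -, hu⟩ := hE.existsUnique_one Q i (J := PEmpty) (fun j => j.elim) (fun j => j.elim)
    (fun j => j.elim) ⟨Cofan.IsColimit.mk _ (fun s => hQ.to s.pt) (fun _ j => j.elim)
      (fun _ _ _ => hQ.hom_ext _ _)⟩ (A := A) (fun j => j.elim)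
  exact ⟨⟨⟨h⟩, fun k => hu k fun j => j.elim⟩⟩

theorem VGraph.exists_eq_mk {X Y : VGraph.{w} V} (f : X ⟶ Y) {φ : X.obj → Y.obj} (h : f.obj = φ) :
    ∃ g : ∀ a b, X.hom a b ⟶ Y.hom (φ a) (φ b), f = ⟨φ, g⟩ := by
  subst h
  exact ⟨f.hom, rfl⟩

end Initial

section Path

variable {V : Type u} [Category.{v} V] [HasCoproducts.{w} V]

open Classical in
/-- The graph with vertices `0, …, n`, with `X i` as the hom from `i` to `i + 1` and with all other
homs initial. -/
noncomputable def pathGraph {n : ℕ} (X : Fin n → V) : VGraph.{w} V where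
  obj := ULift.{w} (Fin (n + 1))
  hom a b := if h : ∃ i : Fin n, a.down = i.castSucc ∧ b.down = i.succ then X h.choose
    else ∐ (fun e : PEmpty.{w + 1} => e.elim)

theorem pathGraph_step {n : ℕ} (i : Fin n) :
    ∃ j : Fin n, i.castSucc = j.castSucc ∧ i.succ = j.succ :=
  ⟨i, rfl, rfl⟩

theorem pathGraph_step_choose {n : ℕ} (i : Fin n) : (pathGraph_step i).choose = i :=
  (Fin.succ_injective _ (pathGraph_step i).choose_spec.2).symm

theorem pathGraph_hom {n : ℕ} (X : Fin n → V) (i : Fin n) :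
    (pathGraph.{w} X).hom ⟨i.castSucc⟩ ⟨i.succ⟩ = X i :=
  (dif_pos (pathGraph_step i)).trans (congrArg X (pathGraph_step_choose i))

theorem pathGraph_isInitial {n : ℕ} (X : Fin n → V) (a b : (pathGraph.{w} X).obj)
    (h : ¬ ∃ i : Fin n, a.down = i.castSucc ∧ b.down = i.succ) :
    Nonempty (IsInitial ((pathGraph.{w} X).hom a b)) := by
  have e : (pathGraph.{w} X).hom a b = ∐ (fun e : PEmpty.{w + 1} => e.elim) := dif_neg h
  rw [e]
  exact ⟨IsInitial.ofUniqueHom (fun A => Sigma.desc fun e => e.elim)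
    fun A m => Sigma.hom_ext _ _ fun e => e.elim⟩

/-- Homs other than the consecutive ones are initial and impose no condition, so a graph map out of
the path is freely given by maps out of the `X i`. -/
theorem pathGraph_desc {n : ℕ} (X : Fin n → V) (H : VGraph.{w} V) (φ : Fin (n + 1) → H.obj)
    (g : ∀ i : Fin n, X i ⟶ H.hom (φ i.castSucc) (φ i.succ)) :
    ∃ f : ∀ a b, (pathGraph.{w} X).hom a b ⟶ H.hom (φ a.down) (φ b.down),
      ∀ i : Fin n, f ⟨i.castSucc⟩ ⟨i.succ⟩ = eqToHom (pathGraph_hom X i) ≫ g i := by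
  -- Quantifying over the equations `ha` and `hb` gives a condition on each hom separately, so that
  -- `f` can be chosen hom by hom.
  have h : ∀ a b, ∃ f : (pathGraph.{w} X).hom a b ⟶ H.hom (φ a.down) (φ b.down),
      ∀ (i : Fin n) (ha : a = ⟨i.castSucc⟩) (hb : b = ⟨i.succ⟩),
        f = eqToHom ((congrArg₂ (pathGraph.{w} X).hom ha hb).trans (pathGraph_hom X i)) ≫ g i ≫
          eqToHom (congrArg₂ (fun c d => H.hom (φ (ULift.down c)) (φ (ULift.down d))) ha hb).symm := by
    intro a b
    by_cases hab : ∃ i : Fin n, a.down = i.castSucc ∧ b.down = i.succ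
    · obtain ⟨i, hi, hi'⟩ := hab
      obtain ⟨a⟩ := a
      obtain ⟨b⟩ := b
      dsimp only at hi hi'
      subst hi hi'
      refine ⟨eqToHom (pathGraph_hom X i) ≫ g i, fun j hj hj' => ?_⟩
      obtain rfl : i = j := Fin.succ_injective _ (congrArg ULift.down hj')
      exact whisker_eq _ (Category.comp_id _).symm
    · refine ⟨(pathGraph_isInitial X a b hab).some.to _, fun i ha hb => ?_⟩
      subst ha hb
      exact absurd (pathGraph_step i) hab
  choose f hf using h
  exact ⟨f, fun i => (hf _ _ i rfl rfl).trans (whisker_eq _ (Category.comp_id _))⟩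

/-- A sequence from `0` to `n` other than the full path has an initial hom as one of its entries, so
its summand is initial and does not contribute to the coproduct. -/
theorem pathGraph_isIso {E : TensorFunctor V} (hE : IsDistributive.{w} E) {n : ℕ} (X : Fin n → V) :
    IsIso (gammaIncl E (pathGraph.{w} X)
      (ObjSeq.ofVtx (ULift.up : Fin (n + 1) → (pathGraph.{w} X).obj))) := by
  have h : ∀ x : ObjSeq (pathGraph.{w} X).obj ⟨0⟩ ⟨Fin.last n⟩,
      ∃ f : seqTensor E (pathGraph.{w} X) x ⟶ seqTensor E (pathGraph.{w} X)
          (ObjSeq.ofVtx (ULift.up : Fin (n + 1) → (pathGraph.{w} X).obj)),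
        f ≫ gammaIncl E (pathGraph.{w} X) _ = gammaIncl E (pathGraph.{w} X) x ∧
        ∀ h : x = ObjSeq.ofVtx (ULift.up : Fin (n + 1) → (pathGraph.{w} X).obj),
          f = eqToHom (congrArg (seqTensor E (pathGraph.{w} X)) h) := by
    intro x
    by_cases hx : x = ObjSeq.ofVtx (ULift.up : Fin (n + 1) → (pathGraph.{w} X).obj)
    · subst hx
      exact ⟨𝟙 _, Category.id_comp _, fun _ => rfl⟩
    · have hx' : ¬ ∀ i : Fin x.len, ∃ j : Fin n,
          (x.vtx i.castSucc).down = j.castSucc ∧ (x.vtx i.succ).down = j.succ := fun h =>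
        hx (ObjSeq.eq_ofVtx_of_steps x h)
      obtain ⟨i, hi⟩ := not_forall.1 hx'
      have hu := hE.unique_of_initial (homs (pathGraph.{w} X) x) i
        (pathGraph_isInitial X _ _ hi)
      exact ⟨(hu _).some.default, ((hu _).some.uniq _).trans ((hu _).some.uniq _).symm,
        fun h => absurd h hx⟩
  choose r hr hr' using h
  -- The components `r` of the inverse are the identity on the full path and the unique map out of
  -- an initial object elsewhere.
  refine ⟨Sigma.desc r, (Sigma.ι_desc _ _).trans (hr' _ rfl), gamma_hom_ext_one fun x => ?_⟩
  refine (Category.assoc _ _ _).symm.trans ?_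
  refine (eq_whisker (Sigma.ι_desc _ _) _).trans ?_
  exact (hr x).trans (Category.comp_id _).symm

/-- Every sequence of objects is the sequence of homs along a path in a graph in which the path is
the only contribution to `Γ E`, and along which graph morphisms can be defined freely. -/
theorem exists_path {E : TensorFunctor V} (hE : IsDistributive.{w} E) {n : ℕ} (X : Fin n → V) :
    ∃ (G : VGraph.{w} V) (p : Fin (n + 1) → G.obj),
      (fun i : Fin n => G.hom (p i.castSucc) (p i.succ)) = X ∧
      IsIso (gammaIncl E G (ObjSeq.ofVtx p)) ∧
      ∀ (H : VGraph.{w} V) (φ : Fin (n + 1) → H.obj)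
        (g : ∀ i : Fin n, G.hom (p i.castSucc) (p i.succ) ⟶ H.hom (φ i.castSucc) (φ i.succ)),
        ∃ f : G ⟶ H, (fun k => f.obj (p k)) = φ ∧
          ∀ i : Fin n, f.hom (p i.castSucc) (p i.succ) ≍ g i := by
  refine ⟨pathGraph X, ULift.up, funext (pathGraph_hom X), pathGraph_isIso hE X, fun H φ g => ?_⟩
  obtain ⟨f, hf⟩ := pathGraph_desc X H φ fun i => eqToHom (pathGraph_hom X i).symm ≫ g i
  refine ⟨⟨fun a => φ a.down, f⟩, rfl, fun i => heq_of_eq ?_⟩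
  refine (hf i).trans ?_
  rw [← Category.assoc, eqToHom_trans]
  exact Category.id_comp _

end Path

/-! ### Distributive laws as families of maps on homs -/

section Law

variable {V : Type u} [Category.{v} V] [HasCoproducts.{w} V] {M : Multitensor V} {T : Monad V}

/-- A family of maps `Γ(E) G(T) X ⟶ G(T) Γ(E) X` that are identities on objects. -/
abbrev GammaFamily (M : Multitensor V) (T : Monad V) :=
  ∀ (G : VGraph.{w} V) (a b : G.obj),
    (gammaObj M.E ((graphMonad T).obj G)).hom a b ⟶ T.obj ((gammaObj M.E G).hom a b)

/-- The map `t` is `l` on the path graph of `X`, conjugated by the invertible inclusion of its only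
relevant summand. The stated property is naturality of `l` along the graph map that sends the path
to the vertices `φ` by means of `g`. -/
theorem exists_tau (hM : IsDistributive.{w} M.E) (l : GammaFamily.{w} M T)
    (hl : ∀ {G H : VGraph.{w} V} (f : G ⟶ H) (a b : G.obj),
      gammaMapHom M.E ((graphMonad T).map f) a b ≫ l H (f.obj a) (f.obj b) =
        l G a b ≫ T.map (gammaMapHom M.E f a b)) {n : ℕ} (X : Fin n → V) :
    ∃ t : (M.E n).obj (fun i => T.obj (X i)) ⟶ T.obj ((M.E n).obj X),
      ∀ (H : VGraph.{w} V) (φ : Fin (n + 1) → H.obj)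
        (g : ∀ i : Fin n, X i ⟶ H.hom (φ i.castSucc) (φ i.succ)),
        tmap M.E (fun i => T.map (g i)) ≫
            gammaIncl M.E ((graphMonad T).obj H) (ObjSeq.ofVtx φ) ≫ l H _ _ =
          t ≫ T.map (tmap M.E g ≫ gammaIncl M.E H (ObjSeq.ofVtx φ)) := by
  obtain ⟨G, p, rfl, hp, hG⟩ := exists_path hM X
  refine ⟨gammaIncl M.E ((graphMonad T).obj G) (ObjSeq.ofVtx p) ≫ l G _ _ ≫
    T.map (inv (gammaIncl M.E G (ObjSeq.ofVtx p))), fun H φ g => ?_⟩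
  -- Once `φ` is replaced by the vertices of `f`, the heterogeneous equalities in `hf` become
  -- ordinary ones.
  obtain ⟨f, rfl, hf⟩ := hG H φ g
  obtain rfl : (fun i => f.hom (p i.castSucc) (p i.succ)) = g := funext fun i => eq_of_heq (hf i)
  have h1 := gammaIncl_map M.E f (ObjSeq.ofVtx p)
  have h2 := gammaIncl_map M.E ((graphMonad T).map f) (ObjSeq.ofVtx p)
  have h3 := hl f (p 0) (p (Fin.last n))
  have h4 : T.map (inv (gammaIncl M.E G (ObjSeq.ofVtx p))) ≫
      T.map (gammaIncl M.E G (ObjSeq.ofVtx p) ≫ gammaMapHom M.E f _ _) =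
      T.map (gammaMapHom M.E f _ _) := by
    rw [← T.map_comp, IsIso.inv_hom_id_assoc]
  refine (comp_whisker h2.symm _).trans ?_
  refine (whisker_eq _ h3).trans ?_
  refine Eq.trans ?_ (whisker_eq _ (congrArg T.map h1))
  refine Eq.trans ?_ (Category.assoc _ _ _).symm
  refine whisker_eq _ ?_
  refine Eq.trans ?_ (Category.assoc _ _ _).symm
  exact whisker_eq _ h4.symm

variable (M T) in
/-- The conditions on a family of maps `Γ(E) G(T) X ⟶ G(T) Γ(E) X` of being a distributive law. -/
structure IsGammaLaw (hM : IsDistributive.{w} M.E) (l : GammaFamily.{w} M T) : Prop where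
  natural : ∀ {G H : VGraph.{w} V} (f : G ⟶ H) (a b : G.obj),
    gammaMapHom M.E ((graphMonad T).map f) a b ≫ l H (f.obj a) (f.obj b) =
      l G a b ≫ T.map (gammaMapHom M.E f a b)
  unit_left : ∀ (G : VGraph.{w} V) (a b : G.obj),
    gammaUnitHom M ((graphMonad T).obj G) a b ≫ l G a b = T.map (gammaUnitHom M G a b)
  unit_right : ∀ (G : VGraph.{w} V) (a b : G.obj),
    gammaMapHom M.E ((graphMonad T).η.app G) a b ≫ l G a b = T.η.app _
  mul_left : ∀ (G : VGraph.{w} V) (a b : G.obj),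
    gammaMulHom M hM ((graphMonad T).obj G) a b ≫ l G a b =
      gammaMapHom M.E (X := gammaObj M.E ((graphMonad T).obj G))
        (Y := (graphMonad T).obj (gammaObj M.E G)) ⟨id, l G⟩ a b ≫
        l (gammaObj M.E G) a b ≫ T.map (gammaMulHom M hM G a b)
  mul_right : ∀ (G : VGraph.{w} V) (a b : G.obj),
    gammaMapHom M.E ((graphMonad T).μ.app G) a b ≫ l G a b =
      l ((graphMonad T).obj G) a b ≫ T.map (l G a b) ≫ T.μ.app _

/-- As the components are identities on objects, each equation between graph maps can be read hom by
hom, without transport along equalities of end points. -/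
theorem exists_isGammaLaw (hM : IsDistributive.{w} M.E) (d : IdOnObjDistributiveLaw.{w} M T hM) :
    ∃ l : GammaFamily.{w} M T, IsGammaLaw M T hM l ∧ ∀ G, d.1.app G = ⟨id, l G⟩ := by
  have h : ∀ G, ∃ g : ∀ a b, (gammaObj M.E ((graphMonad T).obj G)).hom a b ⟶
      T.obj ((gammaObj M.E G).hom a b), d.1.app G = ⟨id, g⟩ := fun G =>
    VGraph.exists_eq_mk (X := gammaObj M.E ((graphMonad T).obj G))
      (Y := (graphMonad T).obj (gammaObj M.E G)) (d.1.app G) (d.2 G)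
  choose l hl using h
  refine ⟨l, ⟨fun {G H} f a b => ?_, fun G a b => ?_, fun G a b => ?_, fun G a b => ?_,
    fun G a b => ?_⟩, hl⟩
  · have h := d.1.natural f
    rw [hl, hl] at h
    exact VGraph.hom_injective (X := gammaObj M.E ((graphMonad T).obj G))
      (Y := (graphMonad T).obj (gammaObj M.E H)) h a b
  · have h := d.1.unit_left G
    rw [hl] at h
    exact VGraph.hom_injective (X := (graphMonad T).obj G)
      (Y := (graphMonad T).obj (gammaObj M.E G)) h a b
  · have h := d.1.unit_right G
    rw [hl] at h
    exact VGraph.hom_injective (X := gammaObj M.E G)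
      (Y := (graphMonad T).obj (gammaObj M.E G)) h a b
  · have h := d.1.mul_left G
    rw [hl, hl] at h
    exact VGraph.hom_injective (X := gammaObj M.E (gammaObj M.E ((graphMonad T).obj G)))
      (Y := (graphMonad T).obj (gammaObj M.E G)) h a b
  · have h := d.1.mul_right G
    rw [hl, hl] at h
    exact VGraph.hom_injective (X := gammaObj M.E ((graphMonad T).obj ((graphMonad T).obj G)))
      (Y := (graphMonad T).obj (gammaObj M.E G)) h a b

end Law

/-! ### Cutting a sequence into blocks -/

namespace ObjSeq

variable {O : Type w}

/-- The sequence of end points of consecutive blocks of prescribed lengths of a sequence. -/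
def blocks {m : ℕ} (n : Fin m → ℕ) (p : Fin ((∑ i, n i) + 1) → O) :
    ObjSeq O (p 0) (p (Fin.last _)) where
  len := m
  vtx k := p ⟨_, psum_lt n k⟩
  head := rfl
  last := rfl

theorem psum_add_lt {m : ℕ} (n : Fin m → ℕ) (i : Fin m) (j : Fin (n i + 1)) :
    ∑ t : Fin i.1, n (Fin.castLE i.2.le t) + j.1 < (∑ i, n i) + 1 := by
  have h := psum_lt n i.succ
  have hs : ∑ t : Fin (i.1 + 1), n (Fin.castLE (Nat.le_of_lt_succ i.succ.2) t)
      = (∑ t : Fin i.1, n (Fin.castLE i.2.le t)) + n i := by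
    rw [Fin.sum_univ_castSucc]
    rfl
  have hj := j.2
  have h' : ∑ t : Fin (i.1 + 1), n (Fin.castLE (Nat.le_of_lt_succ i.succ.2) t) <
    (∑ i, n i) + 1 := h
  omega

/-- The consecutive blocks of prescribed lengths of a sequence. -/
def block {m : ℕ} (n : Fin m → ℕ) (p : Fin ((∑ i, n i) + 1) → O) (i : Fin m) :
    ObjSeq O ((blocks n p).vtx (Fin.castSucc i)) ((blocks n p).vtx (Fin.succ i)) where
  len := n i
  vtx j := p ⟨_, psum_add_lt n i j⟩
  head := rfl
  last := by
    refine congrArg p (Fin.ext ?_)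
    have hs : ∑ t : Fin (i.1 + 1), n (Fin.castLE (Nat.le_of_lt_succ i.succ.2) t)
        = (∑ t : Fin i.1, n (Fin.castLE i.2.le t)) + n i := by
      rw [Fin.sum_univ_castSucc]
      rfl
    exact hs.symm

theorem block_castSucc {m : ℕ} (n : Fin m → ℕ) (p : Fin ((∑ i, n i) + 1) → O) (i : Fin m)
    (j : Fin (n i)) : (block n p i).vtx j.castSucc =
      p (finSigmaFinEquiv (⟨i, j⟩ : (i : Fin m) × Fin (n i))).castSucc :=
  congrArg p (Fin.ext (finSigmaFinEquiv_apply (⟨i, j⟩ : (i : Fin m) × Fin (n i))).symm)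

theorem block_succ {m : ℕ} (n : Fin m → ℕ) (p : Fin ((∑ i, n i) + 1) → O) (i : Fin m)
    (j : Fin (n i)) : (block n p i).vtx j.succ =
      p (finSigmaFinEquiv (⟨i, j⟩ : (i : Fin m) × Fin (n i))).succ :=
  congrArg p (Fin.ext (congrArg (· + 1)
    (finSigmaFinEquiv_apply (⟨i, j⟩ : (i : Fin m) × Fin (n i))).symm))

/-- Cutting is a section of concatenation. A path through `flat Z` thereby becomes a doubly nested
sequence, on which the multiplication of `Γ(E)` is given by `σ` at `Z`. -/
theorem blocks_concat_block {m : ℕ} (n : Fin m → ℕ) (p : Fin ((∑ i, n i) + 1) → O) :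
    (blocks n p).concat (block n p) = ofVtx p :=
  ext_of rfl fun l => by
    obtain ⟨⟨i, j⟩, rfl⟩ := (finSigmaFinEquiv (n := n)).surjective l
    exact ((blocks n p).concatVtx_succ (block n p) i j).trans (block_succ n p i j)

end ObjSeq

section Cast

variable {V : Type u} [Category.{v} V]

theorem isIso_tcast (E : TensorFunctor V) {n n' : ℕ} (h : n = n') {X : Fin n → V} {Y : Fin n' → V}
    (hX : ∀ i, X i = Y (Fin.cast h i)) : IsIso (tcast E h hX) := by
  unfold tcast
  infer_instance

end Cast

/-! ### From distributive laws to monoidal coherences -/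

section Law

variable {V : Type u} [Category.{v} V] [HasCoproducts.{w} V] {M : Multitensor V} {T : Monad V}

theorem isIso_gammaIncl_of_eq {E : TensorFunctor V} {G : VGraph.{w} V} {a b : G.obj}
    {x y : ObjSeq G.obj a b} (h : x = y) (hy : IsIso (gammaIncl E G y)) :
    IsIso (gammaIncl E G x) := by
  subst h
  exact hy

namespace IsGammaLaw

variable {hM : IsDistributive.{w} M.E} {l : GammaFamily.{w} M T}

theorem exists_family (hl : IsGammaLaw M T hM l) : ∃ τ : ∀ {n : ℕ} (X : Fin n → V),
      (M.E n).obj (fun i => T.obj (X i)) ⟶ T.obj ((M.E n).obj X),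
    (∀ {n : ℕ} {X Y : Fin n → V} (f : ∀ i, X i ⟶ Y i),
      tmap M.E (fun i => T.map (f i)) ≫ τ Y = τ X ≫ T.map (tmap M.E f)) ∧
    ∀ (G : VGraph.{w} V) {a b : G.obj} (x : ObjSeq G.obj a b),
      gammaIncl M.E ((graphMonad T).obj G) x ≫ l G a b =
        τ (homs G x) ≫ T.map (gammaIncl M.E G x) := by
  have h := fun (n : ℕ) (X : Fin n → V) => exists_tau hM l hl.natural X
  choose τ hτ using h
  have h1 : ∀ (G : VGraph.{w} V) {a b : G.obj} (x : ObjSeq G.obj a b),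
      gammaIncl M.E ((graphMonad T).obj G) x ≫ l G a b =
        τ _ (homs G x) ≫ T.map (gammaIncl M.E G x) := by
    rintro G a b ⟨n, φ, rfl, rfl⟩
    -- Taking identities for the maps `g` shows that the maps `τ`, chosen on path graphs, describe
    -- `l` on every summand of every graph.
    have h := hτ n _ G φ fun _ => 𝟙 _
    have e : tmap M.E (fun i : Fin n => T.map (𝟙 (G.hom (φ i.castSucc) (φ i.succ)))) = 𝟙 _ :=
      (congrArg (tmap M.E) (funext fun i => T.map_id _)).trans (tmap_id M.E _)
    refine (Category.id_comp _).symm.trans ((eq_whisker e.symm _).trans (h.trans ?_))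
    exact whisker_eq _ (congrArg T.map ((eq_whisker (tmap_id M.E _) _).trans (Category.id_comp _)))
  refine ⟨fun {n} X => τ n X, fun {n X Y} f => ?_, h1⟩
  -- Naturality of `τ` is tested in the path graph of the target sequence, where the inclusion can
  -- be cancelled.
  obtain ⟨H, q, rfl, hq, -⟩ := exists_path hM Y
  have h := hτ n X H q f
  rw [T.map_comp] at h
  refine (cancel_mono (T.map (gammaIncl M.E H (ObjSeq.ofVtx q)))).1 ?_
  refine (Category.assoc _ _ _).trans ((whisker_eq _ (h1 H (ObjSeq.ofVtx q)).symm).trans ?_)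
  exact h.trans (Category.assoc _ _ _).symm

/-- Each axiom for `τ` is the matching axiom for `l`, evaluated on a suitable path graph and
restricted to the summand of the path. There `T` of the inclusion is invertible, so it can be
cancelled. -/
theorem exists_coherence (hl : IsGammaLaw M T hM l) : ∃ c : MonoidalCoherence M T,
    ∀ (G : VGraph.{w} V) {a b : G.obj} (x : ObjSeq G.obj a b),
      gammaIncl M.E ((graphMonad T).obj G) x ≫ l G a b =
        c.τ (homs G x) ≫ T.map (gammaIncl M.E G x) := by
  obtain ⟨τ, natural, hτ⟩ := hl.exists_family
  refine ⟨⟨τ, natural, fun X => ?_, fun {m} n Z => ?_, fun {n} X => ?_, fun {n} X => ?_⟩, hτ⟩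
  · obtain ⟨G, p, hX, hp, -⟩ := exists_path hM fun _ : Fin 1 => X
    obtain rfl : G.hom (p 0) (p (Fin.last 1)) = X := congrFun hX 0
    have e : ObjSeq.single (p 0) (p (Fin.last 1)) = ObjSeq.ofVtx p :=
      ObjSeq.ext_of rfl fun i : Fin 1 => by
        rw [Subsingleton.elim i 0]
        rfl
    have hi := isIso_gammaIncl_of_eq (E := M.E) (G := G) e hp
    have hc : IsIso (singleCast M.E G (p 0) (p (Fin.last 1))) := isIso_tcast _ _ _
    have h1 := hl.unit_left G (p 0) (p (Fin.last 1))
    have h2 := hτ G (ObjSeq.single (p 0) (p (Fin.last 1)))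
    have h3 := tcast_family (M := M) τ (n := 1) (X := fun _ => G.hom (p 0) (p (Fin.last 1)))
      (Y := homs G (ObjSeq.single (p 0) (p (Fin.last 1)))) rfl (fun i => (congrArg₂ G.hom
        (ObjSeq.single_castSucc _ _ i) (ObjSeq.single_succ _ _ i)).symm)
      (fun i => congrArg T.obj (congrArg₂ G.hom
        (ObjSeq.single_castSucc _ _ i) (ObjSeq.single_succ _ _ i)).symm)
    refine (cancel_mono (T.map (singleCast M.E G (p 0) (p (Fin.last 1)) ≫
      gammaIncl M.E G (ObjSeq.single (p 0) (p (Fin.last 1)))))).1 ?_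
    refine Eq.trans ?_ (h1.trans (T.map_comp _ _))
    refine Eq.trans ?_ (Category.assoc _ _ _).symm
    refine (Category.assoc _ _ _).trans (whisker_eq _ ?_)
    refine (whisker_eq _ (T.map_comp _ _)).trans ?_
    refine Eq.trans ?_ (Category.assoc _ _ _).symm
    refine Eq.trans ?_ (whisker_eq _ h2).symm
    exact comp_whisker h3.symm _
  · obtain ⟨G, p, hZ, hp, -⟩ := exists_path hM (flat Z)
    -- The path is built on the concatenated sequence, and `Z` is then identified with the homs
    -- along its blocks.
    obtain rfl : (fun i => homs G (ObjSeq.block n p i)) = Z := funext fun i => funext fun j =>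
      (congrArg₂ G.hom (ObjSeq.block_castSucc n p i j) (ObjSeq.block_succ n p i j)).trans
        ((congrFun hZ _).trans (flat_apply Z ⟨i, j⟩))
    let x := ObjSeq.blocks n p
    let y := ObjSeq.block n p
    have hi := isIso_gammaIncl_of_eq (E := M.E) (G := G) (ObjSeq.blocks_concat_block n p) hp
    have hc : IsIso (concatCast M.E G x y) := isIso_tcast _ _ _
    have h1 := hl.mul_left G (p 0) (p (Fin.last _))
    have h2 := gammaMul_spec M hM ((graphMonad T).obj G) x y
    have h3 := hτ G (x.concat y)
    have h4 := tcast_family (M := M) τ (X := flat fun i => homs G (y i))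
      (Y := homs G (x.concat y)) rfl (fun l => congrArg₂ G.hom
        (ObjSeq.concat_castSucc x y l) (ObjSeq.concat_succ x y l))
      (fun l => congrArg T.obj (congrArg₂ G.hom
        (ObjSeq.concat_castSucc x y l) (ObjSeq.concat_succ x y l)))
    have h5 := gammaIncl_map M.E (X := gammaObj M.E ((graphMonad T).obj G))
      (Y := (graphMonad T).obj (gammaObj M.E G)) ⟨id, l G⟩ x
    have h6 : tmap M.E (fun i => gammaIncl M.E ((graphMonad T).obj G) (y i)) ≫
        seqTensorMap M.E (X := gammaObj M.E ((graphMonad T).obj G))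
          (Y := (graphMonad T).obj (gammaObj M.E G)) ⟨id, l G⟩ x =
        tmap M.E (fun i => τ (homs G (y i))) ≫ tmap M.E (fun i => T.map (gammaIncl M.E G (y i))) :=
      (tmap_comp M.E _ _).trans ((congrArg (tmap M.E) (funext fun i => hτ G (y i))).trans
        (tmap_comp M.E _ _).symm)
    have h7 := hτ (gammaObj M.E G) x
    have h8 := natural fun i => gammaIncl M.E G (y i)
    have h9 := congrArg T.map (gammaMul_spec M hM G x y)
    rw [T.map_comp, T.map_comp, T.map_comp, T.map_comp] at h9
    -- `hL` and `hR` evaluate the two sides of `mul_left` on this doubly nested sequence. Both end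
    -- in the same `T` of an isomorphism.
    have hL : tmap M.E (fun i => gammaIncl M.E ((graphMonad T).obj G) (y i)) ≫
        gammaIncl M.E (gammaObj M.E ((graphMonad T).obj G)) x ≫
          gammaMulHom M hM ((graphMonad T).obj G) (p 0) (p (Fin.last _)) ≫
            l G (p 0) (p (Fin.last _)) =
        (M.subst n (fun i j => T.obj (homs G (y i) j)) ≫ τ (flat fun i => homs G (y i))) ≫
          T.map (concatCast M.E G x y ≫ gammaIncl M.E G (x.concat y)) := by
      refine (whisker_eq _ (Category.assoc _ _ _).symm).trans ?_
      refine (Category.assoc _ _ _).symm.trans ((eq_whisker h2 _).trans ?_)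
      refine (Category.assoc _ _ _).trans (Eq.trans (whisker_eq _ ?_) (Category.assoc _ _ _).symm)
      refine (Category.assoc _ _ _).trans ((whisker_eq _ h3).trans ?_)
      refine (comp_whisker h4 _).trans ?_
      exact whisker_eq _ (T.map_comp _ _).symm
    have hR : tmap M.E (fun i => gammaIncl M.E ((graphMonad T).obj G) (y i)) ≫
        gammaIncl M.E (gammaObj M.E ((graphMonad T).obj G)) x ≫
          gammaMapHom M.E (X := gammaObj M.E ((graphMonad T).obj G))
            (Y := (graphMonad T).obj (gammaObj M.E G)) ⟨id, l G⟩ _ _ ≫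
          l (gammaObj M.E G) _ _ ≫ T.map (gammaMulHom M hM G (p 0) (p (Fin.last _))) =
        (tmap M.E (fun i => τ (homs G (y i))) ≫
          τ (fun i => (M.E (n i)).obj (homs G (y i))) ≫ T.map (M.subst n fun i => homs G (y i))) ≫
          T.map (concatCast M.E G x y ≫ gammaIncl M.E G (x.concat y)) := by
      refine (whisker_eq _ (comp_whisker h5 _)).trans ?_
      refine (Category.assoc _ _ _).symm.trans ((eq_whisker h6 _).trans ?_)
      refine (Category.assoc _ _ _).trans (Eq.trans (whisker_eq _ ?_) (Category.assoc _ _ _).symm)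
      refine (whisker_eq _ (comp_whisker h7 _)).trans ?_
      refine (comp_whisker h8 _).trans (Eq.trans (whisker_eq _ ?_) (Category.assoc _ _ _).symm)
      exact h9.trans (whisker_eq _ (T.map_comp _ _).symm)
    refine (cancel_mono (T.map (concatCast M.E G x y ≫ gammaIncl M.E G (x.concat y)))).1 ?_
    exact hR.symm.trans ((whisker_eq _ (whisker_eq _ h1.symm)).trans hL)
  · obtain ⟨G, p, rfl, hp, -⟩ := exists_path hM X
    have h1 := hl.unit_right G (p 0) (p (Fin.last n))
    have h2 := gammaIncl_map M.E ((graphMonad T).η.app G) (ObjSeq.ofVtx p)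
    have h3 := hτ G (ObjSeq.ofVtx p)
    refine (cancel_mono (T.map (gammaIncl M.E G (ObjSeq.ofVtx p)))).1 ?_
    refine (Category.assoc _ _ _).trans ((whisker_eq _ h3.symm).trans ?_)
    refine (comp_whisker h2.symm _).trans ?_
    exact (whisker_eq _ h1).trans (T.η.naturality _)
  · obtain ⟨G, p, rfl, hp, -⟩ := exists_path hM X
    have h1 := hl.mul_right G (p 0) (p (Fin.last n))
    have h2 := gammaIncl_map M.E ((graphMonad T).μ.app G) (ObjSeq.ofVtx p)
    have h3 := hτ G (ObjSeq.ofVtx p)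
    have h4 := hτ ((graphMonad T).obj G) (ObjSeq.ofVtx p)
    have h5 := (T.map_comp _ _).symm.trans ((congrArg T.map h3).trans (T.map_comp _ _))
    have h6 := T.μ.naturality (gammaIncl M.E G (ObjSeq.ofVtx p))
    refine (cancel_mono (T.map (gammaIncl M.E G (ObjSeq.ofVtx p)))).1 ?_
    refine (Category.assoc _ _ _).trans ((whisker_eq _ h3.symm).trans ?_)
    refine (comp_whisker h2.symm _).trans ?_
    refine (whisker_eq _ h1).trans ?_
    refine (comp_whisker h4 _).trans ?_
    refine Eq.trans (whisker_eq _ ?_) (Category.assoc _ _ _).symm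
    refine (comp_whisker h5 _).trans ?_
    exact (whisker_eq _ h6).trans (Category.assoc _ _ _).symm

end IsGammaLaw

end Law

/-! ### The bijections between coherences, laws and liftings -/

section Equivalences

variable {V : Type u} [Category.{v} V] [HasCoproducts.{w} V] {M : Multitensor V} {T : Monad V}

theorem ECatStruct.ext_action {G : VGraph.{w} V} {s s' : ECatStruct M G}
    (h : s.toECat.action = s'.toECat.action) : s = s' := by
  have h' : ∀ {a b : G.obj} (x : ObjSeq G.obj a b), s.comp x = s'.comp x := fun {a b} x =>
    (s.toECat.gammaIncl_action x).symm.trans ((whisker_eq _ (VGraph.hom_injective h a b)).trans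
      (s'.toECat.gammaIncl_action x))
  obtain ⟨k, _, _⟩ := s
  obtain ⟨k', _, _⟩ := s'
  obtain rfl : @k = @k' := funext fun a => funext fun b => funext fun x => h' x
  rfl

/-- By `law_action` the law determines the action on `S X` for every `X`, hence all the compositions
of the lifting. -/
theorem LiftingData.eq_of_law_eq (hM : IsDistributive.{w} M.E) {S : Monad (VGraph.{w} V)}
    {L L' : LiftingData M S} (h : L.law hM = L'.law hM) : L = L' :=
  LiftingData.ext_str fun X => ECatStruct.ext_action ((L.law_action hM X).symm.trans
    ((eq_whisker (congrArg (fun d : DistributiveLaw S (gammaMonad M hM) => d.app X.graph) h) _).trans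
      (L'.law_action hM X)))

namespace MonoidalCoherence

/-- Every sequence is the sequence of homs along some path whose inclusion is invertible. -/
theorem eq_of_family_eq (hM : IsDistributive.{w} M.E) {c c' : MonoidalCoherence M T}
    (h : ∀ (G : VGraph.{w} V) {a b : G.obj} (x : ObjSeq G.obj a b),
      c.τ (homs G x) ≫ T.map (gammaIncl M.E G x) = c'.τ (homs G x) ≫ T.map (gammaIncl M.E G x)) :
    c = c' := by
  ext n X
  obtain ⟨G, p, rfl, hp, -⟩ := exists_path hM X
  exact (cancel_mono (T.map (gammaIncl M.E G (ObjSeq.ofVtx p)))).1 (h G (ObjSeq.ofVtx p))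

/-- In Beck's formula, naturality of `τ` moves the unit of `Γ(E)` behind `τ`. There the right unit
law of `Γ(E)`, restricted to one summand, reduces it to the inclusion. -/
theorem law_app (hM : IsDistributive.{w} M.E) (c : MonoidalCoherence M T) (G : VGraph.{w} V) :
    (c.liftingData.law hM).app G =
      ⟨id, fun _ _ => Sigma.desc fun x => c.τ (homs G x) ≫ T.map (gammaIncl M.E G x)⟩ :=
  VGraph.hom_ext fun a b => gamma_hom_ext_one (X := (graphMonad T).obj G) fun x => by
    have h1 := gammaIncl_map M.E ((graphMonad T).map (gammaUnit M G)) x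
    have h2 := (c.liftStruct (ECat.free hM G)).toECat.gammaIncl_action (a := a) (b := b) x
    have h3 := c.natural fun i : Fin x.len =>
      gammaUnitHom M G (x.vtx i.castSucc) (x.vtx i.succ)
    have h4 : tmap M.E (fun i : Fin x.len => gammaUnitHom M G (x.vtx i.castSucc) (x.vtx i.succ)) ≫
        gammaIncl M.E (gammaObj M.E G) x ≫ gammaMulHom M hM G a b = gammaIncl M.E G x := by
      refine (comp_whisker (gammaIncl_map M.E (gammaUnit M G) x).symm _).trans ?_
      exact (whisker_eq _ (gamma_right_unit M hM G a b)).trans (Category.comp_id _)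
    have h5 := (T.map_comp _ _).symm.trans (congrArg T.map h4)
    refine Eq.trans ?_ (Sigma.ι_desc _ _).symm
    refine (comp_whisker h1 _).trans ?_
    refine (whisker_eq _ h2).trans ?_
    refine (comp_whisker h3 _).trans ?_
    exact whisker_eq _ h5

/-- The distributive law of a monoidal monad. -/
noncomputable def toLaw (hM : IsDistributive.{w} M.E) (c : MonoidalCoherence M T) :
    IdOnObjDistributiveLaw.{w} M T hM :=
  ⟨c.liftingData.law hM, fun _ => rfl⟩

theorem toLaw_injective (hM : IsDistributive.{w} M.E) :
    Function.Injective (toLaw hM : MonoidalCoherence M T → _) := fun c c' h =>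
  eq_of_family_eq hM fun G a b x => by
    have h1 : (c.liftingData.law hM).app G = (c'.liftingData.law hM).app G :=
      congrArg (fun d : IdOnObjDistributiveLaw.{w} M T hM => d.1.app G) h
    have h2 := VGraph.hom_injective ((c.law_app hM G).symm.trans (h1.trans (c'.law_app hM G))) a b
    have h3 := Sigma.ι_desc (fun x : ObjSeq G.obj a b =>
      c.τ (homs G x) ≫ T.map (gammaIncl M.E G x)) x
    exact h3.symm.trans ((whisker_eq _ h2).trans (Sigma.ι_desc _ _))

theorem toLaw_surjective (hM : IsDistributive.{w} M.E) :
    Function.Surjective (toLaw hM : MonoidalCoherence M T → _) := fun d => by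
  obtain ⟨l, hl, hd⟩ := exists_isGammaLaw hM d
  obtain ⟨c, hc⟩ := hl.exists_coherence
  refine ⟨c, Subtype.ext (DistributiveLaw.ext (funext fun G => ?_))⟩
  refine (c.law_app hM G).trans (Eq.trans ?_ (hd G).symm)
  exact VGraph.hom_ext fun a b => gamma_hom_ext_one (X := (graphMonad T).obj G) fun x =>
    (Sigma.ι_desc _ _).trans (hc G x).symm

end MonoidalCoherence

/-- Monoidal monads correspond to distributive laws. -/
noncomputable def lawEquiv (hM : IsDistributive.{w} M.E) (T : Monad V) :
    MonoidalCoherence M T ≃ IdOnObjDistributiveLaw.{w} M T hM :=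
  Equiv.ofBijective (MonoidalCoherence.toLaw hM)
    ⟨MonoidalCoherence.toLaw_injective hM, MonoidalCoherence.toLaw_surjective hM⟩

/-- The passage from lifting data to laws is injective, and its composite with the passage from
coherences to lifting data is the bijection `toLaw`. Hence both passages are bijective. -/
theorem liftingData_bijective (hM : IsDistributive.{w} M.E) (T : Monad V) :
    Function.Bijective fun c : MonoidalCoherence M T => c.liftingData.{w}.toLifting := by
  refine ⟨fun c c' h => MonoidalCoherence.toLaw_injective hM (Subtype.ext ?_), fun L => ?_⟩
  · exact congrArg (fun L : LiftingData M (graphMonad T) => L.law hM)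
      (LiftingData.toLifting_injective h)
  · obtain ⟨L, rfl⟩ := LiftingData.toLifting_surjective L
    obtain ⟨c, hc⟩ := MonoidalCoherence.toLaw_surjective hM ⟨L.law hM, fun _ => rfl⟩
    exact ⟨c, congrArg LiftingData.toLifting
      (LiftingData.eq_of_law_eq hM (congrArg Subtype.val hc))⟩

/-- Monoidal monads correspond to liftings. -/
noncomputable def liftingEquiv (hM : IsDistributive.{w} M.E) (T : Monad V) :
    MonoidalCoherence M T ≃ Lifting.{w} M (graphMonad T) :=
  Equiv.ofBijective _ (liftingData_bijective hM T)

end Equivalences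

/-- A fully faithful functor that is bijective on objects is an isomorphism of categories. -/
theorem exists_inverse_of_bijective {C D : Type*} [Category C] [Category D] (Φ : C ⥤ D)
    [Φ.Full] [Φ.Faithful] (h : Function.Bijective Φ.obj) :
    ∃ Ψ : D ⥤ C, Φ ⋙ Ψ = 𝟭 C ∧ Ψ ⋙ Φ = 𝟭 D := by
  let e := Equiv.ofBijective Φ.obj h
  have he : ∀ Y, Φ.obj (e.symm Y) = Y := e.apply_symm_apply
  let Ψ : D ⥤ C :=
    { obj := e.symm
      map := fun {X Y} f => Φ.preimage (eqToHom (he X) ≫ f ≫ eqToHom (he Y).symm)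
      map_id := fun X => Φ.map_injective (by simp)
      map_comp := fun f g => Φ.map_injective (by simp) }
  refine ⟨Ψ, CategoryTheory.Functor.ext (fun X => e.symm_apply_apply X) fun X Y f => Φ.map_injective ?_,
    CategoryTheory.Functor.ext he fun X Y f => Φ.map_preimage _⟩
  refine (Φ.map_preimage _).trans ?_
  exact ((Φ.map_comp _ _).trans ((whisker_eq _ (Φ.map_comp _ _)).trans
    (congrArg₂ (· ≫ ·) (eqToHom_map Φ _) (whisker_eq _ (eqToHom_map Φ _))))).symm

/-! ### Compositions along sequences of length one -/

section ECatLemmas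

variable {V : Type u} [Category.{v} V]

theorem Multitensor.tcast_substLeft (M : Multitensor V) {n : ℕ} {X Y : Fin n → V}
    (h : ∀ i, X i = Y i) :
    tmap M.E (fun _ : Fin 1 => tcast M.E rfl h) ≫ M.substLeft Y =
      M.substLeft X ≫ tcast M.E rfl h := by
  obtain rfl : X = Y := funext h
  exact (eq_whisker (tmap_id M.E _) _).trans
    ((Category.id_comp _).trans (Category.comp_id _).symm)

namespace ECat

variable {M : Multitensor V}

/-- An `E`-functor whose graph map is an identity forces the two families of compositions to agree.
-/
theorem eq_of_hom {X Y : ECat.{w} M} (f : X ⟶ Y) (h : X.graph = Y.graph)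
    (hf : f.toHom = eqToHom h) : X = Y := by
  obtain ⟨G, k, _, _⟩ := X
  obtain ⟨G', k', _, _⟩ := Y
  dsimp only at h
  subst h
  have hk : ∀ {a b : G.obj} (x : ObjSeq G.obj a b), k x = k' x := fun {a b} x => by
    have := f.comm x
    rw [hf] at this
    exact (Category.comp_id _).symm.trans (this.trans
      ((eq_whisker (tmap_id M.E _) _).trans (Category.id_comp _)))
  obtain rfl : @k = @k' := funext fun a => funext fun b => funext fun x => hk x
  rfl

theorem comp_congr (X : ECat.{w} M) {a b : X.graph.obj} {x y : ObjSeq X.graph.obj a b}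
    (h : x = y) (hl : x.len = y.len) (hX : ∀ i, homs X.graph x i = homs X.graph y (Fin.cast hl i)) :
    tcast M.E hl hX ≫ X.comp y = X.comp x := by
  subst h
  exact Category.id_comp _

theorem comp_copy (X : ECat.{w} M) {a b a' b' : X.graph.obj} (x : ObjSeq X.graph.obj a b)
    (ha : a = a') (hb : b = b') (h : X.graph.hom a b = X.graph.hom a' b') :
    X.comp x ≫ eqToHom h = X.comp (x.copy ha hb) := by
  subst ha hb
  exact Category.comp_id _

/-- Associativity of composition for an outer sequence of length one. `map_single_comp` is the case
in which all inner sequences have length one. -/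
theorem map_comp_single (X : ECat.{w} M) {a b : X.graph.obj} (x : ObjSeq X.graph.obj a b) :
    tmap M.E (fun _ : Fin 1 => X.comp x) ≫ singleCast M.E X.graph a b ≫ X.comp (ObjSeq.single a b) =
      M.substLeft (homs X.graph x) ≫ X.comp x := by
  let y : (ObjSeq.single a b).Inner := fun i =>
    x.copy (ObjSeq.single_castSucc a b i).symm (ObjSeq.single_succ a b i).symm
  have h2 : tmap M.E (fun _ : Fin 1 => X.comp x) ≫ singleCast M.E X.graph a b =
      tmap M.E (fun i => X.comp (y i)) := by
    refine (tcast_tmap M.E (X := fun _ : Fin 1 => seqTensor M.E X.graph x)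
      (Y := fun i => seqTensor M.E X.graph (y i)) rfl (fun _ => rfl) _ _
      (fun i => X.comp (y i)) fun i => ?_).trans (Category.id_comp _)
    exact (X.comp_copy x (ObjSeq.single_castSucc a b i).symm
      (ObjSeq.single_succ a b i).symm _).trans (Category.id_comp _).symm
  have h3 := X.subst_comp (ObjSeq.single a b) y
  have hl : ∑ _i : Fin 1, x.len = x.len := by simp
  have hX := homs_congr X.graph (ObjSeq.concat_single_left x) hl
  have h5 := X.comp_congr (ObjSeq.concat_single_left x) hl hX
  have h6 : concatCast M.E X.graph (ObjSeq.single a b) y ≫ tcast M.E hl hX =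
      tcast M.E hl (flat_unit_left (homs X.graph x)) := tcast_trans M.E _ _ _ _
  refine (Category.assoc _ _ _).symm.trans ((eq_whisker h2 _).trans ?_)
  refine h3.trans ?_
  refine (whisker_eq _ (whisker_eq _ h5.symm)).trans ?_
  refine (whisker_eq _ ((Category.assoc _ _ _).symm.trans (eq_whisker h6 _))).trans ?_
  exact (Category.assoc _ _ _).symm

theorem map_single_comp (X : ECat.{w} M) {a b : X.graph.obj} (x : ObjSeq X.graph.obj a b) :
    tmap M.E (fun i : Fin x.len => singleCast M.E X.graph (x.vtx i.castSucc) (x.vtx i.succ) ≫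
        X.comp (ObjSeq.single (x.vtx i.castSucc) (x.vtx i.succ))) ≫ X.comp x =
      M.substRight (homs X.graph x) ≫ X.comp x := by
  let y : x.Inner := fun i => ObjSeq.single (x.vtx i.castSucc) (x.vtx i.succ)
  have h2 := tmap_comp M.E
    (fun i : Fin x.len => singleCast M.E X.graph (x.vtx i.castSucc) (x.vtx i.succ))
    (fun i => X.comp (y i))
  have h3 := X.subst_comp x y
  have hl : ∑ _i : Fin x.len, 1 = x.len := by simp
  have hX := homs_congr X.graph (ObjSeq.concat_single_right x) hl
  have h5 := X.comp_congr (ObjSeq.concat_single_right x) hl hX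
  have hS : ∀ i (j : Fin 1), homs X.graph x i = homs X.graph (y i) j := fun i j =>
    (congrArg₂ X.graph.hom (ObjSeq.single_castSucc (x.vtx i.castSucc) (x.vtx i.succ) j)
      (ObjSeq.single_succ (x.vtx i.castSucc) (x.vtx i.succ) j)).symm
  have h6 : tmap M.E (fun i => singleCast M.E X.graph (x.vtx i.castSucc) (x.vtx i.succ)) ≫
        M.subst (fun i => (y i).len) (fun i => homs X.graph (y i)) =
      M.subst (fun _ => 1) (fun i _ => homs X.graph x i) ≫
        tcast M.E rfl (fun l => hS _ (finSigmaFinEquiv.symm l).2) := by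
    refine (eq_whisker (tmap_eqToHom M.E (fun i => tobj_congr M.E rfl (hS i))) _).trans ?_
    exact subst_tcast (E := M.E) M.subst rfl (n := fun _ => 1) (n' := fun i => (y i).len)
      (fun _ => rfl) hS _ rfl _
  have h7 : tcast M.E rfl (fun l => hS _ (finSigmaFinEquiv.symm l).2) ≫
      concatCast M.E X.graph x y ≫ tcast M.E hl hX =
        tcast M.E hl (flat_unit_right (homs X.graph x)) :=
    (whisker_eq _ (tcast_trans M.E _ _ _ _)).trans (tcast_trans M.E _ _ _ _)
  refine (eq_whisker h2.symm _).trans ?_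
  refine (Category.assoc _ _ _).trans ((whisker_eq _ h3).trans ?_)
  refine (comp_whisker h6 _).trans ?_
  refine (whisker_eq _ (whisker_eq _ (whisker_eq _ h5.symm))).trans ?_
  refine (whisker_eq _ (whisker_eq _ (Category.assoc _ _ _).symm)).trans ?_
  refine (whisker_eq _ ((Category.assoc _ _ _).symm.trans (eq_whisker h7 _))).trans ?_
  exact (Category.assoc _ _ _).symm

theorem singleCast_map_comp (X : ECat.{w} M) {G : VGraph.{w} V} (f : G ⟶ X.graph) (a b : G.obj) :
    singleCast M.E G a b ≫ seqTensorMap M.E f (ObjSeq.single a b) ≫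
        X.comp ((ObjSeq.single a b).map f.obj) =
      tmap M.E (fun _ : Fin 1 => f.hom a b) ≫ singleCast M.E X.graph (f.obj a) (f.obj b) ≫
        X.comp (ObjSeq.single (f.obj a) (f.obj b)) := by
  have hmap : (ObjSeq.single a b).map f.obj = ObjSeq.single (f.obj a) (f.obj b) :=
    ObjSeq.ext_of rfl fun i => (congrArg f.obj (ObjSeq.single_succ a b i)).trans
      (ObjSeq.single_succ (f.obj a) (f.obj b) i).symm
  have hU : ∀ i : Fin 1, X.graph.hom (f.obj a) (f.obj b) =
      homs X.graph ((ObjSeq.single a b).map f.obj) i := fun i => congrArg₂ X.graph.hom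
    (congrArg f.obj (ObjSeq.single_castSucc a b i)).symm
    (congrArg f.obj (ObjSeq.single_succ a b i)).symm
  have hV := homs_congr X.graph hmap rfl
  have h2 : tmap M.E (fun _ : Fin 1 => f.hom a b) ≫ tcast M.E rfl hU =
      singleCast M.E G a b ≫ seqTensorMap M.E f (ObjSeq.single a b) :=
    tcast_tmap M.E rfl _ _ _ _ fun i => VGraph.hom_eqToHom f
      (ObjSeq.single_castSucc a b i).symm (ObjSeq.single_succ a b i).symm _ _
  have h3 := X.comp_congr hmap rfl hV
  have h4 : tcast M.E rfl hU ≫ tcast M.E rfl hV = singleCast M.E X.graph (f.obj a) (f.obj b) :=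
    tcast_trans M.E _ _ _ _
  refine (Category.assoc _ _ _).symm.trans ((eq_whisker h2.symm _).trans ?_)
  refine (Category.assoc _ _ _).trans (whisker_eq _ ?_)
  refine (whisker_eq _ h3.symm).trans ?_
  exact (Category.assoc _ _ _).symm.trans (eq_whisker h4 _)

end ECat

end ECatLemmas

/-! ### Categories enriched in `TE` as algebras for the lifted monad -/

section Algebras

variable {V : Type u} [Category.{v} V] {M : Multitensor V} {T : Monad V}

namespace CompositeMultitensor

variable (s : CompositeMultitensor M T)

/-- The `E`-category underlying a category enriched in `T E`. -/
def restrict (X : ECat.{w} s.toMultitensor) : ECat.{w} M where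
  graph := X.graph
  comp x := T.η.app ((M.E x.len).obj (homs X.graph x)) ≫ X.comp x
  unit_comp a b := by
    have h1 := T.η.naturality (singleCast M.E X.graph a b)
    have h2 := X.unit_comp a b
    have h3 : singleCast s.toMultitensor.E X.graph a b = T.map (singleCast M.E X.graph a b) :=
      tcast_compTensor _ _
    rw [h3] at h2
    refine (whisker_eq _ (comp_whisker h1 _)).trans ?_
    exact (Category.assoc _ _ _).symm.trans h2
  subst_comp x y := by
    have h1 := s.isMultitensorMap.subst (fun i => (y i).len) (fun i => homs X.graph (y i))
    have h2 := X.subst_comp x y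
    have h3 : concatCast s.toMultitensor.E X.graph x y = T.map (concatCast M.E X.graph x y) :=
      tcast_compTensor _ _
    have h4 := T.η.naturality (concatCast M.E X.graph x y)
    rw [h3] at h2
    have h5 : tmap M.E (fun i => T.η.app ((M.E (y i).len).obj (homs X.graph (y i))) ≫ X.comp (y i)) =
        tmap M.E (fun i => T.η.app ((M.E (y i).len).obj (homs X.graph (y i)))) ≫
          tmap M.E (fun i => X.comp (y i)) := (tmap_comp M.E _ _).symm
    have h6 := T.η.naturality (tmap M.E fun i => X.comp (y i))
    refine (eq_whisker h5 _).trans ?_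
    refine (Category.assoc _ _ _).trans ?_
    refine (whisker_eq _ (comp_whisker h6 _)).trans ?_
    refine (whisker_eq _ (whisker_eq _ h2)).trans ?_
    refine Eq.trans ?_ (whisker_eq _ (comp_whisker h4 _)).symm
    refine Eq.trans ?_ (comp_whisker h1.symm _)
    exact whisker_eq _ (Category.assoc _ _ _).symm

/-- The action of `T` on the homs of a category enriched in `T E`. -/
def homAction (X : ECat.{w} s.toMultitensor) (a b : X.graph.obj) :
    T.obj (X.graph.hom a b) ⟶ X.graph.hom a b :=
  s.inl (X.graph.hom a b) ≫ singleCast s.toMultitensor.E X.graph a b ≫ X.comp (ObjSeq.single a b)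

theorem η_homAction (X : ECat.{w} s.toMultitensor) (a b : X.graph.obj) :
    T.η.app (X.graph.hom a b) ≫ s.homAction X a b = 𝟙 _ :=
  (Category.assoc _ _ _).symm.trans ((eq_whisker (s.η_inl _) _).trans (X.unit_comp a b))

theorem map_comp_homAction (X : ECat.{w} s.toMultitensor) {a b : X.graph.obj}
    (x : ObjSeq X.graph.obj a b) :
    T.map (X.comp x) ≫ s.homAction X a b =
      s.inl (seqTensor s.toMultitensor.E X.graph x) ≫
        s.toMultitensor.substLeft (homs X.graph x) ≫ X.comp x :=
  (comp_whisker (s.inl_natural (X.comp x)) _).trans (whisker_eq _ (X.map_comp_single x))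

/-- Acting by `T` on a composite is a substitution along `Tu` by `map_comp_homAction`. With the `η`
of the restriction it forms the middle unit law. A `TE`-category is therefore determined by its
`E`-composition and its `T`-action. -/
theorem map_restrict_comp (X : ECat.{w} s.toMultitensor) {a b : X.graph.obj}
    (x : ObjSeq X.graph.obj a b) :
    T.map ((s.restrict X).comp x) ≫ s.homAction X a b = X.comp x := by
  have h1 := s.map_comp_homAction X x
  have h2 := s.inl_η (homs X.graph x)
  have h3 := s.inl_natural (T.η.app ((M.E x.len).obj (homs X.graph x)))
  refine (eq_whisker (T.map_comp _ _) _).trans ?_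
  refine (Category.assoc _ _ _).trans ((whisker_eq _ h1).trans ?_)
  refine (comp_whisker h3 _).trans ?_
  refine (whisker_eq _ (Category.assoc _ _ _).symm).trans ?_
  refine (Category.assoc _ _ _).symm.trans ?_
  exact (eq_whisker h2 _).trans (Category.id_comp _)

/-- Associativity of composition for singletons merges the two actions into a substitution of two
copies of `Tu`, which `inl_inl` identifies with `μ`. -/
theorem μ_homAction (X : ECat.{w} s.toMultitensor) (a b : X.graph.obj) :
    T.μ.app (X.graph.hom a b) ≫ s.homAction X a b =
      T.map (s.homAction X a b) ≫ s.homAction X a b := by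
  let S := s.toMultitensor
  let A := X.graph.hom a b
  have h1 := s.inl_inl A
  have h2 := S.tcast_substLeft (X := fun _ : Fin 1 => A)
    (Y := homs X.graph (ObjSeq.single a b)) fun i => (congrArg₂ X.graph.hom
      (ObjSeq.single_castSucc a b i) (ObjSeq.single_succ a b i)).symm
  have h3 := X.map_comp_single (ObjSeq.single a b)
  have h4 : tmap S.E (fun _ : Fin 1 => s.homAction X a b) =
      tmap S.E (fun _ => s.inl A) ≫ tmap S.E (fun _ => singleCast S.E X.graph a b) ≫
        tmap S.E (fun _ => X.comp (ObjSeq.single a b)) := tmap_comp₂ S.E _ _ _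
  have h5 := s.inl_natural (s.homAction X a b)
  refine Eq.trans ?_ (comp_whisker h5 _).symm
  refine Eq.trans ?_ (whisker_eq _ (eq_whisker h4 _)).symm
  refine Eq.trans ?_ (whisker_eq _ ((Category.assoc _ _ _).trans
    (whisker_eq _ (Category.assoc _ _ _)))).symm
  refine Eq.trans ?_ (whisker_eq _ (whisker_eq _ (whisker_eq _ h3))).symm
  refine Eq.trans ?_ (whisker_eq _ (whisker_eq _ (comp_whisker h2 _))).symm
  refine Eq.trans ?_ (whisker_eq _ (Category.assoc _ _ _))
  refine Eq.trans ?_ (Category.assoc _ _ _)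
  exact (Category.assoc _ _ _).symm.trans (eq_whisker h1.symm _)

end CompositeMultitensor

namespace MonoidalCoherence

variable (c : MonoidalCoherence M T)

/-- The action of `T` on the homs of a category enriched in `T E` consists of `E`-functors. -/
theorem homAction_comm (X : ECat.{w} c.composite.toMultitensor) {a b : X.graph.obj}
    (x : ObjSeq X.graph.obj a b) :
    (c.τ (homs X.graph x) ≫ T.map ((c.composite.restrict X).comp x)) ≫ c.composite.homAction X a b =
      tmap M.E (fun i => c.composite.homAction X (x.vtx i.castSucc) (x.vtx i.succ)) ≫
        (c.composite.restrict X).comp x := by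
  -- This reduces the left side to `τ` followed by the `TE`-composition. On the right side,
  -- associativity for singleton inner sequences produces the expression for `τ` in `composite_τ`.
  have h1 := c.composite.map_restrict_comp X x
  have h2 := X.map_single_comp x
  have h3 := c.composite_τ (homs X.graph x)
  have h4 : tmap M.E (fun i => c.composite.homAction X (x.vtx i.castSucc) (x.vtx i.succ)) =
      tmap M.E (fun i => T.map (M.unit (homs X.graph x i))) ≫
        tmap M.E (fun i : Fin x.len => singleCast c.composite.toMultitensor.E X.graph
          (x.vtx i.castSucc) (x.vtx i.succ) ≫
            X.comp (ObjSeq.single (x.vtx i.castSucc) (x.vtx i.succ))) := (tmap_comp M.E _ _).symm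
  have h5 := T.η.naturality (tmap M.E fun i : Fin x.len =>
    singleCast c.composite.toMultitensor.E X.graph (x.vtx i.castSucc) (x.vtx i.succ) ≫
      X.comp (ObjSeq.single (x.vtx i.castSucc) (x.vtx i.succ)))
  have h6 := T.η.naturality (tmap M.E fun i => T.map (M.unit (homs X.graph x i)))
  refine (Category.assoc _ _ _).trans ((whisker_eq _ h1).trans ?_)
  refine Eq.trans ?_ (eq_whisker h4 _).symm
  refine Eq.trans ?_ (Category.assoc _ _ _).symm
  refine Eq.trans ?_ (whisker_eq _ (comp_whisker h5 _)).symm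
  refine Eq.trans ?_ (whisker_eq _ (whisker_eq _ h2)).symm
  refine Eq.trans ?_ (comp_whisker h6 _).symm
  refine (eq_whisker h3.symm _).trans ?_
  exact (Category.assoc _ _ _).trans (whisker_eq _ (Category.assoc _ _ _))

variable {c} in
/-- An algebra for the lifted monad whose structure map is the identity on objects. -/
def algebraOf (Y : ECat.{w} M) (act : ∀ a b, T.obj (Y.graph.hom a b) ⟶ Y.graph.hom a b)
    (unit : ∀ a b, T.η.app (Y.graph.hom a b) ≫ act a b = 𝟙 _)
    (assoc : ∀ a b, T.μ.app (Y.graph.hom a b) ≫ act a b = T.map (act a b) ≫ act a b)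
    (comm : ∀ {a b : Y.graph.obj} (x : ObjSeq Y.graph.obj a b),
      (c.τ (homs Y.graph x) ≫ T.map (Y.comp x)) ≫ act a b =
        tmap M.E (fun i => act (x.vtx i.castSucc) (x.vtx i.succ)) ≫ Y.comp x) :
    c.liftingData.{w}.monad.Algebra where
  A := Y
  a := ⟨⟨id, act⟩, fun x => comm x⟩
  unit := ECat.Hom.ext (VGraph.hom_ext fun a b => unit a b)
  assoc := ECat.Hom.ext (VGraph.hom_ext fun a b => assoc a b)

theorem exists_algebraOf (A : c.liftingData.{w}.monad.Algebra) :
    ∃ act unit assoc comm, A = algebraOf (c := c) A.A act unit assoc comm := by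
  obtain ⟨Y, ⟨a, ha⟩, hu, hm⟩ := A
  -- The unit law forces the structure map to be the identity on objects, because `η` is.
  have h0 : a.obj = id := congrArg (fun f : Y ⟶ Y => f.toHom.obj) hu
  obtain ⟨act, rfl⟩ := VGraph.exists_eq_mk (X := (graphMonad T).obj Y.graph) (Y := Y.graph) a h0
  have h1 := VGraph.hom_injective (X := Y.graph) (Y := Y.graph) (φ := id)
    (congrArg (fun f : Y ⟶ Y => f.toHom) hu)
  have h2 := VGraph.hom_injective (X := (graphMonad T).obj ((graphMonad T).obj Y.graph))
    (Y := Y.graph) (φ := id) (congrArg ECat.Hom.toHom hm)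
  exact ⟨act, h1, h2, fun x => ha x, rfl⟩

/-- A category enriched in the composite multitensor, as an algebra for the lifted monad. -/
def toAlgebra (X : ECat.{w} c.composite.toMultitensor) : c.liftingData.{w}.monad.Algebra :=
  algebraOf (c.composite.restrict X) (c.composite.homAction X) (c.composite.η_homAction X)
    (c.composite.μ_homAction X) (c.homAction_comm X)

/-- The comparison functor from categories enriched in the composite multitensor to algebras for
the lifted monad. -/
def comparison : ECat.{w} c.composite.toMultitensor ⥤ c.liftingData.{w}.monad.Algebra where
  obj := c.toAlgebra
  map {X Y} f :=
    { f := ⟨f.toHom, fun x => by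
        have h1 := f.comm x
        have h2 := T.η.naturality (tmap M.E (X := homs X.graph x)
          (Y := homs Y.graph (x.map f.toHom.obj)) fun _ => f.toHom.hom _ _)
        refine (Category.assoc _ _ _).trans ((whisker_eq _ h1).trans ?_)
        exact comp_whisker h2.symm _⟩
      h := ECat.Hom.ext (VGraph.hom_ext fun a b => by
        have h1 := c.composite.inl_natural (f.toHom.hom a b)
        have h2 := f.comm (ObjSeq.single a b)
        have h3 := Y.singleCast_map_comp f.toHom a b
        refine (comp_whisker h1 _).trans ?_
        refine (whisker_eq _ h3.symm).trans ?_
        refine (whisker_eq _ (whisker_eq _ h2.symm)).trans ?_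
        exact (whisker_eq _ (Category.assoc _ _ _).symm).trans (Category.assoc _ _ _).symm) }
  map_id _ := Monad.Algebra.Hom.ext rfl
  map_comp _ _ := Monad.Algebra.Hom.ext rfl

instance : c.comparison.{w}.Faithful where
  map_injective h := ECat.Hom.ext
    (congrArg (fun f : Monad.Algebra.Hom _ _ => ECat.Hom.toHom f.f) h)

/-- A map of algebras commutes with the `E`-compositions and with the `T`-actions, and
`map_restrict_comp` builds the `TE`-composition from these two. -/
instance : c.comparison.{w}.Full where
  map_surjective {X Y} g := by
    have hg : ∀ a b, T.map (g.f.toHom.hom a b) ≫ c.composite.homAction Y _ _ =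
        c.composite.homAction X a b ≫ g.f.toHom.hom a b :=
      VGraph.hom_injective (X := (graphMonad T).obj X.graph) (Y := Y.graph) (φ := g.f.toHom.obj)
        (congrArg ECat.Hom.toHom g.h)
    refine ⟨⟨g.f.toHom, fun {a b} x => ?_⟩, rfl⟩
    have h1 := c.composite.map_restrict_comp X x
    have h2 := c.composite.map_restrict_comp Y (x.map g.f.toHom.obj)
    have h3 := congrArg T.map (g.f.comm x)
    rw [T.map_comp, T.map_comp] at h3
    refine (eq_whisker h1.symm _).trans ?_
    refine (Category.assoc _ _ _).trans ((whisker_eq _ (hg a b).symm).trans ?_)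
    refine (comp_whisker h3 _).trans ?_
    exact whisker_eq _ h2

/-- By fullness an equality of images lifts to a `TE`-functor whose graph map is an `eqToHom`, and
`ECat.eq_of_hom` applies. -/
theorem comparison_obj_injective : Function.Injective c.comparison.{w}.obj := fun X Y h => by
  have h1 := eqToHom_map (Monad.forget _ ⋙ ECat.forget M) h
  exact ECat.eq_of_hom (c.comparison.preimage (eqToHom h))
    (congrArg (fun A : c.liftingData.{w}.monad.Algebra => A.A.graph) h)
    ((congrArg (Monad.forget _ ⋙ ECat.forget M).map (c.comparison.map_preimage (eqToHom h))).trans h1)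

/-- The category enriched in the composite multitensor given by an algebra for the lifted monad. -/
def ofAlgebra (Y : ECat.{w} M) (act : ∀ a b, T.obj (Y.graph.hom a b) ⟶ Y.graph.hom a b)
    (unit : ∀ a b, T.η.app (Y.graph.hom a b) ≫ act a b = 𝟙 _)
    (assoc : ∀ a b, T.μ.app (Y.graph.hom a b) ≫ act a b = T.map (act a b) ≫ act a b)
    (comm : ∀ {a b : Y.graph.obj} (x : ObjSeq Y.graph.obj a b),
      (c.τ (homs Y.graph x) ≫ T.map (Y.comp x)) ≫ act a b =
        tmap M.E (fun i => act (x.vtx i.castSucc) (x.vtx i.succ)) ≫ Y.comp x) :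
    ECat.{w} c.composite.toMultitensor where
  graph := Y.graph
  comp {a b} x := T.map (Y.comp x) ≫ act a b
  unit_comp a b := by
    have h1 := T.η.naturality (singleCast M.E Y.graph a b ≫ Y.comp (ObjSeq.single a b))
    have h2 := Y.unit_comp a b
    have h3 : singleCast c.composite.toMultitensor.E Y.graph a b =
      T.map (singleCast M.E Y.graph a b) := tcast_compTensor _ _
    rw [h3]
    refine (whisker_eq _ (Category.assoc _ _ _).symm).trans ?_
    refine (whisker_eq _ (eq_whisker (T.map_comp _ _).symm _)).trans ?_
    refine (Category.assoc _ _ _).trans ((whisker_eq _ (comp_whisker h1.symm _)).trans ?_)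
    refine (whisker_eq _ (whisker_eq _ (unit a b))).trans ?_
    exact (whisker_eq _ (Category.comp_id _)).trans h2
  subst_comp {a b} x y := by
    have h1 : tmap c.composite.toMultitensor.E
          (fun i => T.map (Y.comp (y i)) ≫ act (x.vtx i.castSucc) (x.vtx i.succ)) =
        T.map (tmap M.E fun i => T.map (Y.comp (y i))) ≫
          T.map (tmap M.E fun i => act (x.vtx i.castSucc) (x.vtx i.succ)) :=
      (congrArg T.map (tmap_comp M.E _ _).symm).trans (T.map_comp _ _)
    have h2 := congrArg T.map (comm x)
    rw [T.map_comp, T.map_comp, T.map_comp] at h2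
    have h3 := congrArg T.map (c.natural fun i => Y.comp (y i))
    rw [T.map_comp, T.map_comp] at h3
    have h4 := T.μ.naturality (Y.comp x)
    have h5 := T.μ.naturality (tmap M.E fun i => Y.comp (y i))
    have h6 := congrArg T.map (Y.subst_comp x y)
    rw [T.map_comp, T.map_comp, T.map_comp] at h6
    have h7 : concatCast c.composite.toMultitensor.E Y.graph x y =
      T.map (concatCast M.E Y.graph x y) := tcast_compTensor _ _
    rw [h7]
    refine (eq_whisker h1 _).trans ?_
    refine (Category.assoc _ _ _).trans ?_
    -- The action is an `E`-functor, so the inner actions can be carried past the outer composition.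
    -- There they meet the outer action, and associativity of the action replaces the pair by `μ`
    -- and a single action.
    refine (whisker_eq _ (comp_whisker h2.symm _)).trans ?_
    refine (whisker_eq _ ((Category.assoc _ _ _).trans
      (whisker_eq _ (whisker_eq _ (assoc a b).symm)))).trans ?_
    refine (whisker_eq _ (whisker_eq _ (comp_whisker h4 _))).trans ?_
    refine (comp_whisker h3 _).trans ?_
    refine (whisker_eq _ (comp_whisker h5 _)).trans ?_
    refine (whisker_eq _ (whisker_eq _ (comp_whisker h6 _))).trans ?_
    refine (whisker_eq _ (whisker_eq _ (whisker_eq _ (Category.assoc _ _ _)))).trans ?_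
    exact (whisker_eq _ (Category.assoc _ _ _).symm).trans (Category.assoc _ _ _).symm

theorem comparison_obj_surjective : Function.Surjective c.comparison.{w}.obj := fun A => by
  obtain ⟨act, unit, assoc, comm, h⟩ := c.exists_algebraOf A
  -- The carrier has to be a variable before `A` can be replaced by its canonical form, since that
  -- form mentions it.
  generalize A.A = Y at act unit assoc comm h
  subst h
  let X := c.ofAlgebra Y act unit assoc comm
  have hk : ∀ {a b : Y.graph.obj} (x : ObjSeq Y.graph.obj a b),
      (c.composite.restrict X).comp x = Y.comp x := fun {a b} x => by
    refine (comp_whisker (T.η.naturality (Y.comp x)).symm _).trans ?_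
    exact (whisker_eq _ (unit a b)).trans (Category.comp_id _)
  have ha : c.composite.homAction X = act := funext fun a => funext fun b => by
    have h1 := congrArg T.map (Y.unit_comp a b)
    rw [T.map_comp, T.map_comp, T.map_id] at h1
    have h2 : singleCast c.composite.toMultitensor.E Y.graph a b =
      T.map (singleCast M.E Y.graph a b) := tcast_compTensor _ _
    refine (whisker_eq _ (eq_whisker h2 _)).trans ?_
    refine (whisker_eq _ (Category.assoc _ _ _).symm).trans ?_
    refine (Category.assoc _ _ _).symm.trans ?_
    exact (eq_whisker h1 _).trans (Category.id_comp _)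
  -- The compositions and the action are abstracted so that `hk` and `ha` can be substituted. The
  -- accompanying laws are propositions and then agree automatically.
  have aux : ∀ (k : ∀ {a b : Y.graph.obj} (x : ObjSeq Y.graph.obj a b), _) (_ : @k = @Y.comp)
      (act' : ∀ a b, T.obj (Y.graph.hom a b) ⟶ Y.graph.hom a b) (_ : act' = act) hu hs u' a' c',
      algebraOf (c := c) (⟨Y.graph, k, hu, hs⟩ : ECat.{w} M) act' u' a' c' =
        algebraOf Y act unit assoc comm := by
    rintro _ rfl _ rfl _ _ _ _ _
    rfl
  exact ⟨X, aux _ (funext fun a => funext fun b => funext fun x => hk x) _ ha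
    (c.composite.restrict X).unit_comp (c.composite.restrict X).subst_comp
    (c.composite.η_homAction X) (c.composite.μ_homAction X) (c.homAction_comm X)⟩

theorem exists_inverse_comparison : ∃ Ψ : c.liftingData.{w}.monad.Algebra ⥤
    ECat.{w} c.composite.toMultitensor,
    c.comparison ⋙ Ψ = 𝟭 _ ∧ Ψ ⋙ c.comparison = 𝟭 _ :=
  exists_inverse_of_bijective c.comparison
    ⟨c.comparison_obj_injective, c.comparison_obj_surjective⟩

end MonoidalCoherence

end Algebras

end EnrichedMultitensor

theorem mainTheorem5 {V : Type u} [Category.{v} V] (M : Multitensor V) (T : Monad V) :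
    ∃ e₁₂ : MonoidalCoherence M T ≃ CompositeMultitensor M T,
      (∀ (c : MonoidalCoherence M T) {m : ℕ} (n : Fin m → ℕ) (Z : ∀ i, Fin (n i) → V),
        (e₁₂ c).subst n Z =
          T.map (c.τ fun i => (M.E (n i)).obj (Z i)) ≫ T.μ.app _ ≫ T.map (M.subst n Z)) ∧
      ∀ [HasCoproducts.{w} V] (hM : IsDistributive.{w} M.E),
        ∃ (e₁₃ : MonoidalCoherence M T ≃ IdOnObjDistributiveLaw.{w} M T hM)
          (e₁₄ : MonoidalCoherence M T ≃ Lifting.{w} M (graphMonad.{w} T)),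
          (∀ (c : MonoidalCoherence M T) (X : VGraph.{w} V),
            (e₁₃ c).1.app X =
              ⟨id, fun _ _ => Sigma.desc fun x => c.τ (homs X x) ≫ T.map (gammaIncl M.E X x)⟩) ∧
          (∀ (c : MonoidalCoherence M T) (X : ECat.{w} M), ∃ hu hs,
            (e₁₄ c).monad.obj X =
              ⟨(graphMonad T).obj X.graph,
                fun x => c.τ (homs X.graph x) ≫ T.map (X.comp x), hu, hs⟩) ∧
          ∀ c : MonoidalCoherence M T,
            ∃ (Φ : ECat.{w} (e₁₂ c).toMultitensor ⥤ (e₁₄ c).monad.Algebra)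
              (Ψ : (e₁₄ c).monad.Algebra ⥤ ECat.{w} (e₁₂ c).toMultitensor),
              Φ ⋙ Ψ = 𝟭 _ ∧ Ψ ⋙ Φ = 𝟭 _ ∧
              Φ ⋙ Monad.forget _ ⋙ ECat.forget M = ECat.forget (e₁₂ c).toMultitensor := by
  refine ⟨compositeEquiv M T, fun c m n Z => rfl, fun hM => ?_⟩
  -- The formula for `λ` is `law_app`. Those for `σ'` and `T'`, and the compatibility with the
  -- forgetful functors, hold by definition.
  refine ⟨lawEquiv hM T, liftingEquiv hM T, fun c G => c.law_app hM G, fun c X =>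
    ⟨(c.liftStruct X).unit_comp, (c.liftStruct X).subst_comp, rfl⟩, fun c => ?_⟩
  obtain ⟨Ψ, h₁, h₂⟩ := c.exists_inverse_comparison
  exact ⟨c.comparison, Ψ, h₁, h₂, rfl⟩
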